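/- Let $k$ be a field and let $C$ be a smooth projective irreducible curve over $k$ with a $k$-rational point and of genus $g = \dim_k H^1(C, \mathcal{O}_C) = 0$ (so that $C \cong \mathbb{P}^1_k$). For a field $K \supseteq k$ write $C_K := C \otimes_k K$. Then the following hold. (a) For every field $K \supseteq k$, every vector bundle over $C_K$ is defined over $k$: it is isomorphic to the pullback of a vector bundle over $C$. (b) For all integers $r \geq 1$ and $d$, the moduli stack $\mathrm{Bun}_{C,r,d}$ of vector bundles of rank $r$ and degree $d$ over $C$ satisfies $$\mathrm{ed}_k(\mathrm{Bun}_{C,r,d}) = 0.$$ Here $\mathrm{ed}_k(\mathrm{Bun}_{C,r,d}) := \sup_{K, E} \mathrm{ed}_k(E)$, where the supremum is over all fields $K \supseteq k$ and all vector bundles $E$ of rank $r$ and degree $d$ over $C_K$ (and is $-\infty$ if there are none), and $\mathrm{ed}_k(E) := \inf_{K'} \mathrm{trdeg}_k K'$, where the infimum is over all intermediate fields $k \subseteq K' \subseteq K$ such that $E$ is defined over $K'$, that is, $E \cong E' \otimes_{K'} K$ for some vector bundle $E'$ of rank $r$ and degree $d$ over $C_{K'}$. -/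

import Mathlib

open CategoryTheory AlgebraicGeometry TopologicalSpace

universe u

noncomputable section

namespace CurveBundles

/-! ### Cohomology of modules over a `k`-scheme, and the genus -/

section Cohomology

variable {k : Type u} [Field k] {X : Scheme.{u}}

/-- The ring homomorphism `k → Γ(X, U)` of a `k`-scheme `f : X ⟶ Spec k`. -/
def scalars (f : X ⟶ Spec (.of k)) (U : X.Opens) : k →+* Γ(X, U) :=
  ((Scheme.ΓSpecIso (.of k)).inv ≫ f.appTop ≫
    X.presheaf.map (homOfLE (le_top : U ≤ ⊤)).op).hom

lemma map_scalars (f : X ⟶ Spec (.of k)) {U V : X.Opens} (i : U ⟶ V) (a : k) :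
    X.presheaf.map i.op (scalars f V a) = scalars f U a := by
  have h : X.presheaf.map (homOfLE (le_top : V ≤ ⊤)).op ≫ X.presheaf.map i.op =
      X.presheaf.map (homOfLE (le_top : U ≤ ⊤)).op := by
    rw [← Functor.map_comp]
    rfl
  simp only [scalars, ← h]
  rfl

/-- The sheaf of abelian groups underlying an `𝒪_X`-module. -/
def abSheaf (E : X.Modules) : Sheaf (Opens.grothendieckTopology X) AddCommGrpCat.{u} :=
  ⟨E.presheaf, E.isSheaf⟩

/-- Multiplication by a scalar `a : k`, as an endomorphism of the underlying abelian sheaf. -/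
def scalarHom (f : X ⟶ Spec (.of k)) (E : X.Modules) (a : k) : abSheaf E ⟶ abSheaf E :=
  ⟨{ app := fun U => E.smul (scalars f U.unop a)
     naturality := fun U V i => by
      have := E.map_comp_smul (i := i.unop) (r := scalars f U.unop a)
      rw [map_scalars] at this
      exact this.symm }⟩

lemma scalarHom_one (f : X ⟶ Spec (.of k)) (E : X.Modules) : scalarHom f E 1 = 𝟙 _ := by
  ext U x
  change scalars f U.unop 1 • (show Γ(E, U.unop) from x) = x
  rw [map_one, one_smul]

lemma scalarHom_mul (f : X ⟶ Spec (.of k)) (E : X.Modules) (a b : k) :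
    scalarHom f E (a * b) = scalarHom f E b ≫ scalarHom f E a := by
  ext U x
  change scalars f U.unop (a * b) • (show Γ(E, U.unop) from x) =
    scalars f U.unop a • (scalars f U.unop b • (show Γ(E, U.unop) from x))
  rw [map_mul, mul_smul]

lemma scalarHom_add (f : X ⟶ Spec (.of k)) (E : X.Modules) (a b : k) :
    scalarHom f E (a + b) = scalarHom f E a + scalarHom f E b := by
  ext U x
  change scalars f U.unop (a + b) • (show Γ(E, U.unop) from x) =
    scalars f U.unop a • (show Γ(E, U.unop) from x) +
      scalars f U.unop b • (show Γ(E, U.unop) from x)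
  rw [map_add, add_smul]

lemma scalarHom_zero (f : X ⟶ Spec (.of k)) (E : X.Modules) : scalarHom f E 0 = 0 := by
  ext U x
  change scalars f U.unop 0 • (show Γ(E, U.unop) from x) = 0
  rw [map_zero, zero_smul]

/-- The sheaf cohomology group `H^n(X, E)` of an `𝒪_X`-module on a `k`-scheme `f : X ⟶ Spec k`. -/
def Cohomology (_f : X ⟶ Spec (.of k)) (E : X.Modules) (n : ℕ) : Type u :=
  Sheaf.H (abSheaf E) n

instance (f : X ⟶ Spec (.of k)) (E : X.Modules) (n : ℕ) : AddCommGroup (Cohomology f E n) :=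
  inferInstanceAs (AddCommGroup (Sheaf.H (abSheaf E) n))

lemma map_zeroHom {F G : Sheaf (Opens.grothendieckTopology X) AddCommGrpCat.{u}} {n : ℕ}
    (x : Sheaf.H F n) : Sheaf.H.map (0 : F ⟶ G) n x = 0 := by
  rw [Sheaf.H.map_apply, Abelian.Ext.mk₀_zero, Abelian.Ext.comp_zero]

/-- The `k`-vector space structure on `H^n(X, E)`: a scalar acts through the endomorphism of the
sheaf that it induces. -/
instance (f : X ⟶ Spec (.of k)) (E : X.Modules) (n : ℕ) : Module k (Cohomology f E n) where
  smul a x := (Sheaf.H.map (scalarHom f E a) n : Sheaf.H (abSheaf E) n →+ _) x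
  one_smul x := (congrArg (fun g => Sheaf.H.map g n x) (scalarHom_one f E)).trans
    (Sheaf.H.map_id_apply _)
  mul_smul a b x := (congrArg (fun g => Sheaf.H.map g n x) (scalarHom_mul f E a b)).trans
    (Sheaf.H.map_comp_apply _ _ _)
  smul_zero a := map_zero (Sheaf.H.map (scalarHom f E a) n)
  smul_add a x y := map_add (Sheaf.H.map (scalarHom f E a) n) x y
  add_smul a b x := (congrArg (fun g => Sheaf.H.map g n x) (scalarHom_add f E a b)).trans
    (Sheaf.H.map_add_apply _ _ _)
  zero_smul x := (congrArg (fun g => Sheaf.H.map g n x) (scalarHom_zero f E)).trans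
    (map_zeroHom x)

/-- The structure sheaf `𝒪_X` as a module over itself. -/
def structureModule (X : Scheme.{u}) : X.Modules := SheafOfModules.unit X.ringCatSheaf

/-- The genus `dim_k H^1(C, 𝒪_C)` of a curve `f : C ⟶ Spec k`. -/
def genus (f : X ⟶ Spec (.of k)) : Cardinal.{u} :=
  Module.rank k (Cohomology f (structureModule X) 1)

end Cohomology

/-! ### Projective schemes -/

section Projective

attribute [local instance] MvPolynomial.gradedAlgebra

variable {k : Type u} [Field k]

/-- Projective space `ℙ^N` over `k`, as `Proj k[x_0, …, x_N]`. -/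
abbrev ProjSpace (k : Type u) [Field k] (N : ℕ) : Scheme.{u} :=
  Proj (MvPolynomial.homogeneousSubmodule (Fin (N + 1)) k)

/-- The structure morphism `ℙ^N ⟶ Spec k`. -/
def ProjSpace.toSpec (k : Type u) [Field k] (N : ℕ) : ProjSpace k N ⟶ Spec (.of k) :=
  Proj.toSpecZero (MvPolynomial.homogeneousSubmodule (Fin (N + 1)) k) ≫
    Spec.map (CommRingCat.ofHom
      (algebraMap k (MvPolynomial.homogeneousSubmodule (Fin (N + 1)) k 0)))

/-- A `k`-scheme is projective if it is isomorphic to a closed subscheme of some `ℙ^N`. -/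
def IsProjective {X : Scheme.{u}} (f : X ⟶ Spec (.of k)) : Prop :=
  ∃ (N : ℕ) (i : X ⟶ ProjSpace k N), IsClosedImmersion i ∧ i ≫ ProjSpace.toSpec k N = f

end Projective

/-! ### Vector bundles, rank and degree -/

section Bundles

variable {X : Scheme.{u}} {r : ℕ}

/-- Sections `e_1, …, e_r` of `E` over `U` form a frame if `𝒪_U^r ⟶ E|_U` is an isomorphism: over
every open `V ⊆ U` they restrict to a basis of `Γ(E, V)`. -/
def IsFrame (E : X.Modules) {U : X.Opens} (e : Fin r → Γ(E, U)) : Prop :=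
  ∀ (V : X.Opens) (h : V ≤ U),
    LinearIndependent Γ(X, V) (fun i => (E.presheaf.map (homOfLE h).op (e i) : Γ(E, V))) ∧
    ⊤ ≤ Submodule.span Γ(X, V)
      (Set.range fun i => (E.presheaf.map (homOfLE h).op (e i) : Γ(E, V)))

/-- The basis of `Γ(E, V)` obtained by restricting a frame to `V ⊆ U`. -/
def IsFrame.basis {E : X.Modules} {U : X.Opens} {e : Fin r → Γ(E, U)} (he : IsFrame E e)
    {V : X.Opens} (h : V ≤ U) : Module.Basis (Fin r) Γ(X, V) Γ(E, V) :=
  Module.Basis.mk (he V h).1 (he V h).2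

/-- A vector bundle of rank `r`: an `𝒪_X`-module that is locally free of rank `r`. -/
def IsVectorBundle (E : X.Modules) (r : ℕ) : Prop :=
  ∀ x : X, ∃ (U : X.Opens) (_ : x ∈ U) (e : Fin r → Γ(E, U)), IsFrame E e

/-- The transition function from a frame `b` over `V` to a frame `e` over `U` on an integral
scheme, `det (e / b) ∈ Γ(X, U ∩ V)`, as a rational function on `X`. -/
def transitionDet [IsIntegral X] {E : X.Modules} {U V : X.Opens} (hU : Nonempty U)
    (hV : Nonempty V) (e : Fin r → Γ(E, U)) {b : Fin r → Γ(E, V)} (hb : IsFrame E b) :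
    X.functionField :=
  haveI : Nonempty ((U ⊓ V : X.Opens) : Type u) := by
    obtain ⟨⟨x, hx⟩⟩ := hU
    obtain ⟨⟨y, hy⟩⟩ := hV
    obtain ⟨z, hz⟩ := nonempty_preirreducible_inter U.2 V.2 ⟨x, hx⟩ ⟨y, hy⟩
    exact ⟨⟨z, hz⟩⟩
  X.germToFunctionField (U ⊓ V)
    ((hb.basis (inf_le_right : U ⊓ V ≤ V)).det
      fun i => (E.presheaf.map (homOfLE (inf_le_left : U ⊓ V ≤ U)).op (e i) : Γ(E, U ⊓ V)))

/-- A rank `r` vector bundle `E` on a curve `f : X ⟶ Spec K` has degree `d`: for a frame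
`e_1, …, e_r` of `E` over a nonempty open `U`, the divisor `D` of the rational section
`e_1 ∧ … ∧ e_r` of `det E` has degree `d`. The coefficient of `D` at `x` is the order of vanishing
at `x` of `e_1 ∧ … ∧ e_r` relative to any frame `b` of `E` near `x`. -/
def HasDegree {K : Type u} [Field K] (f : X ⟶ Spec (.of K)) (E : X.Modules) (r : ℕ) (d : ℤ) :
    Prop :=
  ∃ (_ : IsIntegral X) (_ : IsLocallyNoetherian X) (U : X.Opens) (hU : Nonempty U)
    (e : Fin r → Γ(E, U)) (D : X → ℤ), IsFrame E e ∧
    (∀ (x : X) (V : X.Opens) (hx : x ∈ V) (b : Fin r → Γ(E, V)) (hb : IsFrame E b),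
      D x = Scheme.ord (transitionDet hU ⟨⟨x, hx⟩⟩ e hb) x) ∧
    d = ∑ᶠ x : X, D x * (f.residueDegree x : ℤ)

end Bundles

/-! ### Base change and essential dimension -/

section EssentialDimension

variable {k : Type u} [Field k] {C : Scheme.{u}} (f : C ⟶ Spec (.of k))

/-- The base change `C_K` of a `k`-scheme along a field extension `K / k`. -/
abbrev baseChange (K : Type u) [Field K] [Algebra k K] : Scheme.{u} :=
  Limits.pullback f (Spec.map (CommRingCat.ofHom (algebraMap k K)))

/-- The structure morphism `C_K ⟶ Spec K`. -/
abbrev baseChangeStr (K : Type u) [Field K] [Algebra k K] :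
    baseChange f K ⟶ Spec (.of K) :=
  Limits.pullback.snd f (Spec.map (CommRingCat.ofHom (algebraMap k K)))

/-- The projection `C_K ⟶ C`. -/
abbrev baseChangeFst (K : Type u) [Field K] [Algebra k K] : baseChange f K ⟶ C :=
  Limits.pullback.fst f (Spec.map (CommRingCat.ofHom (algebraMap k K)))

/-- The morphism `C_K ⟶ C_{K'}` for a tower of fields `K / K' / k`. -/
def baseChangeMap (K' K : Type u) [Field K'] [Field K] [Algebra k K'] [Algebra k K]
    [Algebra K' K] [IsScalarTower k K' K] : baseChange f K ⟶ baseChange f K' :=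
  Limits.pullback.lift (baseChangeFst f K)
    (baseChangeStr f K ≫ Spec.map (CommRingCat.ofHom (algebraMap K' K))) (by
      rw [Category.assoc, ← Spec.map_comp, ← CommRingCat.ofHom_comp,
        ← IsScalarTower.algebraMap_eq, Limits.pullback.condition])

/-- `E` is an object of `Bun_{C,r,d}(K)`: a vector bundle of rank `r` and degree `d` over `C_K`. -/
def IsBun (r : ℕ) (d : ℤ) (K : Type u) [Field K] [Algebra k K]
    (E : (baseChange f K).Modules) : Prop :=
  IsVectorBundle E r ∧ HasDegree (baseChangeStr f K) E r d

/-- An object `E` of `Bun_{C,r,d}(K)` is defined over an intermediate field `k ⊆ K' ⊆ K` if it is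
isomorphic to the pullback of an object of `Bun_{C,r,d}(K')`. -/
def IsDefinedOver (r : ℕ) (d : ℤ) {K : Type u} [Field K] [Algebra k K]
    (E : (baseChange f K).Modules) (K' : IntermediateField k K) : Prop :=
  ∃ E' : (baseChange f K').Modules, IsBun f r d K' E' ∧
    Nonempty ((Scheme.Modules.pullback (baseChangeMap f K' K)).obj E' ≅ E)

/-- The essential dimension `ed_k(E)` of an object `E` of `Bun_{C,r,d}(K)`: the infimum of
`trdeg_k K'` over all intermediate fields `k ⊆ K' ⊆ K` over which `E` is defined. -/
def essDimObj (r : ℕ) (d : ℤ) {K : Type u} [Field K] [Algebra k K]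
    (E : (baseChange f K).Modules) : ℕ∞ :=
  ⨅ (K' : IntermediateField k K) (_ : IsDefinedOver f r d E K'),
    Cardinal.toENat (Algebra.trdeg k K')

/-- The essential dimension `ed_k(Bun_{C,r,d})`: the supremum of `ed_k(E)` over all field extensions
`K / k` and all objects `E` of `Bun_{C,r,d}(K)`, equal to `⊥` (that is, `-∞`) if there are none. -/
def essDimBun (r : ℕ) (d : ℤ) : WithBot ℕ∞ :=
  ⨆ (K : Type u) (_ : Field K) (_ : Algebra k K) (E : (baseChange f K).Modules)
    (_ : IsBun f r d K E), (essDimObj f r d E : WithBot ℕ∞)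

end EssentialDimension

end CurveBundles

end

/-! The curve is covered by two affine lines with coordinates `t` and `s = 1 / t`, and a vector
bundle on any base change is determined up to isomorphism by a list of integers that makes sense
already over `k`.

Charts. Let `z` vanish to first order at the rational point `p` and nowhere else on a neighbourhood
of it. Since `H¹(C, 𝒪) = 0`, Mayer–Vietoris (`exists_resO_sub_resO`) writes `1 / z` as a difference
of a function regular near `p` and one regular off `p`; up to sign the latter is a function `t` with
a simple pole at `p` and no other pole. Subtracting multiples of powers of `t` lowers pole orders,
and a function without poles is constant, so the functions off `p` are `k[t]`
(`eval₂_bijective_of_pole`); similarly `k[1 / t]` is the ring of functions where `t` does not vanish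
(`eval₂_bijective_of_zero`). That these open sets are affine comes from Zariski's main theorem
(`isAffine_of_isPrincipalIdealRing`). The result is `exists_projectiveLineCharts`; the charts
survive base change to any `K`, and afterwards nothing but the charts is used.

Splitting. Each chart has a principal ideal domain as coordinate ring, so a bundle has a frame on it
(`exists_frame_of_isPrincipalIdealRing`). The transition matrix has entries in `K[t, 1 / t]`, and
`exists_birkhoff` makes it diagonal with entries `t ^ n i` (`exists_isSplit_of_isVectorBundle`).
These entries are defined over every subfield, so gluing along them over a smaller field gives a
bundle that pulls back to the given one (`nonempty_pullback_iso`). This is (a).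

Degree. For (b) the descended bundle must also have degree `d`. A bundle with exponents `n` has
degree `-∑ i, n i` (`IsSplit.hasDegree`), and no other degree, because principal divisors have
degree zero (`hasDegreeZero`, `IsSplit.eq_of_hasDegree`). Thus every object is defined over `k`
itself, of transcendence degree `0`, and objects exist for every `d` when `r ≥ 1`, so the supremum
is `0` and not `-∞`. -/

namespace CurveBundles

/-! ### Restriction and gluing of sections. -/

section Sections

variable {X : Scheme.{u}}

/-- Restriction of sections of a sheaf of modules. -/
noncomputable def res (E : X.Modules) {U V : X.Opens} (h : V ≤ U) : Γ(E, U) →+ Γ(E, V) :=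
  (E.presheaf.map (homOfLE h).op).hom

/-- Restriction of regular functions. -/
noncomputable def resO {U V : X.Opens} (h : V ≤ U) : Γ(X, U) →+* Γ(X, V) :=
  (X.presheaf.map (homOfLE h).op).hom

@[simp] lemma res_res (E : X.Modules) {U V W : X.Opens} (h : V ≤ U) (h' : W ≤ V) (a : Γ(E, U)) :
    res E h' (res E h a) = res E (h'.trans h) a := by
  have : E.presheaf.map (homOfLE h).op ≫ E.presheaf.map (homOfLE h').op =
      E.presheaf.map (homOfLE (h'.trans h)).op := by
    rw [← Functor.map_comp]; rfl
  exact congr($this a)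

@[simp] lemma resO_resO {U V W : X.Opens} (h : V ≤ U) (h' : W ≤ V) (a : Γ(X, U)) :
    resO h' (resO h a) = resO (h'.trans h) a := by
  have : X.presheaf.map (homOfLE h).op ≫ X.presheaf.map (homOfLE h').op =
      X.presheaf.map (homOfLE (h'.trans h)).op := by
    rw [← Functor.map_comp]; rfl
  exact congr($this a)

@[simp] lemma res_self (E : X.Modules) {U : X.Opens} (h : U ≤ U) (a : Γ(E, U)) :
    res E h a = a := by
  have : E.presheaf.map (homOfLE h).op = 𝟙 _ := E.presheaf.map_id _
  exact congr($this a)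

@[simp] lemma resO_self {U : X.Opens} (h : U ≤ U) (a : Γ(X, U)) :
    resO h a = a := by
  have : X.presheaf.map (homOfLE h).op = 𝟙 _ := X.presheaf.map_id _
  exact congr($this a)

@[simp] lemma res_smul (E : X.Modules) {U V : X.Opens} (h : V ≤ U) (c : Γ(X, U)) (a : Γ(E, U)) :
    res E h (c • a) = resO h c • res E h a :=
  E.map_smul (homOfLE h) c a

lemma germ_resO {U V : X.Opens} (h : V ≤ U) {x : X} (hx : x ∈ V) (a : Γ(X, U)) :
    X.presheaf.germ V x hx (resO h a) = X.presheaf.germ U x (h hx) a :=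
  X.presheaf.germ_res_apply (homOfLE h) x hx a

lemma app_res {E F : X.Modules} (φ : E ⟶ F) {U V : X.Opens} (h : V ≤ U) (a : Γ(E, U)) :
    φ.app V (res E h a) = res F h (φ.app U a) :=
  congr($(φ.mapPresheaf.naturality (homOfLE h).op) a)

lemma section_ext (E : X.Modules) {ι : Type*} {U : X.Opens} (V : ι → X.Opens)
    (hV : ∀ i, V i ≤ U) (hc : ∀ x ∈ U, ∃ i, x ∈ V i) {a b : Γ(E, U)}
    (h : ∀ i, res E (hV i) a = res E (hV i) b) : a = b := by
  -- Indexing by the range of `V` instead of `ι` brings the cover into the universe of `X`.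
  have := TopCat.Sheaf.eq_of_locally_eq' (abSheaf E) (fun i : ULift.{u} (Set.range V) => i.down.1) U
    (fun i => homOfLE (by obtain ⟨⟨_, ⟨i, rfl⟩⟩⟩ := i; exact hV i))
    (fun x hx => by
      obtain ⟨i, hi⟩ := hc x hx
      exact Opens.mem_iSup.2 ⟨⟨⟨_, ⟨i, rfl⟩⟩⟩, hi⟩) a b
  refine this ?_
  rintro ⟨⟨_, ⟨i, rfl⟩⟩⟩
  exact h i

lemma sectionO_ext {ι : Type*} {U : X.Opens} (V : ι → X.Opens)
    (hV : ∀ i, V i ≤ U) (hc : ∀ x ∈ U, ∃ i, x ∈ V i) {a b : Γ(X, U)}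
    (h : ∀ i, resO (hV i) a = resO (hV i) b) : a = b := by
  have := TopCat.Sheaf.eq_of_locally_eq' X.sheaf (fun i : ULift.{u} (Set.range V) => i.down.1) U
    (fun i => homOfLE (by obtain ⟨⟨_, ⟨i, rfl⟩⟩⟩ := i; exact hV i))
    (fun x hx => by
      obtain ⟨i, hi⟩ := hc x hx
      exact Opens.mem_iSup.2 ⟨⟨⟨_, ⟨i, rfl⟩⟩⟩, hi⟩) a b
  refine this ?_
  rintro ⟨⟨_, ⟨i, rfl⟩⟩⟩
  exact h i

lemma exists_glue (E : X.Modules) {ι : Type u} {U : X.Opens} (V : ι → X.Opens)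
    (hV : ∀ i, V i ≤ U) (hc : ∀ x ∈ U, ∃ i, x ∈ V i) (s : ∀ i, Γ(E, V i))
    (h : ∀ i j, res E (inf_le_left : V i ⊓ V j ≤ V i) (s i) =
      res E (inf_le_right : V i ⊓ V j ≤ V j) (s j)) :
    ∃ a : Γ(E, U), ∀ i, res E (hV i) a = s i := by
  obtain ⟨a, ha, -⟩ := TopCat.Sheaf.existsUnique_gluing' (abSheaf E) V U
    (fun i => homOfLE (hV i)) (fun x hx => Opens.mem_iSup.2 (hc x hx)) s h
  exact ⟨a, ha⟩

lemma exists_glueO {ι : Type u} {U : X.Opens} (V : ι → X.Opens)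
    (hV : ∀ i, V i ≤ U) (hc : ∀ x ∈ U, ∃ i, x ∈ V i) (s : ∀ i, Γ(X, V i))
    (h : ∀ i j, resO (inf_le_left : V i ⊓ V j ≤ V i) (s i) =
      resO (inf_le_right : V i ⊓ V j ≤ V j) (s j)) :
    ∃ a : Γ(X, U), ∀ i, resO (hV i) a = s i := by
  obtain ⟨a, ha, -⟩ := TopCat.Sheaf.existsUnique_gluing' X.sheaf V U
    (fun i => homOfLE (hV i)) (fun x hx => Opens.mem_iSup.2 (hc x hx)) s h
  exact ⟨a, ha⟩

lemma section_ext₂ (E : X.Modules) {U V₀ V₁ : X.Opens} (h₀ : V₀ ≤ U) (h₁ : V₁ ≤ U)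
    (hc : U ≤ V₀ ⊔ V₁) {a b : Γ(E, U)} (e₀ : res E h₀ a = res E h₀ b)
    (e₁ : res E h₁ a = res E h₁ b) : a = b :=
  section_ext E (fun i : Bool => bif i then V₀ else V₁) (by rintro (_ | _) <;> assumption)
    (fun x hx => (hc hx).elim (fun h => ⟨true, h⟩) (fun h => ⟨false, h⟩))
    (by rintro (_ | _) <;> assumption)

lemma exists_glue₂ (E : X.Modules) {U V₀ V₁ W : X.Opens} (h₀ : V₀ ≤ U) (h₁ : V₁ ≤ U)
    (hc : U ≤ V₀ ⊔ V₁) (hW₀ : W ≤ V₀) (hW₁ : W ≤ V₁) (hW : V₀ ⊓ V₁ ≤ W)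
    (a₀ : Γ(E, V₀)) (a₁ : Γ(E, V₁)) (h : res E hW₀ a₀ = res E hW₁ a₁) :
    ∃ a : Γ(E, U), res E h₀ a = a₀ ∧ res E h₁ a = a₁ := by
  obtain rfl : W = V₀ ⊓ V₁ := le_antisymm (le_inf hW₀ hW₁) hW
  obtain ⟨a, ha⟩ := exists_glue E (fun i : ULift.{u} Bool => bif i.down then V₀ else V₁)
    (U := U) (by rintro ⟨_ | _⟩ <;> assumption)
    (fun x hx => (hc hx).elim (fun h => ⟨⟨true⟩, h⟩) (fun h => ⟨⟨false⟩, h⟩))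
    (fun | ⟨true⟩ => a₀ | ⟨false⟩ => a₁) (by
      rintro ⟨_ | _⟩ ⟨_ | _⟩
      · rfl
      · have := congrArg (res E (le_of_eq (inf_comm V₁ V₀))) h
        rw [res_res, res_res] at this
        exact this.symm
      · exact h
      · rfl)
  exact ⟨a, ha ⟨true⟩, ha ⟨false⟩⟩

lemma exists_glueO₂ {U V₀ V₁ W : X.Opens} (h₀ : V₀ ≤ U) (h₁ : V₁ ≤ U)
    (hc : U ≤ V₀ ⊔ V₁) (hW₀ : W ≤ V₀) (hW₁ : W ≤ V₁) (hW : V₀ ⊓ V₁ ≤ W)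
    (a₀ : Γ(X, V₀)) (a₁ : Γ(X, V₁)) (h : resO hW₀ a₀ = resO hW₁ a₁) :
    ∃ a : Γ(X, U), resO h₀ a = a₀ ∧ resO h₁ a = a₁ := by
  obtain rfl : W = V₀ ⊓ V₁ := le_antisymm (le_inf hW₀ hW₁) hW
  obtain ⟨a, ha⟩ := exists_glueO (fun i : ULift.{u} Bool => bif i.down then V₀ else V₁)
    (U := U) (by rintro ⟨_ | _⟩ <;> assumption)
    (fun x hx => (hc hx).elim (fun h => ⟨⟨true⟩, h⟩) (fun h => ⟨⟨false⟩, h⟩))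
    (fun | ⟨true⟩ => a₀ | ⟨false⟩ => a₁) (by
      rintro ⟨_ | _⟩ ⟨_ | _⟩
      · rfl
      · have := congrArg (resO (le_of_eq (inf_comm V₁ V₀))) h
        rw [resO_resO, resO_resO] at this
        exact this.symm
      · exact h
      · rfl)
  exact ⟨a, ha ⟨true⟩, ha ⟨false⟩⟩

end Sections

/-! ### Frames and coordinates. -/

section Frames

variable {X : Scheme.{u}} {r : ℕ} {E : X.Modules} {U : X.Opens}

lemma isFrame_iff (e : Fin r → Γ(E, U)) :
    IsFrame E e ↔ ∀ (V : X.Opens) (h : V ≤ U),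
      LinearIndependent Γ(X, V) (fun i => res E h (e i)) ∧
      ⊤ ≤ Submodule.span Γ(X, V) (Set.range fun i => res E h (e i)) := Iff.rfl

lemma IsFrame.restrict {e : Fin r → Γ(E, U)} (he : IsFrame E e) {V : X.Opens} (h : V ≤ U) :
    IsFrame E (fun i => res E h (e i)) := by
  rw [isFrame_iff] at he ⊢
  intro W hW
  simpa using he W (hW.trans h)

@[simp] lemma IsFrame.basis_apply {e : Fin r → Γ(E, U)} (he : IsFrame E e) {V : X.Opens}
    (h : V ≤ U) (i : Fin r) : he.basis h i = res E h (e i) := by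
  simp [IsFrame.basis, res]

/-- The coordinates of a section with respect to a frame. -/
noncomputable def IsFrame.coord {e : Fin r → Γ(E, U)} (he : IsFrame E e) {V : X.Opens}
    (h : V ≤ U) : Γ(E, V) →ₗ[Γ(X, V)] (Fin r → Γ(X, V)) :=
  (he.basis h).equivFun.toLinearMap

lemma IsFrame.sum_coord {e : Fin r → Γ(E, U)} (he : IsFrame E e) {V : X.Opens}
    (h : V ≤ U) (a : Γ(E, V)) : ∑ i, he.coord h a i • res E h (e i) = a := by
  have := (he.basis h).sum_equivFun a
  simp only [IsFrame.basis_apply] at this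
  exact this

lemma IsFrame.coord_sum {e : Fin r → Γ(E, U)} (he : IsFrame E e) {V : X.Opens}
    (h : V ≤ U) (c : Fin r → Γ(X, V)) : he.coord h (∑ i, c i • res E h (e i)) = c := by
  simpa [IsFrame.coord, Module.Basis.equivFun_symm_apply] using
    (he.basis h).equivFun.apply_symm_apply c

lemma IsFrame.coord_eq {e : Fin r → Γ(E, U)} (he : IsFrame E e) {V : X.Opens}
    (h : V ≤ U) {a : Γ(E, V)} {c : Fin r → Γ(X, V)} (hc : ∑ i, c i • res E h (e i) = a) :
    he.coord h a = c := by
  rw [← hc, he.coord_sum]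

lemma IsFrame.coord_res {e : Fin r → Γ(E, U)} (he : IsFrame E e) {V W : X.Opens}
    (h : V ≤ U) (h' : W ≤ V) (a : Γ(E, V)) :
    he.coord (h'.trans h) (res E h' a) = fun i => resO h' (he.coord h a i) := by
  refine he.coord_eq _ ?_
  conv_rhs => rw [← he.sum_coord h a]
  simp

lemma IsFrame.ext_coeff {e : Fin r → Γ(E, U)} (he : IsFrame E e) {V : X.Opens}
    (h : V ≤ U) {c d : Fin r → Γ(X, V)}
    (hcd : ∑ i, c i • res E h (e i) = ∑ i, d i • res E h (e i)) : c = d := by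
  rw [← he.coord_sum h c, hcd, he.coord_sum]

lemma isFrame_of_existsUnique {e : Fin r → Γ(E, U)}
    (hinj : ∀ (V : X.Opens) (h : V ≤ U) (c : Fin r → Γ(X, V)),
      ∑ i, c i • res E h (e i) = 0 → c = 0)
    (hsurj : ∀ (V : X.Opens) (h : V ≤ U) (a : Γ(E, V)),
      ∃ c : Fin r → Γ(X, V), ∑ i, c i • res E h (e i) = a) : IsFrame E e := by
  rw [isFrame_iff]
  refine fun V h => ⟨Fintype.linearIndependent_iff.2 fun c hc i => ?_, fun a _ => ?_⟩
  · exact congrFun (hinj V h c hc) i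
  · obtain ⟨c, rfl⟩ := hsurj V h a
    exact Submodule.sum_mem _ fun i _ =>
      Submodule.smul_mem _ _ (Submodule.subset_span ⟨i, rfl⟩)

/-- Coordinates in a frame are unique, and equality of functions is local. So the coordinates of a
section in the local frames agree on overlaps and glue. -/
lemma isFrame_of_locally {e : Fin r → Γ(E, U)}
    (H : ∀ x ∈ U, ∃ (V : X.Opens) (h : V ≤ U), x ∈ V ∧ IsFrame E (fun i => res E h (e i))) :
    IsFrame E e := by
  choose! N hN hxN hf using H
  have key : ∀ (V : X.Opens) (h : V ≤ U) (c d : Fin r → Γ(X, V)),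
      ∑ i, c i • res E h (e i) = ∑ i, d i • res E h (e i) → c = d := by
    intro V h c d hcd
    funext j
    refine sectionO_ext (fun x : V => N x ⊓ V) (fun x => inf_le_right)
      (fun x hx => ⟨⟨x, hx⟩, hxN x (h hx), hx⟩) fun x => ?_
    have := (hf x (h x.2)).ext_coeff (V := N x ⊓ V) inf_le_left
      (c := fun i => resO inf_le_right (c i)) (d := fun i => resO inf_le_right (d i)) ?_
    · exact congrFun this j
    · have := congrArg (res E (inf_le_right : N x ⊓ V ≤ V)) hcd
      simpa using this
  refine isFrame_of_existsUnique (fun V h c hc => key V h c 0 (by simpa using hc)) ?_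
  intro V h a
  let cc : ∀ x : V, Fin r → Γ(X, N x ⊓ V) := fun x =>
    (hf x (h x.2)).coord inf_le_left (res E inf_le_right a)
  have hcc : ∀ x : V, ∑ i, cc x i • res E (inf_le_right.trans h) (e i) =
      res E (inf_le_right : N x ⊓ V ≤ V) a := fun x => by
    simpa using (hf x (h x.2)).sum_coord (V := N x ⊓ V) inf_le_left (res E inf_le_right a)
  have hg : ∀ i, ∃ c : Γ(X, V), ∀ x : V, resO (inf_le_right : N x ⊓ V ≤ V) c = cc x i := by
    intro i
    refine exists_glueO (fun x : V => N x ⊓ V) (fun x => inf_le_right)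
      (fun x hx => ⟨⟨x, hx⟩, hxN x (h hx), hx⟩) (fun x => cc x i) fun x y => ?_
    refine congrFun (key (N x ⊓ V ⊓ (N y ⊓ V)) (inf_le_left.trans (inf_le_right.trans h))
      (fun i => resO inf_le_left (cc x i)) (fun i => resO inf_le_right (cc y i)) ?_) i
    have h1 := congrArg (res E (inf_le_left : N x ⊓ V ⊓ (N y ⊓ V) ≤ N x ⊓ V)) (hcc x)
    have h2 := congrArg (res E (inf_le_right : N x ⊓ V ⊓ (N y ⊓ V) ≤ N y ⊓ V)) (hcc y)
    simp only [map_sum, res_smul, res_res] at h1 h2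
    rw [h1, h2]
  choose c hc using hg
  refine ⟨c, section_ext E (fun x : V => N x ⊓ V) (fun x => inf_le_right)
      (fun x hx => ⟨⟨x, hx⟩, hxN x (h hx), hx⟩) fun x => ?_⟩
  rw [← hcc x]
  simp [hc]

end Frames

/-! ### Morphisms out of a sheaf given by two frames, and its pullback. -/

section Hom

variable {X : Scheme.{u}} {r : ℕ}

/-- A compatible family of linear maps on sections is a morphism of sheaves of modules. -/
noncomputable def homMk (E F : X.Modules) (φ : ∀ V : X.Opens, Γ(E, V) → Γ(F, V))
    (hadd : ∀ V a b, φ V (a + b) = φ V a + φ V b)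
    (hsmul : ∀ V (c : Γ(X, V)) a, φ V (c • a) = c • φ V a)
    (hres : ∀ {V W : X.Opens} (h : W ≤ V) a, φ W (res E h a) = res F h (φ V a)) : E ⟶ F :=
  ⟨PresheafOfModules.homMk
    { app := fun V => AddCommGrpCat.ofHom (AddMonoidHom.mk' (φ V.unop) (hadd V.unop))
      naturality := fun V W i => by
        ext a
        exact hres (leOfHom i.unop) a }
    (fun V c a => hsmul V.unop c a)⟩

@[simp] lemma homMk_app (E F : X.Modules) (φ : ∀ V : X.Opens, Γ(E, V) → Γ(F, V)) (hadd hsmul hres)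
    (V : X.Opens) (a : Γ(E, V)) :
    (homMk E F φ hadd hsmul hres).app V a = φ V a := rfl

lemma app_sum_smul {E F : X.Modules} (φ : E ⟶ F) {V : X.Opens} (c : Fin r → Γ(X, V))
    (a : Fin r → Γ(E, V)) : φ.app V (∑ i, c i • a i) = ∑ i, c i • φ.app V (a i) := by
  rw [map_sum]
  simp

lemma hom_ext_of_frames {E F : X.Modules} {U₀ U₁ : X.Opens} (hU : U₀ ⊔ U₁ = ⊤)
    {e : Fin r → Γ(E, U₀)} {b : Fin r → Γ(E, U₁)} (he : IsFrame E e) (hb : IsFrame E b)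
    {φ ψ : E ⟶ F} (h₀ : ∀ i, φ.app U₀ (e i) = ψ.app U₀ (e i))
    (h₁ : ∀ i, φ.app U₁ (b i) = ψ.app U₁ (b i)) : φ = ψ := by
  refine Scheme.Modules.hom_ext _ _ fun V => ?_
  ext a
  refine section_ext₂ F (inf_le_left : V ⊓ U₀ ≤ V) (inf_le_left : V ⊓ U₁ ≤ V)
    (by rw [← inf_sup_left, hU, inf_top_eq]) ?_ ?_
  · rw [← app_res, ← app_res, ← he.sum_coord inf_le_right (res E inf_le_left a),
      app_sum_smul, app_sum_smul]
    simp only [app_res, h₀]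
  · rw [← app_res, ← app_res, ← hb.sum_coord inf_le_right (res E inf_le_left a),
      app_sum_smul, app_sum_smul]
    simp only [app_res, h₁]

/-- The transition between the coordinates in two frames that differ by a diagonal matrix. -/
lemma coord_mul_of_transition {E : X.Modules} {U₀ U₁ : X.Opens}
    {e : Fin r → Γ(E, U₀)} {b : Fin r → Γ(E, U₁)} (he : IsFrame E e) (hb : IsFrame E b)
    {g : Fin r → Γ(X, U₀ ⊓ U₁)}
    (hg : ∀ i, res E inf_le_left (e i) = g i • res E inf_le_right (b i))
    {V : X.Opens} (h : V ≤ U₀ ⊓ U₁) (a : Γ(E, V)) (i : Fin r) :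
    hb.coord (h.trans inf_le_right) a i =
      he.coord (h.trans inf_le_left) a i * resO h (g i) := by
  refine congrFun (hb.coord_eq (c := fun i => he.coord (h.trans inf_le_left) a i * resO h (g i))
    (h.trans inf_le_right) ?_) i
  conv_rhs => rw [← he.sum_coord (h.trans inf_le_left) a]
  refine Finset.sum_congr rfl fun j _ => ?_
  have := congrArg (res E h) (hg j)
  simp only [res_smul, res_res] at this
  rw [this, smul_smul]

/-- The prescribed images `u`, `v` satisfy the same transition rule as the frames `e`, `b`. Hence
the two formulas "same coordinates, new vectors" agree on the overlap and glue to a morphism. -/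
lemma exists_hom_of_frames {E F : X.Modules} {U₀ U₁ : X.Opens} (hU : U₀ ⊔ U₁ = ⊤)
    {e : Fin r → Γ(E, U₀)} {b : Fin r → Γ(E, U₁)} (he : IsFrame E e) (hb : IsFrame E b)
    {g : Fin r → Γ(X, U₀ ⊓ U₁)}
    (hg : ∀ i, res E inf_le_left (e i) = g i • res E inf_le_right (b i))
    (u : Fin r → Γ(F, U₀)) (v : Fin r → Γ(F, U₁))
    (huv : ∀ i, res F inf_le_left (u i) = g i • res F inf_le_right (v i)) :
    ∃ φ : E ⟶ F, (∀ i, φ.app U₀ (e i) = u i) ∧ ∀ i, φ.app U₁ (b i) = v i := by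
  let φ₀ : ∀ V : X.Opens, V ≤ U₀ → Γ(E, V) → Γ(F, V) := fun V h a =>
    ∑ i, he.coord h a i • res F h (u i)
  let φ₁ : ∀ V : X.Opens, V ≤ U₁ → Γ(E, V) → Γ(F, V) := fun V h a =>
    ∑ i, hb.coord h a i • res F h (v i)
  have r₀ : ∀ {V W : X.Opens} (h : V ≤ U₀) (h' : W ≤ V) a,
      φ₀ W (h'.trans h) (res E h' a) = res F h' (φ₀ V h a) := by
    intro V W h h' a
    simp only [φ₀, he.coord_res h h', map_sum, res_smul, res_res]
  have r₁ : ∀ {V W : X.Opens} (h : V ≤ U₁) (h' : W ≤ V) a,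
      φ₁ W (h'.trans h) (res E h' a) = res F h' (φ₁ V h a) := by
    intro V W h h' a
    simp only [φ₁, hb.coord_res h h', map_sum, res_smul, res_res]
  -- Passing from `e` to `b` multiplies the `i`-th coordinate by `g i`, and passing from `v` to `u`
  -- multiplies the `i`-th vector by the same factor.
  have key : ∀ (V : X.Opens) (h₀ : V ≤ U₀) (h₁ : V ≤ U₁) a, φ₀ V h₀ a = φ₁ V h₁ a := by
    intro V h₀ h₁ a
    refine Finset.sum_congr rfl fun i _ => ?_
    rw [coord_mul_of_transition he hb hg (le_inf h₀ h₁) a i, mul_smul]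
    have := congrArg (res F (le_inf h₀ h₁)) (huv i)
    simp only [res_smul, res_res] at this
    rw [this]
  have hcov : ∀ V : X.Opens, V ≤ (V ⊓ U₀) ⊔ (V ⊓ U₁) := fun V => by
    rw [← inf_sup_left, hU, inf_top_eq]
  have hglue : ∀ (V : X.Opens) (a : Γ(E, V)), ∃ c : Γ(F, V),
      res F inf_le_left c = φ₀ (V ⊓ U₀) inf_le_right (res E inf_le_left a) ∧
      res F inf_le_left c = φ₁ (V ⊓ U₁) inf_le_right (res E inf_le_left a) := by
    intro V a
    refine exists_glue₂ F _ _ (hcov V) (W := V ⊓ U₀ ⊓ (V ⊓ U₁)) inf_le_left inf_le_right le_rfl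
      _ _ ?_
    rw [← r₀, ← r₁, res_res, res_res]
    exact key _ _ _ _
  choose Φ hΦ₀ hΦ₁ using hglue
  have uniq : ∀ (V : X.Opens) (c d : Γ(F, V)),
      res F (inf_le_left : V ⊓ U₀ ≤ V) c = res F inf_le_left d →
      res F (inf_le_left : V ⊓ U₁ ≤ V) c = res F inf_le_left d → c = d := fun V c d =>
    section_ext₂ F _ _ (hcov V)
  refine ⟨homMk E F Φ (fun V a b => ?_) (fun V c a => ?_) (fun {V W} h a => ?_),
    fun i => ?_, fun i => ?_⟩
  · refine uniq V _ _ ?_ ?_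
    · rw [hΦ₀, map_add, map_add, hΦ₀, hΦ₀]
      simp only [φ₀, map_add, Pi.add_apply, add_smul, Finset.sum_add_distrib]
    · rw [hΦ₁, map_add, map_add, hΦ₁, hΦ₁]
      simp only [φ₁, map_add, Pi.add_apply, add_smul, Finset.sum_add_distrib]
  · refine uniq V _ _ ?_ ?_
    · rw [hΦ₀, res_smul, res_smul, hΦ₀]
      simp only [φ₀, map_smul, Pi.smul_apply, Finset.smul_sum, smul_eq_mul, mul_smul]
    · rw [hΦ₁, res_smul, res_smul, hΦ₁]
      simp only [φ₁, map_smul, Pi.smul_apply, Finset.smul_sum, smul_eq_mul, mul_smul]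
  · refine uniq W _ _ ?_ ?_
    · rw [hΦ₀, res_res, res_res]
      have := congrArg (res F (inf_le_inf_right U₀ h)) (hΦ₀ V a)
      rw [← r₀, res_res, res_res] at this
      exact this.symm
    · rw [hΦ₁, res_res, res_res]
      have := congrArg (res F (inf_le_inf_right U₁ h)) (hΦ₁ V a)
      rw [← r₁, res_res, res_res] at this
      exact this.symm
  · have h1 : Φ U₀ (e i) = φ₀ U₀ le_rfl (e i) := by
      refine uniq U₀ _ _ ?_ ?_
      · rw [hΦ₀, ← r₀]
      · rw [hΦ₁, ← key _ inf_le_left, ← r₀ le_rfl]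
    rw [homMk_app, h1]
    simp only [φ₀]
    rw [he.coord_eq le_rfl (c := Pi.single i 1)]
    · simp [Pi.single_apply]
    · simp [Pi.single_apply]
  · have h1 : Φ U₁ (b i) = φ₁ U₁ le_rfl (b i) := by
      refine uniq U₁ _ _ ?_ ?_
      · rw [hΦ₀, key _ _ inf_le_left, ← r₁ le_rfl]
      · rw [hΦ₁, ← r₁]
    rw [homMk_app, h1]
    simp only [φ₁]
    rw [hb.coord_eq le_rfl (c := Pi.single i 1)]
    · simp [Pi.single_apply]
    · simp [Pi.single_apply]

/-- The pullback of a sheaf of modules glued from two trivial ones along a diagonal transition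
matrix is any sheaf of modules glued along the pulled back matrix. -/
theorem nonempty_pullback_iso {X' : Scheme.{u}} (π : X' ⟶ X) {U₀ U₁ : X.Opens}
    (hU : U₀ ⊔ U₁ = ⊤) {E : X.Modules} {e : Fin r → Γ(E, U₀)} {b : Fin r → Γ(E, U₁)}
    (he : IsFrame E e) (hb : IsFrame E b) {g : Fin r → Γ(X, U₀ ⊓ U₁)}
    (hg : ∀ i, res E inf_le_left (e i) = g i • res E inf_le_right (b i))
    {E' : X'.Modules} {e' : Fin r → Γ(E', π ⁻¹ᵁ U₀)} {b' : Fin r → Γ(E', π ⁻¹ᵁ U₁)}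
    (he' : IsFrame E' e') (hb' : IsFrame E' b')
    (hg' : ∀ i, res E' (π.preimage_mono (inf_le_left : U₀ ⊓ U₁ ≤ U₀)) (e' i) =
      π.app (U₀ ⊓ U₁) (g i) • res E' (π.preimage_mono (inf_le_right : U₀ ⊓ U₁ ≤ U₁)) (b' i)) :
    Nonempty ((Scheme.Modules.pullback π).obj E ≅ E') := by
  let adj := Scheme.Modules.pullbackPushforwardAdjunction π
  let PE := (Scheme.Modules.pullback π).obj E
  let η : E ⟶ (Scheme.Modules.pushforward π).obj PE := adj.unit.app E
  -- The adjunction avoids any description of the sections of the pullback. A morphism out of it is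
  -- a morphism `E ⟶ π_* E'`, given by the frames of `E'`; the inverse sends the frames of `E'` to
  -- the images of `e` and `b` under the unit. Both composites are checked on frames.
  obtain ⟨α, hα₀, hα₁⟩ := exists_hom_of_frames (F := (Scheme.Modules.pushforward π).obj E')
    hU he hb hg e' b' hg'
  obtain ⟨β, hβ₀, hβ₁⟩ := exists_hom_of_frames (X := X') (F := PE) (U₀ := π ⁻¹ᵁ U₀)
    (U₁ := π ⁻¹ᵁ U₁) (by rw [← Scheme.Hom.preimage_sup, hU]; rfl)
    he' hb' (g := fun i => π.app (U₀ ⊓ U₁) (g i)) hg' (fun i => η.app U₀ (e i))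
    (fun i => η.app U₁ (b i)) (fun i => by
      have := congrArg (η.app (U₀ ⊓ U₁)) (hg i)
      rw [app_res, Scheme.Modules.Hom.app_smul, app_res] at this
      exact this)
  let α' : PE ⟶ E' := (adj.homEquiv E E').symm α
  have hα' : η ≫ (Scheme.Modules.pushforward π).map α' = α := by
    have := (adj.homEquiv E E').apply_symm_apply α
    rwa [Adjunction.homEquiv_unit] at this
  refine ⟨⟨α', β, ?_, ?_⟩⟩
  · apply (adj.homEquiv E PE).injective
    rw [Adjunction.homEquiv_unit, Adjunction.homEquiv_unit, Functor.map_comp]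
    change η ≫ _ ≫ _ = η ≫ _
    rw [← Category.assoc, hα', CategoryTheory.Functor.map_id, Category.comp_id]
    refine hom_ext_of_frames hU he hb (fun i => ?_) (fun i => ?_)
    · rw [Scheme.Modules.Hom.comp_app]
      change β.app (π ⁻¹ᵁ U₀) (α.app U₀ (e i)) = _
      rw [hα₀, hβ₀]
    · rw [Scheme.Modules.Hom.comp_app]
      change β.app (π ⁻¹ᵁ U₁) (α.app U₁ (b i)) = _
      rw [hα₁, hβ₁]
  · refine hom_ext_of_frames (by rw [← Scheme.Hom.preimage_sup, hU]; rfl) he' hb'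
      (fun i => ?_) (fun i => ?_)
    · rw [Scheme.Modules.Hom.comp_app]
      change α'.app _ (β.app (π ⁻¹ᵁ U₀) (e' i)) = e' i
      rw [hβ₀, ← hα₀, ← hα']
      rfl
    · rw [Scheme.Modules.Hom.comp_app]
      change α'.app _ (β.app (π ⁻¹ᵁ U₁) (b' i)) = b' i
      rw [hβ₁, ← hα₁, ← hα']
      rfl

end Hom

/-! ### Construction of a sheaf from a diagonal transition matrix. -/

namespace Glued

variable {X : Scheme.{u}} {r : ℕ} {U₀ U₁ : X.Opens} (g : Fin r → Γ(X, U₀ ⊓ U₁))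

/-- Sections over `V` of the sheaf glued from `𝒪^r` on `U₀` and `𝒪^r` on `U₁` along the diagonal
matrix `g`: pairs of vectors of functions that correspond to each other on the overlap. -/
def sections (V : X.Opens) :
    AddSubgroup ((Fin r → Γ(X, V ⊓ U₀)) × (Fin r → Γ(X, V ⊓ U₁))) where
  carrier := {p | ∀ i, resO (V := V ⊓ (U₀ ⊓ U₁)) (inf_le_inf_left V inf_le_right) (p.2 i) =
    resO (V := V ⊓ (U₀ ⊓ U₁)) (inf_le_inf_left V inf_le_left) (p.1 i) * resO inf_le_right (g i)}
  add_mem' {p q} hp hq i := by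
    simp only [Prod.fst_add, Prod.snd_add, Pi.add_apply, map_add, add_mul]
    rw [hp i, hq i]
  zero_mem' i := by simp
  neg_mem' {p} hp i := by
    simp only [Prod.fst_neg, Prod.snd_neg, Pi.neg_apply, map_neg, neg_mul]
    rw [hp i]

variable {g} in

noncomputable instance (V : X.Opens) : Module Γ(X, V) (sections g V) where
  smul c p := ⟨(fun i => resO inf_le_left c * p.1.1 i, fun i => resO inf_le_left c * p.1.2 i),
    fun i => by
      have := p.2 i
      simp only [map_mul, resO_resO]
      rw [this, mul_assoc]⟩
  one_smul p := Subtype.ext <| Prod.ext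
    (funext fun i => show resO _ 1 * p.1.1 i = _ by rw [map_one, one_mul])
    (funext fun i => show resO _ 1 * p.1.2 i = _ by rw [map_one, one_mul])
  mul_smul c d p := Subtype.ext <| Prod.ext
    (funext fun i => show resO _ (c * d) * p.1.1 i = resO _ c * (resO _ d * p.1.1 i) by
      rw [map_mul, mul_assoc])
    (funext fun i => show resO _ (c * d) * p.1.2 i = resO _ c * (resO _ d * p.1.2 i) by
      rw [map_mul, mul_assoc])
  smul_zero c := Subtype.ext <| Prod.ext (funext fun i => mul_zero _) (funext fun i => mul_zero _)
  smul_add c p q := Subtype.ext <| Prod.ext (funext fun i => mul_add _ _ _)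
    (funext fun i => mul_add _ _ _)
  add_smul c d p := Subtype.ext <| Prod.ext
    (funext fun i => show resO _ (c + d) * p.1.1 i = resO _ c * p.1.1 i + resO _ d * p.1.1 i by
      rw [map_add, add_mul])
    (funext fun i => show resO _ (c + d) * p.1.2 i = resO _ c * p.1.2 i + resO _ d * p.1.2 i by
      rw [map_add, add_mul])
  zero_smul p := Subtype.ext <| Prod.ext
    (funext fun i => show resO _ 0 * p.1.1 i = _ by rw [map_zero, zero_mul]; rfl)
    (funext fun i => show resO _ 0 * p.1.2 i = _ by rw [map_zero, zero_mul]; rfl)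

lemma smul_fst {V : X.Opens} (c : Γ(X, V)) (p : sections g V) (i : Fin r) :
    (c • p).1.1 i = resO inf_le_left c * p.1.1 i := rfl

lemma smul_snd {V : X.Opens} (c : Γ(X, V)) (p : sections g V) (i : Fin r) :
    (c • p).1.2 i = resO inf_le_left c * p.1.2 i := rfl

/-- Restriction of sections of the glued sheaf. -/
noncomputable def restrict {V W : X.Opens} (h : W ≤ V) : sections g V →+ sections g W where
  toFun p := ⟨(fun i => resO (inf_le_inf_right _ h) (p.1.1 i),
    fun i => resO (inf_le_inf_right _ h) (p.1.2 i)), fun i => by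
      have := congrArg (resO (inf_le_inf_right (U₀ ⊓ U₁) h)) (p.2 i)
      simp only [map_mul, resO_resO] at this ⊢
      exact this⟩
  map_zero' := Subtype.ext <| Prod.ext (funext fun i => map_zero _) (funext fun i => map_zero _)
  map_add' p q := Subtype.ext <| Prod.ext (funext fun i => map_add _ _ _)
    (funext fun i => map_add _ _ _)

lemma restrict_fst {V W : X.Opens} (h : W ≤ V) (p : sections g V) (i : Fin r) :
    (restrict g h p).1.1 i = resO (inf_le_inf_right _ h) (p.1.1 i) := rfl

lemma restrict_snd {V W : X.Opens} (h : W ≤ V) (p : sections g V) (i : Fin r) :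
    (restrict g h p).1.2 i = resO (inf_le_inf_right _ h) (p.1.2 i) := rfl

variable {g} in
lemma sections_ext {V : X.Opens} {p q : sections g V} (h₀ : ∀ i, p.1.1 i = q.1.1 i)
    (h₁ : ∀ i, p.1.2 i = q.1.2 i) : p = q :=
  Subtype.ext <| Prod.ext (funext h₀) (funext h₁)

lemma restrict_smul {V W : X.Opens} (h : W ≤ V) (c : Γ(X, V)) (p : sections g V) :
    restrict g h (c • p) = resO h c • restrict g h p :=
  sections_ext
    (fun i => by rw [restrict_fst, smul_fst, smul_fst, restrict_fst, map_mul, resO_resO, resO_resO])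
    (fun i => by rw [restrict_snd, smul_snd, smul_snd, restrict_snd, map_mul, resO_resO, resO_resO])

/-- The abelian presheaf underlying the glued sheaf. -/
noncomputable def abPresheaf : TopCat.Presheaf Ab.{u} X where
  obj V := AddCommGrpCat.of (sections g V.unop)
  map i := AddCommGrpCat.ofHom (restrict g (leOfHom i.unop))
  map_id V := by
    refine AddCommGrpCat.hom_ext (AddMonoidHom.ext fun p => ?_)
    change restrict g le_rfl p = p
    exact sections_ext (fun i => resO_self _ _) (fun i => resO_self _ _)
  map_comp {_ _ _} i j := by
    refine AddCommGrpCat.hom_ext (AddMonoidHom.ext fun p => ?_)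
    change restrict g ((leOfHom j.unop).trans (leOfHom i.unop)) p =
      restrict g (leOfHom j.unop) (restrict g (leOfHom i.unop) p)
    exact sections_ext (fun i => (resO_resO _ _ _).symm) (fun i => (resO_resO _ _ _).symm)

/-- The entries of both vectors glue separately as functions; the compatibility condition is an
equality of functions and so may be checked on the cover. -/
lemma abPresheaf_isSheaf : (abPresheaf g).IsSheaf := by
  rw [TopCat.Presheaf.isSheaf_iff_isSheafUniqueGluing]
  intro ι V s hs
  change ∀ i, sections g (V i) at s
  replace hs : ∀ i j, restrict g inf_le_left (s i) = restrict g inf_le_right (s j) := hs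
  have hc : ∀ (U : X.Opens), ∀ x ∈ iSup V ⊓ U, ∃ i, x ∈ V i ⊓ U := by
    rintro U x ⟨hx, hxU⟩
    obtain ⟨i, hi⟩ := Opens.mem_iSup.1 hx
    exact ⟨i, hi, hxU⟩
  have h₀ : ∀ n, ∃ a : Γ(X, iSup V ⊓ U₀), ∀ i,
      resO (inf_le_inf_right U₀ (le_iSup V i)) a = (s i).1.1 n := fun n =>
    exists_glueO (fun i => V i ⊓ U₀) (fun i => inf_le_inf_right _ (le_iSup V i)) (hc U₀)
      (fun i => (s i).1.1 n) fun i j => by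
        have := congrArg (resO (U := V i ⊓ V j ⊓ U₀) (V := V i ⊓ U₀ ⊓ (V j ⊓ U₀))
          (le_inf (inf_le_inf inf_le_left inf_le_left) (inf_le_left.trans inf_le_right)))
          (congrArg (fun p => p.1.1 n) (hs i j))
        simp only [restrict_fst, resO_resO] at this
        exact this
  have h₁ : ∀ n, ∃ a : Γ(X, iSup V ⊓ U₁), ∀ i,
      resO (inf_le_inf_right U₁ (le_iSup V i)) a = (s i).1.2 n := fun n =>
    exists_glueO (fun i => V i ⊓ U₁) (fun i => inf_le_inf_right _ (le_iSup V i)) (hc U₁)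
      (fun i => (s i).1.2 n) fun i j => by
        have := congrArg (resO (U := V i ⊓ V j ⊓ U₁) (V := V i ⊓ U₁ ⊓ (V j ⊓ U₁))
          (le_inf (inf_le_inf inf_le_left inf_le_left) (inf_le_left.trans inf_le_right)))
          (congrArg (fun p => p.1.2 n) (hs i j))
        simp only [restrict_snd, resO_resO] at this
        exact this
  choose a₀ ha₀ using h₀
  choose a₁ ha₁ using h₁
  refine ⟨(⟨(a₀, a₁), fun n => ?_⟩ : sections g (iSup V)), fun i => ?_, fun p hp => ?_⟩
  · refine sectionO_ext (fun i => V i ⊓ (U₀ ⊓ U₁)) (fun i => inf_le_inf_right _ (le_iSup V i))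
      (hc _) fun i => ?_
    have := (s i).2 n
    rw [← ha₀, ← ha₁] at this
    simp only [map_mul, resO_resO] at this ⊢
    exact this
  · exact sections_ext (fun n => ha₀ n i) (fun n => ha₁ n i)
  · replace hp : ∀ i, restrict g (le_iSup V i) p = s i := hp
    refine sections_ext (fun n => ?_) (fun n => ?_)
    · refine sectionO_ext (fun i => V i ⊓ U₀) (fun i => inf_le_inf_right _ (le_iSup V i))
        (hc _) fun i => (congrArg (fun p => p.1.1 n) (hp i)).trans (ha₀ n i).symm
    · refine sectionO_ext (fun i => V i ⊓ U₁) (fun i => inf_le_inf_right _ (le_iSup V i))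
        (hc _) fun i => (congrArg (fun p => p.1.2 n) (hp i)).trans (ha₁ n i).symm

noncomputable instance (V : X.Opensᵒᵖ) :
    Module (X.ringCatSheaf.obj.obj V) ((abPresheaf g).obj V) :=
  inferInstanceAs (Module Γ(X, V.unop) (sections g V.unop))

/-- The sheaf of modules glued from `𝒪^r` on `U₀` and on `U₁` along the diagonal matrix `g`. -/
noncomputable def sheaf : X.Modules where
  val := PresheafOfModules.ofPresheaf (abPresheaf g) (fun _ _ i c p =>
    restrict_smul g (leOfHom i.unop) c p)
  isSheaf := abPresheaf_isSheaf g

end Glued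

open Glued in
/-- There is a sheaf of modules with frames over `U₀` and `U₁` that differ by a given invertible
diagonal matrix. -/
theorem exists_frames_of_transition {X : Scheme.{u}} {r : ℕ} {U₀ U₁ : X.Opens}
    {g g' : Fin r → Γ(X, U₀ ⊓ U₁)} (hg : ∀ i, g i * g' i = 1) :
    ∃ (E : X.Modules) (e : Fin r → Γ(E, U₀)) (b : Fin r → Γ(E, U₁)), IsFrame E e ∧ IsFrame E b ∧
      ∀ i, res E inf_le_left (e i) = g i • res E inf_le_right (b i) := by
  classical
  -- In the trivialization over `U₁` the section `e i` is `g i` times the standard vector, and in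
  -- the one over `U₀` the section `b i` is `g' i` times it.
  let e : Fin r → sections g U₀ := fun i =>
    ⟨(Pi.single i 1, fun j => if j = i then resO le_rfl (g i) else 0), fun j => by
      by_cases h : j = i
      · subst h; simp
      · simp [h]⟩
  let b : Fin r → sections g U₁ := fun i =>
    ⟨(fun j => if j = i then resO (le_of_eq (inf_comm _ _)) (g' i) else 0, Pi.single i 1), fun j => by
      by_cases h : j = i
      · subst h
        have := congrArg (resO (V := U₁ ⊓ (U₀ ⊓ U₁)) inf_le_right) (hg j)
        rw [map_mul, map_one] at this
        simp only [Pi.single_eq_same, map_one, if_true, resO_resO]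
        rw [mul_comm, this]
      · simp [h]⟩
  have sum_eq : ∀ {V W : X.Opens} (h : W ≤ V) (c : Fin r → Γ(X, W)) (p : Fin r → sections g V),
      (∑ i, c i • res (sheaf g) h (p i) : Γ(sheaf g, W)) =
        (∑ i, c i • restrict g h (p i) : sections g W) := fun h c p => rfl
  have fst_sum : ∀ {W : X.Opens} (p : Fin r → sections g W) (n : Fin r),
      (∑ i, p i : sections g W).1.1 n = ∑ i, (p i).1.1 n := fun p n => by
    rw [AddSubgroup.val_finsetSum, Prod.fst_sum, Finset.sum_apply]
  have snd_sum : ∀ {W : X.Opens} (p : Fin r → sections g W) (n : Fin r),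
      (∑ i, p i : sections g W).1.2 n = ∑ i, (p i).1.2 n := fun p n => by
    rw [AddSubgroup.val_finsetSum, Prod.snd_sum, Finset.sum_apply]
  have fst_e : ∀ (V : X.Opens) (h : V ≤ U₀) (c : Fin r → Γ(X, V)) (n : Fin r),
      (∑ i, c i • restrict g h (e i) : sections g V).1.1 n = resO inf_le_left (c n) := by
    intro V h c n
    rw [fst_sum, Finset.sum_eq_single n]
    · rw [smul_fst, restrict_fst]; simp [e]
    · intro i _ hi
      rw [smul_fst, restrict_fst]; simp [e, hi.symm]
    · simp
  have snd_b : ∀ (V : X.Opens) (h : V ≤ U₁) (c : Fin r → Γ(X, V)) (n : Fin r),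
      (∑ i, c i • restrict g h (b i) : sections g V).1.2 n = resO inf_le_left (c n) := by
    intro V h c n
    rw [snd_sum, Finset.sum_eq_single n]
    · rw [smul_snd, restrict_snd]; simp [b]
    · intro i _ hi
      rw [smul_snd, restrict_snd]; simp [b, hi.symm]
    · simp
  -- Inside `U₀` all of `V ⊓ U₁` lies in the overlap, so the second component is `g` times the
  -- first.
  have ext_fst : ∀ (V : X.Opens) (h : V ≤ U₀) (p q : sections g V),
      (∀ n, p.1.1 n = q.1.1 n) → p = q := by
    intro V h p q hpq
    refine sections_ext hpq fun n => ?_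
    have h1 := p.2 n
    rw [hpq n, ← q.2 n] at h1
    have := congrArg (resO (U := V ⊓ (U₀ ⊓ U₁)) (V := V ⊓ U₁)
      (le_inf inf_le_left (le_inf (inf_le_left.trans h) inf_le_right))) h1
    simpa using this
  -- Recovering the first component from the second requires dividing by `g`, that is, multiplying
  -- by `g'`.
  have ext_snd : ∀ (V : X.Opens) (h : V ≤ U₁) (p q : sections g V),
      (∀ n, p.1.2 n = q.1.2 n) → p = q := by
    intro V h p q hpq
    refine sections_ext (fun n => ?_) hpq
    have h1 := p.2 n
    rw [hpq n, q.2 n] at h1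
    have h2 := congrArg (· * resO (V := V ⊓ (U₀ ⊓ U₁)) inf_le_right (g' n)) h1
    simp only [mul_assoc, ← map_mul, hg, map_one, mul_one] at h2
    have := congrArg (resO (U := V ⊓ (U₀ ⊓ U₁)) (V := V ⊓ U₀)
      (le_inf inf_le_left (le_inf inf_le_right (inf_le_left.trans h)))) h2
    simpa using this.symm
  refine ⟨sheaf g, e, b, isFrame_of_existsUnique (fun V h c hc => ?_) (fun V h p => ?_),
    isFrame_of_existsUnique (fun V h c hc => ?_) (fun V h p => ?_), fun i => ?_⟩
  · replace hc : (∑ i, c i • restrict g h (e i) : sections g V) = 0 := hc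
    funext n
    have := fst_e V h c n
    rw [hc] at this
    have h2 := congrArg (resO (V := V) (le_inf le_rfl h)) this
    simpa using h2.symm
  · refine ⟨fun n => resO (le_inf le_rfl h) ((p : sections g V).1.1 n), ?_⟩
    rw [sum_eq]
    refine ext_fst V h _ _ fun n => ?_
    rw [fst_e, resO_resO, resO_self]
  · replace hc : (∑ i, c i • restrict g h (b i) : sections g V) = 0 := hc
    funext n
    have := snd_b V h c n
    rw [hc] at this
    have h2 := congrArg (resO (V := V) (le_inf le_rfl h)) this
    simpa using h2.symm
  · refine ⟨fun n => resO (le_inf le_rfl h) ((p : sections g V).1.2 n), ?_⟩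
    rw [sum_eq]
    refine ext_snd V h _ _ fun n => ?_
    rw [snd_b, resO_resO, resO_self]
  · suffices h : restrict g inf_le_left (e i) = g i • restrict g inf_le_right (b i) from h
    refine ext_snd _ inf_le_right _ _ fun n => ?_
    rw [smul_snd, restrict_snd, restrict_snd]
    by_cases h : n = i
    · subst h; simp [e, b]
    · simp [e, b, h]

/-! ### Change of frame by an invertible matrix. -/

section ChangeOfFrame

variable {X : Scheme.{u}} {r : ℕ} {E : X.Modules} {U : X.Opens}

lemma sum_smul_matrix {R M : Type*} [CommRing R] [AddCommGroup M] [Module R M]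
    (P : Matrix (Fin r) (Fin r) R) (c : Fin r → R) (e : Fin r → M) :
    ∑ i, c i • ∑ j, P i j • e j = ∑ j, (Matrix.vecMul c P) j • e j := by
  simp only [Matrix.vecMul, dotProduct, Finset.smul_sum, Finset.sum_smul, mul_smul]
  exact Finset.sum_comm

lemma res_sum_smul {V : X.Opens} (h : V ≤ U) (c : Fin r → Γ(X, U)) (e : Fin r → Γ(E, U)) :
    res E h (∑ j, c j • e j) = ∑ j, resO h (c j) • res E h (e j) := by
  simp

/-- An invertible matrix transforms frames to frames. -/
lemma IsFrame.mul {e : Fin r → Γ(E, U)} (he : IsFrame E e)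
    {P Q : Matrix (Fin r) (Fin r) Γ(X, U)} (hPQ : P * Q = 1) :
    IsFrame E (fun i => ∑ j, P i j • e j) := by
  have hPQ' : ∀ (V : X.Opens) (h : V ≤ U), P.map (resO h) * Q.map (resO h) = 1 := by
    intro V h
    rw [← Matrix.map_mul, hPQ, Matrix.map_one _ (map_zero _) (map_one _)]
  have key : ∀ (V : X.Opens) (h : V ≤ U) (c : Fin r → Γ(X, V)),
      ∑ i, c i • res E h (∑ j, P i j • e j) =
        ∑ j, (Matrix.vecMul c (P.map (resO h))) j • res E h (e j) := by
    intro V h c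
    rw [← sum_smul_matrix]
    simp only [res_sum_smul, Matrix.map_apply]
  refine isFrame_of_existsUnique (fun V h c hc => ?_) (fun V h a => ?_)
  · rw [key] at hc
    have h0 : Matrix.vecMul c (P.map (resO h)) = 0 :=
      he.ext_coeff h (by rw [hc]; simp)
    rw [← Matrix.vecMul_one c, ← hPQ' V h, ← Matrix.vecMul_vecMul, h0, Matrix.zero_vecMul]
  · refine ⟨Matrix.vecMul (he.coord h a) (Q.map (resO h)), ?_⟩
    rw [key, Matrix.vecMul_vecMul, mul_eq_one_comm.1 (hPQ' V h), Matrix.vecMul_one, he.sum_coord]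

end ChangeOfFrame

/-! ### Vector bundles on affine opens of an integral scheme; triviality over principal ideal
domains. -/

section Integral

variable {X : Scheme.{u}} {r : ℕ} {E : X.Modules} {U : X.Opens}

lemma nonempty_inf [IrreducibleSpace X] {V W : X.Opens} (hV : (V : Set X).Nonempty)
    (hW : (W : Set X).Nonempty) : ((V ⊓ W : X.Opens) : Set X).Nonempty :=
  nonempty_preirreducible_inter V.2 W.2 hV hW

lemma resO_injective [IsIntegral X] {V W : X.Opens} (h : W ≤ V) (hW : (W : Set X).Nonempty) :
    Function.Injective (resO h : Γ(X, V) → Γ(X, W)) := by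
  obtain ⟨x, hx⟩ := hW
  have : Nonempty W := ⟨⟨x, hx⟩⟩
  exact map_injective_of_isIntegral X (homOfLE h)

/-- In local frames sections are vectors of functions, and on an integral scheme functions are
determined by their restriction to a nonempty open subset. -/
lemma eq_of_res_inf_eq [IsIntegral X] (hE : IsVectorBundle E r) {V W : X.Opens}
    (hW : (W : Set X).Nonempty) {a b : Γ(E, V)}
    (hab : res E (inf_le_left : V ⊓ W ≤ V) a = res E inf_le_left b) : a = b := by
  choose N hN e he using hE
  refine section_ext E (fun x : X => V ⊓ N x) (fun x => inf_le_left) (fun x hx => ⟨x, hx, hN x⟩)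
    fun x => ?_
  rw [← (he x).sum_coord inf_le_right (res E inf_le_left a),
    ← (he x).sum_coord inf_le_right (res E inf_le_left b)]
  congr 1
  funext i
  congr 1
  by_cases hne : ((V ⊓ N x : X.Opens) : Set X).Nonempty
  · refine resO_injective (inf_le_left : V ⊓ N x ⊓ W ≤ V ⊓ N x) (nonempty_inf hne hW) ?_
    have key := congrFun ((he x).coord_res (W := V ⊓ N x ⊓ W) inf_le_right inf_le_left
      (res E (inf_le_left : V ⊓ N x ≤ V) a)) i
    have key' := congrFun ((he x).coord_res (W := V ⊓ N x ⊓ W) inf_le_right inf_le_left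
      (res E (inf_le_left : V ⊓ N x ≤ V) b)) i
    rw [← key, ← key']
    have := congrArg (res E (inf_le_inf_right W inf_le_left : V ⊓ N x ⊓ W ≤ V ⊓ W)) hab
    simp only [res_res] at this ⊢
    rw [this]
  -- Over the empty open set the empty cover shows that any two functions agree.
  · refine sectionO_ext (fun x : Empty => x.elim) (fun x => x.elim) (fun x hx => ?_) (fun x => x.elim)
    exact (hne ⟨x, hx⟩).elim

lemma basicOpen_nonempty [IsIntegral X] {c : Γ(X, U)} (hc : c ≠ 0) :
    (X.basicOpen c : Set X).Nonempty := by
  rw [Set.nonempty_iff_ne_empty]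
  intro h
  exact hc ((basicOpen_eq_bot_iff c).1 (Opens.ext h))

lemma isUnit_resO_basicOpen {V : X.Opens} (c : Γ(X, U)) (h : V ≤ U) (hV : V ≤ X.basicOpen c) :
    IsUnit (resO h c) := by
  have := (RingedSpace.isUnit_res_basicOpen X.toRingedSpace c).map (resO hV)
  convert this using 1
  exact (resO_resO (X.basicOpen_le c) hV c).symm

/-- A power of the function `c` times the section `σ` over `D(c)` extends to `V`. -/
def Extends (E : X.Modules) (c : Γ(X, U)) (σ : Γ(E, X.basicOpen c)) (V : X.Opens) : Prop :=
  ∃ (hVU : V ≤ U) (n : ℕ) (τ : Γ(E, V)), res E (inf_le_left : V ⊓ X.basicOpen c ≤ V) τ =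
    resO ((inf_le_left : V ⊓ X.basicOpen c ≤ V).trans hVU) (c ^ n) •
      res E (inf_le_right : V ⊓ X.basicOpen c ≤ X.basicOpen c) σ

lemma Extends.bot (c : Γ(X, U)) (σ : Γ(E, X.basicOpen c)) : Extends E c σ ⊥ :=
  ⟨bot_le, 0, 0, section_ext E (fun _ : Empty => ⊥) (fun x => x.elim)
    (fun x (hx : x ∈ (⊥ ⊓ X.basicOpen c : X.Opens)) => hx.1.elim) (fun x => x.elim)⟩

/-- Multiplying each extension by the power of `c` used for the other makes both equal to `c ^ (n +
n')` times `σ` over `D(c)`. As `D(c)` is nonempty they then agree on `V ⊓ V'` and glue. -/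
lemma Extends.sup [IsIntegral X] (hE : IsVectorBundle E r) {c : Γ(X, U)} (hc : c ≠ 0)
    {σ : Γ(E, X.basicOpen c)} {V V' : X.Opens} (h : Extends E c σ V) (h' : Extends E c σ V') :
    Extends E c σ (V ⊔ V') := by
  obtain ⟨hVU, n, τ, hτ⟩ := h
  obtain ⟨hVU', n', τ', hτ'⟩ := h'
  obtain ⟨a, ha, ha'⟩ := exists_glue₂ E (U := V ⊔ V') le_sup_left le_sup_right le_rfl
    (W := V ⊓ V') inf_le_left inf_le_right le_rfl (resO hVU (c ^ n') • τ)
    (resO hVU' (c ^ n) • τ') (by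
      refine eq_of_res_inf_eq hE (basicOpen_nonempty hc) ?_
      have h1 := congrArg (res E (inf_le_inf_right (X.basicOpen c) inf_le_left :
        V ⊓ V' ⊓ X.basicOpen c ≤ V ⊓ X.basicOpen c)) hτ
      have h2 := congrArg (res E (inf_le_inf_right (X.basicOpen c) inf_le_right :
        V ⊓ V' ⊓ X.basicOpen c ≤ V' ⊓ X.basicOpen c)) hτ'
      rw [res_res, res_smul, resO_resO, res_res] at h1 h2
      rw [res_res, res_res, res_smul, res_smul, h1, h2, smul_smul, smul_smul, resO_resO,
        resO_resO, mul_comm])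
  refine ⟨sup_le hVU hVU', n' + n, a, ?_⟩
  refine section_ext₂ E (V₀ := V ⊓ X.basicOpen c) (V₁ := V' ⊓ X.basicOpen c)
    (inf_le_inf_right _ le_sup_left) (inf_le_inf_right _ le_sup_right)
    (by rw [inf_sup_right]) ?_ ?_
  · have h1 := congrArg (res E (inf_le_left : V ⊓ X.basicOpen c ≤ V)) ha
    rw [res_res, res_smul, hτ, smul_smul, resO_resO, ← map_mul, ← pow_add] at h1
    rw [res_res, h1, res_smul, resO_resO, res_res]
  · have h1 := congrArg (res E (inf_le_left : V' ⊓ X.basicOpen c ≤ V')) ha'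
    rw [res_res, res_smul, hτ', smul_smul, resO_resO, ← map_mul, ← pow_add, add_comm] at h1
    rw [res_res, h1, res_smul, resO_resO, res_res]

/-- The coordinates of `σ` in the frame are finitely many fractions whose denominators are powers of
`c`; a common denominator gives the extension. -/
lemma exists_extends_of_frame {N V : X.Opens} {b : Fin r → Γ(E, N)} (hb : IsFrame E b)
    (hV : IsAffineOpen V) (hVN : V ≤ N) (hVU : V ≤ U) (c : Γ(X, U)) (σ : Γ(E, X.basicOpen c)) :
    Extends E c σ V := by
  have hW : V ⊓ X.basicOpen c = X.basicOpen (resO hVU c) :=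
    (X.basicOpen_res c (homOfLE hVU).op).symm
  have : IsLocalization.Away (resO hVU c) Γ(X, X.basicOpen (resO hVU c)) :=
    IsAffineOpen.isLocalization_basicOpen hV (resO hVU c)
  let σ' : Γ(E, X.basicOpen (resO hVU c)) := res E (hW.ge.trans inf_le_right) σ
  have hWN : X.basicOpen (resO hVU c) ≤ N := hW.ge.trans (inf_le_left.trans hVN)
  obtain ⟨⟨_, n, rfl⟩, hn⟩ := IsLocalization.exist_integer_multiples_of_finite
    (Submonoid.powers (resO hVU c)) (hb.coord hWN σ')
  choose d hd using hn
  refine ⟨hVU, n, ∑ i, d i • res E hVN (b i), ?_⟩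
  have h : res E (X.basicOpen_le (resO hVU c)) (∑ i, d i • res E hVN (b i)) =
      resO (X.basicOpen_le (resO hVU c)) (resO hVU c ^ n) • σ' := by
    rw [res_sum_smul, ← hb.sum_coord hWN σ', Finset.smul_sum]
    refine Finset.sum_congr rfl fun i _ => ?_
    rw [res_res, smul_smul]
    congr 1
    have := hd i
    rw [Algebra.smul_def] at this
    exact this
  have := congrArg (res E hW.le) h
  rw [res_res, res_smul, ← map_pow, resO_resO, resO_resO, res_res] at this
  exact this

/-- A section over a basic open subset extends after multiplication with a power of the function. -/
lemma exists_extend [IsIntegral X] (hE : IsVectorBundle E r) (hU : IsAffineOpen U)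
    {c : Γ(X, U)} (hc : c ≠ 0) (σ : Γ(E, X.basicOpen c)) :
    ∃ (n : ℕ) (τ : Γ(E, U)), res E (X.basicOpen_le c) τ =
      resO (X.basicOpen_le c) (c ^ n) • σ := by
  suffices H : ∃ V : X.Opens, (U : Set X) ⊆ V ∧ Extends E c σ V by
    obtain ⟨V, hUV, hVU, n, τ, hτ⟩ := H
    obtain rfl : U = V := le_antisymm hUV hVU
    refine ⟨n, τ, ?_⟩
    have := congrArg (res E (le_inf (X.basicOpen_le c) le_rfl)) hτ
    rwa [res_res, res_smul, resO_resO, res_res, res_self] at this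
  refine hU.isCompact.induction_on (p := fun s => ∃ V : X.Opens, s ⊆ (V : Set X) ∧ Extends E c σ V)
    ⟨⊥, Set.empty_subset _, .bot c σ⟩ ?_ ?_ ?_
  · rintro s t hst ⟨V, hV, h⟩
    exact ⟨V, hst.trans hV, h⟩
  · rintro s t ⟨V, hV, h⟩ ⟨V', hV', h'⟩
    exact ⟨V ⊔ V', Set.union_subset_union hV hV', h.sup hE hc h'⟩
  · intro x hx
    obtain ⟨N, hxN, b, hb⟩ := hE x
    obtain ⟨_, ⟨V, hV, rfl⟩, hxV, hVN⟩ := X.isBasis_affineOpens.exists_subset_of_mem_open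
      (show x ∈ N ⊓ U from ⟨hxN, hx⟩) (N ⊓ U).2
    exact ⟨V, mem_nhdsWithin_of_mem_nhds (V.2.mem_nhds hxV), V, le_rfl,
      exists_extends_of_frame hb hV (hVN.trans inf_le_left) (hVN.trans inf_le_right) c σ⟩

/-- The sections `a` generate `E` over every open subset of `V`. -/
def Generates {ι : Type*} (E : X.Modules) (a : ι → Γ(E, U)) {V : X.Opens} (hVU : V ≤ U) : Prop :=
  ∀ (W : X.Opens) (h : W ≤ V), ⊤ ≤ Submodule.span Γ(X, W)
    (Set.range fun i => res E (h.trans hVU) (a i))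

/-- Finitely many global sections generate a vector bundle on an affine scheme. -/
lemma exists_finset_generates [IsIntegral X] (hE : IsVectorBundle E r) (hU : IsAffineOpen U) :
    ∃ T : Finset Γ(E, U), ∀ x ∈ U, ∃ c : Γ(X, U), x ∈ X.basicOpen c ∧
      Generates E (fun a : T => a.1) (X.basicOpen_le c) ∧
      ∃ b : Fin r → Γ(E, X.basicOpen c), IsFrame E b := by
  classical
  have mono : ∀ {S T : Finset Γ(E, U)} (_ : S ⊆ T) {V : X.Opens} (hV : V ≤ U),
      Generates E (fun a : S => a.1) hV → Generates E (fun a : T => a.1) hV := by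
    intro S T hST V hV h W hW
    refine (h W hW).trans (Submodule.span_mono ?_)
    rintro _ ⟨a, rfl⟩
    exact ⟨⟨a.1, hST a.2⟩, rfl⟩
  suffices H : ∃ T : Finset Γ(E, U), ∀ x ∈ (U : Set X), ∃ c : Γ(X, U), x ∈ X.basicOpen c ∧
      Generates E (fun a : T => a.1) (X.basicOpen_le c) ∧
      ∃ b : Fin r → Γ(E, X.basicOpen c), IsFrame E b from H
  refine hU.isCompact.induction_on (p := fun s => ∃ T : Finset Γ(E, U), ∀ x ∈ s,
    ∃ c : Γ(X, U), x ∈ X.basicOpen c ∧ Generates E (fun a : T => a.1) (X.basicOpen_le c) ∧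
      ∃ b : Fin r → Γ(E, X.basicOpen c), IsFrame E b) ⟨∅, by simp⟩ ?_ ?_ ?_
  · rintro s t hst ⟨T, hT⟩
    exact ⟨T, fun x hx => hT x (hst hx)⟩
  · rintro s t ⟨S, hS⟩ ⟨T, hT⟩
    refine ⟨S ∪ T, ?_⟩
    rintro x (hx | hx)
    · obtain ⟨c, hc, hg, hb⟩ := hS x hx
      exact ⟨c, hc, mono Finset.subset_union_left _ hg, hb⟩
    · obtain ⟨c, hc, hg, hb⟩ := hT x hx
      exact ⟨c, hc, mono Finset.subset_union_right _ hg, hb⟩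
  · intro x hx
    obtain ⟨N, hxN, b, hb⟩ := hE x
    obtain ⟨c, hcN, hxc⟩ := hU.exists_basicOpen_le ⟨x, hxN⟩ hx
    have hc : c ≠ 0 := by
      rintro rfl
      rw [Scheme.basicOpen_zero] at hxc
      exact hxc.elim
    -- The members of a local frame extend to `U` only up to powers of `c`, but these are units over
    -- `D(c)`, so the extensions still generate there.
    choose n τ hτ using fun i => exists_extend hE hU hc (res E hcN (b i))
    refine ⟨_, mem_nhdsWithin_of_mem_nhds ((X.basicOpen c).2.mem_nhds hxc), Finset.univ.image τ,
      fun y hy => ⟨c, hy, fun W hW => ?_, _, hb.restrict hcN⟩⟩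
    have hspan := (hb W (hW.trans hcN)).2
    refine hspan.trans (Submodule.span_le.2 ?_)
    rintro _ ⟨i, rfl⟩
    obtain ⟨v, hv⟩ := (isUnit_resO_basicOpen c (hW.trans (X.basicOpen_le c)) hW).pow (n i)
    have h := congrArg (res E hW) (hτ i)
    rw [res_res, res_smul, resO_resO, res_res, map_pow, ← hv] at h
    have h2 : res E (hW.trans hcN) (b i) =
        ((v⁻¹ : (Γ(X, W))ˣ) : Γ(X, W)) • res E (hW.trans (X.basicOpen_le c)) (τ i) := by
      rw [h, smul_smul, Units.inv_mul, one_smul]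
    change res E (hW.trans hcN) (b i) ∈ _
    rw [h2]
    exact Submodule.smul_mem _ _ (Submodule.subset_span
      ⟨⟨τ i, Finset.mem_image_of_mem _ (Finset.mem_univ i)⟩, rfl⟩)

lemma exists_mul_eq_one_of_bases {R M : Type*} [CommRing R] [AddCommGroup M] [Module R M]
    (b c : Module.Basis (Fin r) R M) :
    ∃ P Q : Matrix (Fin r) (Fin r) R, P * Q = 1 ∧ ∀ i, c i = ∑ j, P i j • b j := by
  refine ⟨(b.toMatrix c).transpose, (c.toMatrix b).transpose, ?_, fun i => ?_⟩
  · rw [← Matrix.transpose_mul, Module.Basis.toMatrix_mul_toMatrix_flip, Matrix.transpose_one]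
  · exact (b.sum_toMatrix_smul_self c i).symm

/-- On an affine open subset whose coordinate ring is a principal ideal domain, every vector bundle
has a frame. -/
theorem exists_frame_of_isPrincipalIdealRing [IsIntegral X] (hE : IsVectorBundle E r)
    (hU : IsAffineOpen U) (hne : (U : Set X).Nonempty) [IsPrincipalIdealRing Γ(X, U)] :
    ∃ e : Fin r → Γ(E, U), IsFrame E e := by
  have : Nonempty U := hne.to_subtype
  obtain ⟨T, hT⟩ := exists_finset_generates hE hU
  -- `N` is finitely generated and torsion-free over a principal ideal domain, hence free. Its basis
  -- is the frame sought.
  let N : Submodule Γ(X, U) Γ(E, U) := Submodule.span _ (T : Set Γ(E, U))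
  have hres : ∀ {c : Γ(X, U)}, c ≠ 0 → ∀ {a : Γ(E, U)}, res E (X.basicOpen_le c) a = 0 → a = 0 := by
    intro c hc a ha
    refine eq_of_res_inf_eq hE (basicOpen_nonempty hc) (b := 0) ?_
    have := congrArg (res E (inf_le_right : U ⊓ X.basicOpen c ≤ X.basicOpen c)) ha
    rw [res_res, map_zero] at this
    rw [this, map_zero]
  have htf : ∀ {c : Γ(X, U)}, c ≠ 0 → ∀ {a : Γ(E, U)}, c • a = 0 → a = 0 := by
    intro c hc a ha
    refine hres hc ?_
    have h := congrArg (res E (X.basicOpen_le c)) ha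
    rw [res_smul, map_zero] at h
    exact (isUnit_resO_basicOpen c (X.basicOpen_le c) le_rfl).smul_eq_zero.1 h
  have : Module.Finite Γ(X, U) N := Module.Finite.span_finset _ T
  have : Module.IsTorsionFree Γ(X, U) N := by
    refine Module.IsTorsionFree.of_smul_eq_zero fun c a ha => ?_
    refine or_iff_not_imp_left.2 fun hc => Subtype.ext (htf hc ?_)
    exact congrArg Subtype.val ha
  obtain ⟨ρ, n⟩ := Module.basisOfFiniteTypeTorsionFree' (R := Γ(X, U)) (M := N)
  have hgen : ∀ {c : Γ(X, U)}, Generates E (fun a : T => a.1) (X.basicOpen_le c) →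
      Generates E (fun i => (n i : Γ(E, U))) (X.basicOpen_le c) := by
    intro c hc W hW
    refine (hc W hW).trans (Submodule.span_le.2 ?_)
    rintro _ ⟨⟨a, ha⟩, rfl⟩
    have ha' : a ∈ N := Submodule.subset_span ha
    have h := congrArg Subtype.val (n.sum_repr ⟨a, ha'⟩)
    rw [Submodule.coe_sum] at h
    replace h : _ = a := h
    change res E _ a ∈ _
    rw [← h, map_sum]
    refine Submodule.sum_mem _ fun i _ => ?_
    change res E _ (n.repr ⟨a, ha'⟩ i • (n i : Γ(E, U))) ∈ _
    rw [res_smul]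
    exact Submodule.smul_mem _ _ (Submodule.subset_span ⟨i, rfl⟩)
  -- A relation over `D(c)` becomes one over `U` after clearing denominators, because restriction to
  -- `D(c)` is injective on sections.
  have hind : ∀ c : Γ(X, U), c ≠ 0 → LinearIndependent Γ(X, X.basicOpen c)
      (fun i => res E (X.basicOpen_le c) (n i : Γ(E, U))) := by
    intro c hc
    rw [Fintype.linearIndependent_iff]
    intro d hd
    have : IsLocalization.Away c Γ(X, X.basicOpen c) := hU.isLocalization_basicOpen c
    obtain ⟨⟨_, m, rfl⟩, hm⟩ := IsLocalization.exist_integer_multiples_of_finite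
      (Submonoid.powers c) d
    choose q hq using hm
    have hq' : ∀ i, resO (X.basicOpen_le c) (q i) = resO (X.basicOpen_le c) (c ^ m) * d i := by
      intro i
      have := hq i
      rw [Algebra.smul_def] at this
      exact this
    have h0 : ∑ i, q i • (n i : Γ(E, U)) = 0 := by
      refine hres hc ?_
      rw [map_sum]
      simp only [res_smul, hq', mul_smul]
      rw [← Finset.smul_sum, hd, smul_zero]
    have h1 : ∀ i, q i = 0 := by
      refine Fintype.linearIndependent_iff.1 n.linearIndependent q (Subtype.ext ?_)
      rw [Submodule.coe_sum]
      exact h0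
    intro i
    have h2 := hq' i
    rw [h1, map_zero] at h2
    refine ((isUnit_resO_basicOpen c (X.basicOpen_le c) le_rfl).pow m).mul_left_cancel ?_
    rw [mul_zero, ← map_pow, ← h2]
  have hne0 : ∀ {c : Γ(X, U)} {x : X}, x ∈ X.basicOpen c → c ≠ 0 := by
    rintro c x hx rfl
    rw [Scheme.basicOpen_zero] at hx
    exact hx.elim
  have hbasis : ∀ {c : Γ(X, U)} (hc : c ≠ 0)
      (hg : Generates E (fun a : T => a.1) (X.basicOpen_le c)),
      ∃ B : Module.Basis (Fin ρ) Γ(X, X.basicOpen c) Γ(E, X.basicOpen c),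
        ∀ i, B i = res E (X.basicOpen_le c) (n i : Γ(E, U)) := fun {c} hc hg =>
    ⟨Module.Basis.mk (hind c hc) (hgen hg _ le_rfl), fun i => Module.Basis.mk_apply _ _ i⟩
  obtain ⟨x₀, hx₀⟩ := hne
  obtain rfl : ρ = r := by
    obtain ⟨c, hxc, hg, b, hb⟩ := hT x₀ hx₀
    obtain ⟨B, -⟩ := hbasis (hne0 hxc) hg
    have : Nontrivial Γ(X, X.basicOpen c) :=
      have : Nonempty (X.basicOpen c) := ⟨⟨x₀, hxc⟩⟩
      inferInstance
    have h1 := Module.finrank_eq_card_basis B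
    have h2 := Module.finrank_eq_card_basis (hb.basis le_rfl)
    simpa using h1.symm.trans h2
  refine ⟨fun i => (n i : Γ(E, U)), isFrame_of_locally fun x hx => ?_⟩
  obtain ⟨c, hxc, hg, b, hb⟩ := hT x hx
  obtain ⟨B, hB⟩ := hbasis (hne0 hxc) hg
  refine ⟨X.basicOpen c, X.basicOpen_le c, hxc, ?_⟩
  -- A basis of the sections over the single open set `D(c)` is a frame once one frame exists there:
  -- the matrix between the two bases is invertible and restricts to all smaller opens.
  obtain ⟨P, Q, hPQ, hP⟩ := exists_mul_eq_one_of_bases (hb.basis le_rfl) B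
  have := hb.mul hPQ
  convert this using 2 with i
  rw [← hB, hP]
  simp

end Integral

/-! ### Row reduction and Birkhoff factorization of polynomial matrices. -/

section Birkhoff

open Polynomial

variable {K : Type*} [Field K] {r : ℕ}

/-- The matrix of the coefficients of degree `d i` in the `i`-th row. -/
noncomputable def leadingMatrix (A : Matrix (Fin r) (Fin r) K[X]) (d : Fin r → ℕ) :
    Matrix (Fin r) (Fin r) K :=
  Matrix.of fun i j => (A i j).coeff (d i)

lemma det_updateRow_one {R : Type*} [CommRing R] (i : Fin r) (w : Fin r → R) :
    ((1 : Matrix (Fin r) (Fin r) R).updateRow i w).det = w i := by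
  rw [← Matrix.cramer_transpose_apply, Matrix.transpose_one, Matrix.cramer_one]
  rfl

lemma updateRow_one_mul {R : Type*} [CommRing R] (i : Fin r) (w : Fin r → R)
    (A : Matrix (Fin r) (Fin r) R) :
    (1 : Matrix (Fin r) (Fin r) R).updateRow i w * A = A.updateRow i (Matrix.vecMul w A) := by
  rw [Matrix.updateRow_mul, Matrix.one_mul]

/-- A matrix of polynomials with nonzero determinant can be made row reduced by invertible row
operations. -/
theorem exists_rowReduced (n : ℕ) (A : Matrix (Fin r) (Fin r) K[X]) (hA : A.det ≠ 0)
    (d : Fin r → ℕ) (hd : ∀ i j, (A i j).natDegree ≤ d i) (hn : ∑ i, d i = n) :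
    ∃ (P : Matrix (Fin r) (Fin r) K[X]) (d : Fin r → ℕ), IsUnit P.det ∧
      (∀ i j, ((P * A) i j).natDegree ≤ d i) ∧ (leadingMatrix (P * A) d).det ≠ 0 := by
  induction n using Nat.strong_induction_on generalizing A d with
  | _ n ih =>
  subst hn
  by_cases hL : (leadingMatrix A d).det = 0
  swap
  · exact ⟨1, d, by simp, by simpa using hd, by simpa using hL⟩
  obtain ⟨v, hv, hvL⟩ := Matrix.exists_vecMul_eq_zero_iff.2 hL
  classical
  -- Among the rows in the relation `v` take one of largest `d`. Adding the others, shifted by `X ^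
  -- (d i - d j)`, then cancels all its coefficients of degree `d i`; the operation has determinant
  -- the constant `v i`.
  obtain ⟨i, hi, hmax⟩ : ∃ i, v i ≠ 0 ∧ ∀ j, v j ≠ 0 → d j ≤ d i := by
    obtain ⟨i₀, hi₀⟩ := Function.ne_iff.1 hv
    obtain ⟨i, hi, hmax⟩ := Finset.exists_max_image (Finset.univ.filter fun i => v i ≠ 0) d
      ⟨i₀, by simpa using hi₀⟩
    exact ⟨i, by simpa using hi, fun j hj => hmax j (by simpa using hj)⟩
  let w : Fin r → K[X] := fun j => C (v j) * X ^ (d i - d j)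
  let P₁ : Matrix (Fin r) (Fin r) K[X] := (1 : Matrix (Fin r) (Fin r) K[X]).updateRow i w
  have hP₁ : IsUnit P₁.det := by
    rw [det_updateRow_one]
    simpa [w] using hi
  have hPA : P₁ * A = A.updateRow i (Matrix.vecMul w A) := updateRow_one_mul _ _ _
  have hdet : (P₁ * A).det ≠ 0 := by
    rw [Matrix.det_mul]
    exact mul_ne_zero hP₁.ne_zero hA
  have hdeg : ∀ j, (Matrix.vecMul w A j).natDegree ≤ d i := by
    intro j
    change (∑ l, w l * A l j).natDegree ≤ d i
    refine natDegree_sum_le_of_forall_le _ _ fun l _ => ?_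
    by_cases hl : v l = 0
    · simp [w, hl]
    · have := hmax l hl
      refine natDegree_mul_le.trans ?_
      have h1 : (w l).natDegree ≤ d i - d l := natDegree_C_mul_X_pow_le _ _
      have h2 := hd l j
      omega
  have hcoeff : ∀ j, (Matrix.vecMul w A j).coeff (d i) = 0 := by
    intro j
    have h0 := congrFun hvL j
    simp only [Matrix.vecMul, dotProduct, Pi.zero_apply, leadingMatrix, Matrix.of_apply] at h0 ⊢
    rw [finsetSum_coeff, ← h0]
    refine Finset.sum_congr rfl fun l _ => ?_
    by_cases hl : v l = 0
    · simp [w, hl]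
    · have := hmax l hl
      simp only [w]
      rw [mul_assoc, coeff_C_mul, show d i = d l + (d i - d l) by omega, coeff_X_pow_mul']
      simp
  -- If `d i` were `0`, the cancellation would leave a zero row, against the nonzero determinant. So
  -- `d i - 1` is a genuine decrease.
  have hpos : d i ≠ 0 := by
    intro h0
    refine hdet (Matrix.det_eq_zero_of_row_eq_zero i fun j => ?_)
    rw [hPA, Matrix.updateRow_self]
    have h1 := hdeg j
    rw [h0] at h1
    rw [eq_C_of_natDegree_le_zero h1, ← h0, hcoeff, C_0]
  let d' : Fin r → ℕ := Function.update d i (d i - 1)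
  have hd' : ∀ a b, ((P₁ * A) a b).natDegree ≤ d' a := by
    intro a b
    rw [hPA]
    by_cases ha : a = i
    · subst ha
      rw [Matrix.updateRow_self]
      simp only [d', Function.update_self]
      have h1 := hdeg b
      have h2 : (Matrix.vecMul w A b).natDegree ≠ d a ∨ Matrix.vecMul w A b = 0 := by
        by_contra! h
        refine h.2 (leadingCoeff_eq_zero.1 ?_)
        rw [leadingCoeff, h.1, hcoeff]
      rcases h2 with h2 | h2
      · omega
      · simp [h2]
    · rw [Matrix.updateRow_ne ha]
      simpa [d', ha] using hd a b
  have hlt : ∑ a, d' a < ∑ a, d a := by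
    refine Finset.sum_lt_sum (fun a _ => ?_) ⟨i, Finset.mem_univ i, ?_⟩
    · by_cases ha : a = i
      · subst ha; simp [d']
      · simp [d', ha]
    · simp only [d', Function.update_self]; omega
  obtain ⟨P, e, hP, he, hl⟩ := ih _ hlt _ hdet d' hd' rfl
  refine ⟨P * P₁, e, ?_, ?_, ?_⟩
  · rw [Matrix.det_mul]; exact hP.mul hP₁
  · rwa [Matrix.mul_assoc]
  · rwa [Matrix.mul_assoc]

lemma eval₂_det {R S : Type*} [CommRing R] [CommRing S] (i : R →+* S) (x : S)
    (A : Matrix (Fin r) (Fin r) R[X]) :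
    eval₂ i x A.det = (A.map (eval₂ i x)).det :=
  RingHom.map_det (eval₂RingHom i x) A

/-- A polynomial with nonzero constant term that becomes a multiple of a power of `x` after
substituting `x⁻¹` is constant. -/
lemma isUnit_of_eval₂_inv {q : K[X]} (hq : q.coeff 0 ≠ 0) {c : K} {m D : ℕ}
    {x : FractionRing K[X]} (hx : x = algebraMap K[X] _ X) [Invertible x]
    (h : x ^ D * eval₂ ((algebraMap K[X] (FractionRing K[X])).comp C) (⅟x) q =
      algebraMap K[X] _ (C c * X ^ m)) : IsUnit q := by
  let i : K →+* FractionRing K[X] := (algebraMap K[X] (FractionRing K[X])).comp C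
  have hi : ∀ p : K[X], eval₂ i x p = algebraMap K[X] _ p := by
    intro p
    rw [hx]
    simpa [i] using (hom_eval₂ p C (algebraMap K[X] (FractionRing K[X])) X).symm
  set n := q.natDegree with hn
  have h1 : eval₂ i (⅟x) q * x ^ n = algebraMap K[X] _ q.reverse := by
    have := eval₂_reflect_mul_pow i x n q.reverse ((reverse_natDegree_le q).trans hn.ge)
    rwa [reverse, ← hn, reflect_reflect, hi] at this
  have h2 : X ^ D * q.reverse = C c * X ^ (m + n) := by
    refine IsFractionRing.injective K[X] (FractionRing K[X]) ?_
    rw [map_mul, ← h1, map_pow, ← hx, ← mul_assoc, h, pow_add, ← mul_assoc, map_mul, map_mul _ (C c * X ^ m),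
      map_pow _ X n, ← hx]
    simp
  have hq0 : q ≠ 0 := by rintro rfl; simp at hq
  have hrev0 : q.reverse.coeff 0 ≠ 0 := by
    rw [coeff_zero_reverse]; exact leadingCoeff_ne_zero.2 hq0
  -- The constant term of `q.reverse` is the leading coefficient of `q`, hence nonzero, so the
  -- lowest term on the left of `h2` has degree `D` and that on the right `m + n`.
  have hD : D = m + n := by
    have h3 := congrArg (fun p => coeff p D) h2
    simp only [coeff_C_mul_X_pow] at h3
    have h4 : (X ^ D * q.reverse).coeff D = q.reverse.coeff 0 := by
      simpa using coeff_X_pow_mul q.reverse D 0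
    rw [h4] at h3
    by_contra hne
    rw [if_neg hne] at h3
    exact hrev0 h3
  rw [hD, mul_comm] at h2
  have h4 : q.reverse = C c := mul_right_cancel₀ (pow_ne_zero _ X_ne_zero) h2
  have h5 : q.natDegree = 0 := by
    have := natDegree_eq_reverse_natDegree_add_natTrailingDegree q
    rwa [h4, natDegree_C, zero_add, natTrailingDegree_eq_zero.2 (Or.inr hq)] at this
  rw [eq_C_of_natDegree_eq_zero h5]
  exact isUnit_C.2 hq.isUnit

/-- Birkhoff factorization of a matrix of polynomials whose determinant is a monomial. -/
theorem exists_birkhoff (A : Matrix (Fin r) (Fin r) K[X]) {c : K} (hc : c ≠ 0) {m : ℕ}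
    (hA : A.det = C c * X ^ m) :
    ∃ (P Q : Matrix (Fin r) (Fin r) K[X]) (d : Fin r → ℕ), IsUnit P.det ∧ IsUnit Q.det ∧
      (∀ i j, (Q i j).natDegree ≤ d i) ∧ ∀ i j, (P * A) i j = reflect (d i) (Q i j) := by
  have hA0 : A.det ≠ 0 := by
    rw [hA]; exact mul_ne_zero (C_ne_zero.2 hc) (pow_ne_zero _ X_ne_zero)
  obtain ⟨P, d, hP, hd, hl⟩ := exists_rowReduced _ A hA0
    (fun i => Finset.univ.sup fun j => (A i j).natDegree)
    (fun i j => Finset.le_sup (f := fun j => (A i j).natDegree) (Finset.mem_univ j)) rfl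
  -- Reversing row `i` in degree `d i` expresses `P * A` as `diag (x ^ d i)` times `Q` evaluated at
  -- `1 / x`.
  let Q : Matrix (Fin r) (Fin r) K[X] := Matrix.of fun i j => reflect (d i) ((P * A) i j)
  have hQ : ∀ i j, (P * A) i j = reflect (d i) (Q i j) := fun i j => by simp [Q]
  refine ⟨P, Q, d, hP, ?_, fun i j => ?_, hQ⟩
  -- Row reducedness enters here: `Q` at `0` is the leading matrix. Moreover `det Q` at `1 / x`
  -- times `x ^ ∑ d i` is `det (P * A)`, a monomial, which forces `det Q` to be constant.
  · have hQ0 : Q.det.coeff 0 ≠ 0 := by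
      have h1 : Q.det.coeff 0 = (leadingMatrix (P * A) d).det := by
        rw [← constantCoeff_apply, RingHom.map_det]
        congr 1
        ext i j
        simp [Q, leadingMatrix, coeff_reflect]
      rwa [h1]
    obtain ⟨c', hc', hPc⟩ := isUnit_iff.1 hP
    let x : FractionRing K[X] := algebraMap K[X] _ X
    have hx0 : x ≠ 0 := by
      simp only [x, ne_eq, map_eq_zero_iff _ (IsFractionRing.injective K[X] (FractionRing K[X]))]
      exact X_ne_zero
    let : Invertible x := invertibleOfNonzero hx0
    let i : K →+* FractionRing K[X] := (algebraMap K[X] (FractionRing K[X])).comp C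
    have hi : ∀ p : K[X], eval₂ i x p = algebraMap K[X] _ p := by
      intro p
      simpa [i, x] using (hom_eval₂ p C (algebraMap K[X] (FractionRing K[X])) X).symm
    refine isUnit_of_eval₂_inv hQ0 (c := c' * c) (m := m) (D := ∑ i, d i) (x := x) rfl ?_
    change x ^ (∑ i, d i) * eval₂ i (⅟x) Q.det = _
    rw [eval₂_det, ← Finset.prod_pow_eq_pow_sum, ← Matrix.det_mul_column]
    have h2 : (Matrix.of fun a b => x ^ d a * (Q.map (eval₂ i (⅟x))) a b) =
        (P * A).map (algebraMap K[X] (FractionRing K[X])) := by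
      ext a b
      have := eval₂_reflect_mul_pow i x (d a) ((P * A) a b) (hd a b)
      rw [hi] at this
      rw [Matrix.map_apply, ← this, mul_comm]
      rfl
    rw [h2, ← RingHom.mapMatrix_apply, ← RingHom.map_det, Matrix.det_mul, hA, ← hPc]
    congr 1
    rw [C_mul, mul_assoc]
  · exact natDegree_reflect_le.trans (max_le le_rfl (hd i j))

end Birkhoff

/-! ### Local rings of étale algebras over `k[X]`. -/

section SmoothAlgebra

open Polynomial IsLocalRing

/-- In a Noetherian local ring whose maximal ideal is generated by `x`, every nonzero element is a
unit times a power of `x`. -/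
lemma exists_eq_unit_mul_pow {R : Type*} [CommRing R] [IsLocalRing R] [IsNoetherianRing R] {x : R}
    (hx : maximalIdeal R = Ideal.span {x}) {a : R} (ha : a ≠ 0) :
    ∃ (u : R) (n : ℕ), IsUnit u ∧ a = u * x ^ n := by
  classical
  have h1 : ∃ n, a ∉ maximalIdeal R ^ n := by
    by_contra! h
    have h2 := Ideal.iInf_pow_eq_bot_of_isLocalRing (maximalIdeal R) (maximalIdeal.isMaximal R).ne_top
    exact ha ((Submodule.mem_bot R).1 (h2 ▸ (Submodule.mem_iInf _).2 h))
  obtain ⟨n, hn⟩ : ∃ n, Nat.find h1 = n + 1 := by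
    refine Nat.exists_eq_succ_of_ne_zero fun h0 => ?_
    have := Nat.find_spec h1
    rw [h0, pow_zero] at this
    exact this (by simp)
  have h3 : a ∈ maximalIdeal R ^ n := not_not.1 (Nat.find_min h1 (by omega))
  have h4 : a ∉ maximalIdeal R ^ (n + 1) := hn ▸ Nat.find_spec h1
  rw [hx, Ideal.span_singleton_pow, Ideal.mem_span_singleton] at h3 h4
  obtain ⟨u, rfl⟩ := h3
  refine ⟨u, n, ?_, mul_comm _ _⟩
  by_contra hu
  have : u ∈ maximalIdeal R := hu
  rw [hx, Ideal.mem_span_singleton] at this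
  obtain ⟨v, rfl⟩ := this
  exact h4 ⟨v, by ring⟩

/-- Nonzero elements are units times powers of `x`, and no power of the regular element `x`
vanishes, so there are no zero divisors. A local Noetherian domain with principal nonzero maximal
ideal is a discrete valuation ring. -/
lemma isDiscreteValuationRing_of_span_singleton {R : Type*} [CommRing R] [IsLocalRing R]
    [IsNoetherianRing R] {x : R} (hx : maximalIdeal R = Ideal.span {x})
    (hreg : IsSMulRegular R x) : ∃ _ : IsDomain R, IsDiscreteValuationRing R := by
  have hx0 : x ≠ 0 := by
    rintro rfl
    exact one_ne_zero (hreg (show (0 : R) • (1 : R) = (0 : R) • 0 by simp))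
  have hd : NoZeroDivisors R := by
    refine ⟨fun {a b} hab => ?_⟩
    by_contra! h
    obtain ⟨u, n, hu, rfl⟩ := exists_eq_unit_mul_pow hx h.1
    obtain ⟨v, m, hv, rfl⟩ := exists_eq_unit_mul_pow hx h.2
    have h1 : x ^ (n + m) = 0 := by
      rw [← (hu.mul hv).mul_right_eq_zero, ← hab]; ring
    have h2 : x ^ (n + m) • (1 : R) = x ^ (n + m) • 0 := by simp [h1]
    exact one_ne_zero (hreg.pow _ h2)
  have hD : IsDomain R := NoZeroDivisors.to_isDomain R
  have hF : ¬IsField R := fun hf => ?_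
  · have h1 : IsDiscreteValuationRing R ↔ (maximalIdeal R).IsPrincipal :=
      (IsDiscreteValuationRing.TFAE R hF).out 0 4
    exact ⟨hD, h1.2 ⟨x, hx⟩⟩
  have h1 := (isField_iff_maximalIdeal_eq.1 hf)
  rw [hx, Ideal.span_singleton_eq_bot] at h1
  exact hx0 h1

lemma isNoetherianRing_localization (A : Type*) {B : Type*} [CommRing A] [CommRing B] [Algebra A B]
    [IsNoetherianRing A] [Algebra.FiniteType A B] (q : Ideal B) [q.IsPrime] :
    IsNoetherianRing (Localization.AtPrime q) :=
  have : IsNoetherianRing B := Algebra.FiniteType.isNoetherianRing A B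
  IsLocalization.isNoetherianRing q.primeCompl _ inferInstance

variable {k B : Type*} [Field k] [CommRing B] [Algebra k B] [Algebra k[X] B]
  [IsScalarTower k k[X] B] [Algebra.Etale k[X] B] (q : Ideal B) [q.IsPrime]

/-- This is unramifiedness of the étale algebra at `q`. -/
lemma map_under_eq_maximalIdeal :
    (q.under k[X]).map (algebraMap k[X] (Localization.AtPrime q)) = maximalIdeal _ :=
  letI := Localization.AtPrime.algebraOfLiesOver (q.under k[X]) q
  ((Algebra.isUnramifiedAt_iff_map_eq k[X] (q.under k[X]) q).1 inferInstance).2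

/-- A local ring of an étale `k[X]`-algebra at a prime over the generic point is a field. -/
lemma isField_of_under_eq_bot (hq : q.under k[X] = ⊥) : IsField (Localization.AtPrime q) := by
  rw [isField_iff_maximalIdeal_eq, ← map_under_eq_maximalIdeal (k := k), hq, Ideal.map_bot]

/-- A generator of the prime of `k[X]` below generates the maximal ideal since the algebra is
unramified, and is regular since it is flat. -/
lemma isDiscreteValuationRing_of_under_ne_bot (hq : q.under k[X] ≠ ⊥) :
    ∃ _ : IsDomain (Localization.AtPrime q), IsDiscreteValuationRing (Localization.AtPrime q) := by
  have := isNoetherianRing_localization k[X] q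
  obtain ⟨π, hπ⟩ := IsPrincipalIdealRing.principal (q.under k[X])
  rw [Ideal.submodule_span_eq] at hπ
  have hπ0 : π ≠ 0 := by
    rintro rfl
    exact hq (by simpa using hπ)
  refine isDiscreteValuationRing_of_span_singleton (x := algebraMap k[X] _ π) ?_ ?_
  · rw [← map_under_eq_maximalIdeal (k := k), hπ, Ideal.map_span, Set.image_singleton]
  · have : Module.Flat k[X] (Localization.AtPrime q) := inferInstance
    exact IsSMulRegular.of_flat (mul_right_injective₀ hπ0)

/-- The residue field at `q` is algebraic over that of the maximal ideal below, which is finite over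
`k` by the Nullstellensatz. So the residue of `b` is a root of a nonzero polynomial. -/
lemma exists_eval₂_mem_maximalIdeal (hq : q.under k[X] ≠ ⊥) (b : Localization.AtPrime q) :
    ∃ P : k[X], P ≠ 0 ∧ eval₂ (algebraMap k _) b P ∈ maximalIdeal (Localization.AtPrime q) := by
  let := Localization.AtPrime.algebraOfLiesOver (q.under k[X]) q
  have hmax : (q.under k[X]).IsMaximal := Ideal.IsPrime.isMaximal inferInstance hq
  let : Field (k[X] ⧸ q.under k[X]) := Ideal.Quotient.field _
  have h1 : Module.Finite k (k[X] ⧸ q.under k[X]) := finite_of_finite_type_of_isJacobsonRing _ _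
  have h2 : Algebra.IsAlgebraic k (q.under k[X]).ResidueField := by
    refine ⟨fun y => ?_⟩
    obtain ⟨z, rfl⟩ := (Ideal.bijective_algebraMap_quotient_residueField (q.under k[X])).2 y
    exact (Algebra.IsAlgebraic.isAlgebraic (R := k) z).algebraMap
  have h3 : Algebra.IsAlgebraic (q.under k[X]).ResidueField q.ResidueField := inferInstance
  have h4 : Algebra.IsAlgebraic k q.ResidueField := by
    have : IsScalarTower k (q.under k[X]).ResidueField q.ResidueField := inferInstance
    exact Algebra.IsAlgebraic.trans k (q.under k[X]).ResidueField _
  obtain ⟨P, hP, hPb⟩ := h4.isAlgebraic (residue _ b)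
  refine ⟨P, hP, ?_⟩
  rw [← residue_eq_zero_iff, hom_eval₂]
  exact hPb

end SmoothAlgebra

/-! ### Local structure of smooth curves. -/

section SmoothCurve

open Polynomial IsLocalRing

variable {k : Type u} [Field k] {X : Scheme.{u}} (f : X ⟶ Spec (.of k))

/-- Evaluation at `a` of polynomials over `k`. -/
noncomputable def evalSection {U : X.Opens} (a : Γ(X, U)) : k[X] →+* Γ(X, U) :=
  eval₂RingHom (scalars f U) a

/-- A standard smooth algebra of relative dimension one is étale over a polynomial ring in one
variable; `a` is the image of the variable. -/
lemma exists_etale_chart [SmoothOfRelativeDimension 1 f] (x : X) :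
    ∃ (V : X.Opens) (_ : IsAffineOpen V) (_ : x ∈ V) (a : Γ(X, V)), (evalSection f a).Etale := by
  obtain ⟨U, hU, V, hV, hx, e, hf⟩ :=
    SmoothOfRelativeDimension.exists_isStandardSmoothOfRelativeDimension (n := 1) (f := f) x
  have hUT : U = ⊤ := by
    refine top_unique fun y _ => ?_
    have : Subsingleton (Spec (.of k)) := inferInstanceAs (Subsingleton (PrimeSpectrum k))
    exact Subsingleton.elim (f x) y ▸ e hx
  subst hUT
  have h1 : (scalars f V).IsStandardSmoothOfRelativeDimension 1 := by
    have h2 := RingHom.IsStandardSmoothOfRelativeDimension.equiv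
      (Scheme.ΓSpecIso (.of k)).symm.commRingCatIsoToRingEquiv
    have h3 : scalars f V = (f.appLE ⊤ V e).hom.comp (Scheme.ΓSpecIso (.of k)).inv.hom := by
      rfl
    rw [h3]
    exact hf.comp h2
  obtain ⟨g, hg, hge⟩ := h1.exists_etale_mvPolynomial
  let e₁ : MvPolynomial (Fin 1) k ≃ₐ[k] k[X] :=
    (MvPolynomial.renameEquiv k (Equiv.ofUnique (Fin 1) PUnit.{1})).trans (MvPolynomial.pUnitAlgEquiv k)
  refine ⟨V, hV, hx, g (MvPolynomial.X 0), ?_⟩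
  have h3 : evalSection f (g (MvPolynomial.X 0)) = g.comp e₁.symm.toRingEquiv.toRingHom := by
    ext a
    · simp [evalSection, ← hg, e₁]
    · simp [evalSection, e₁]
  rw [h3]
  exact RingHom.Etale.stableUnderComposition _ _ (.of_bijective e₁.symm.bijective) hge

lemma map_evalSection {U V : X.Opens} (h : V ≤ U) (a : Γ(X, U)) (P : k[X]) :
    resO h (evalSection f a P) = evalSection f (resO h a) P := by
  simp only [evalSection, coe_eval₂RingHom]
  rw [hom_eval₂]
  congr 1
  ext c
  exact map_scalars f (homOfLE h) c

lemma germ_scalars {U V : X.Opens} {x : X} (hU : x ∈ U) (hV : x ∈ V) (c : k) :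
    X.presheaf.germ U x hU (scalars f U c) = X.presheaf.germ V x hV (scalars f V c) := by
  rw [← map_scalars f (homOfLE (le_top : U ≤ ⊤)), ← map_scalars f (homOfLE (le_top : V ≤ ⊤))]
  exact (germ_resO le_top hU _).trans (germ_resO le_top hV _).symm

lemma exists_localRingEquiv {V : X.Opens} (hV : IsAffineOpen V) {x : X} (hx : x ∈ V) :
    ∃ (q : Ideal Γ(X, V)) (_ : q.IsPrime) (φ : X.presheaf.stalk x ≃+* Localization.AtPrime q),
      ∀ a, φ (X.presheaf.germ V x hx a) = algebraMap _ _ a := by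
  have := hV.isLocalization_stalk ⟨x, hx⟩
  let := (X.presheaf.germ V x hx).hom.toAlgebra
  refine ⟨(hV.primeIdealOf ⟨x, hx⟩).asIdeal, inferInstance, ?_⟩
  have : IsLocalization.AtPrime (X.presheaf.stalk x) (hV.primeIdealOf ⟨x, hx⟩).asIdeal :=
    hV.isLocalization_stalk ⟨x, hx⟩
  exact ⟨(IsLocalization.algEquiv (hV.primeIdealOf ⟨x, hx⟩).asIdeal.primeCompl _ _).toRingEquiv,
    fun a => (IsLocalization.algEquiv _ _ _).commutes a⟩

/-- A point of a smooth curve over `k` either is a generic point, at which some function is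
transcendental over `k`, or its local ring is a discrete valuation ring with residue field
algebraic over `k`. -/
theorem stalk_smoothCurve [SmoothOfRelativeDimension 1 f] (x : X) :
    (IsField (X.presheaf.stalk x) ∧ ∃ (U : X.Opens) (_ : x ∈ U) (a : Γ(X, U)),
      ∀ P : k[X], P ≠ 0 → x ∈ X.basicOpen (evalSection f a P)) ∨
    ((∃ _ : IsDomain (X.presheaf.stalk x), IsDiscreteValuationRing (X.presheaf.stalk x)) ∧
      ∀ (U : X.Opens) (_ : x ∈ U) (a : Γ(X, U)),
        ∃ P : k[X], P ≠ 0 ∧ x ∉ X.basicOpen (evalSection f a P)) := by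
  obtain ⟨V, hV, hx, a, ha⟩ := exists_etale_chart f x
  obtain ⟨q, hq, φ, hφ⟩ := exists_localRingEquiv hV hx
  let : Algebra k Γ(X, V) := (scalars f V).toAlgebra
  let : Algebra k[X] Γ(X, V) := (evalSection f a).toAlgebra
  have : IsScalarTower k k[X] Γ(X, V) := .of_algebraMap_eq fun c => by
    simp [RingHom.algebraMap_toAlgebra, evalSection]
  have : Algebra.Etale k[X] Γ(X, V) := ha
  -- If `q` lies over the generic point of the line, every nonzero polynomial in the étale
  -- coordinate is a unit at `x`; otherwise `q` lies over a closed point.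
  by_cases h : q.under k[X] = ⊥
  · refine Or.inl ⟨φ.toMulEquiv.isField (isField_of_under_eq_bot q h), V, hx, a, fun P hP => ?_⟩
    rw [Scheme.mem_basicOpen _ _ _ hx]
    rw [← MulEquiv.isUnit_map φ, hφ]
    have : IsUnit (algebraMap Γ(X, V) (Localization.AtPrime q) (evalSection f a P)) ↔ _ :=
      IsLocalization.AtPrime.isUnit_to_map_iff (Localization.AtPrime q) q _
    rw [this]
    intro hPq
    have h1 : P ∈ q.under k[X] := hPq
    rw [h] at h1
    exact hP h1
  · refine Or.inr ⟨?_, fun U hxU b => ?_⟩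
    · obtain ⟨h1, h2⟩ := isDiscreteValuationRing_of_under_ne_bot q h
      have h3 : IsDomain (X.presheaf.stalk x) := φ.toMulEquiv.isDomain _
      exact ⟨h3, IsDiscreteValuationRing.RingEquivClass.isDiscreteValuationRing φ.symm⟩
    · obtain ⟨P, hP, hPm⟩ := exists_eval₂_mem_maximalIdeal q h (φ (X.presheaf.germ U x hxU b))
      refine ⟨P, hP, ?_⟩
      rw [Scheme.mem_basicOpen _ _ _ hxU, ← MulEquiv.isUnit_map φ]
      have h1 : φ (X.presheaf.germ U x hxU (evalSection f b P)) =
          eval₂ (algebraMap k _) (φ (X.presheaf.germ U x hxU b)) P := by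
        simp only [evalSection, coe_eval₂RingHom]
        have h2 := hom_eval₂ P (scalars f U) ((φ : X.presheaf.stalk x →+* Localization.AtPrime q).comp
          (X.presheaf.germ U x hxU).hom) b
        refine h2.trans ?_
        congr 1
        ext c
        change φ (X.presheaf.germ U x hxU (scalars f U c)) =
          algebraMap Γ(X, V) (Localization.AtPrime q) (scalars f V c)
        rw [← hφ, germ_scalars f hxU hx]
      rw [h1]
      exact hPm

lemma isReduced_of_smoothCurve [SmoothOfRelativeDimension 1 f] : IsReduced X := by
  have (x : X) : _root_.IsReduced (X.presheaf.stalk x) := by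
    rcases stalk_smoothCurve f x with ⟨h, -⟩ | ⟨⟨h, -⟩, -⟩
    · let := h.toField
      infer_instance
    · infer_instance
  exact isReduced_of_isReduced_stalk X

lemma isIntegral_of_smoothCurve [SmoothOfRelativeDimension 1 f] [IrreducibleSpace X] :
    IsIntegral X :=
  have := isReduced_of_smoothCurve f
  isIntegral_of_irreducibleSpace_of_isReduced X

end SmoothCurve

/-! ### Mayer–Vietoris: sections over an overlap when `H¹` vanishes. -/

section MayerVietoris

open Opposite Abelian Limits

variable {T : Type u} [TopologicalSpace T]

/-- The free abelian presheaf on the sections of an open set. -/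
noncomputable abbrev freePresheaf (U : Opens T) : (Opens T)ᵒᵖ ⥤ AddCommGrpCat.{u} :=
  yoneda.obj U ⋙ AddCommGrpCat.free

/-- The free abelian sheaf on the sections of an open set. -/
noncomputable abbrev freeSheaf (U : Opens T) :
    Sheaf (Opens.grothendieckTopology T) AddCommGrpCat.{u} :=
  (presheafToSheaf _ _).obj (freePresheaf U)

lemma free_hom_ext {α : Type u} {G : AddCommGrpCat.{u}} {g h : AddCommGrpCat.free.obj α ⟶ G}
    (H : ∀ a, g (FreeAbelianGroup.of a) = h (FreeAbelianGroup.of a)) : g = h :=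
  AddCommGrpCat.hom_ext (FreeAbelianGroup.lift_ext _ _ H)

lemma biprod_lift_neg_comp {A : Type*} [Category* A] [Preadditive A] [HasBinaryBiproducts A]
    {a b c d : A} (p : d ⟶ a) (q : d ⟶ b) (ψ : a ⊞ b ⟶ c) :
    biprod.lift p (-q) ≫ ψ = p ≫ biprod.inl ≫ ψ + -(q ≫ biprod.inr ≫ ψ) := by
  rw [biprod.lift_eq, Preadditive.add_comp, Category.assoc, Category.assoc,
    Preadditive.neg_comp]

/-- The inclusion of the free presheaf on a smaller open set. -/
noncomputable abbrev freePresheafMap {U V : Opens T} (h : U ⟶ V) :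
    freePresheaf U ⟶ freePresheaf V :=
  Functor.whiskerRight (yoneda.map h) _

/-- The section of `F` over `U` that corresponds to a morphism from the free sheaf on `U`. -/
noncomputable def freeSection {U : Opens T}
    {F : Sheaf (Opens.grothendieckTopology T) AddCommGrpCat.{u}} (ψ : freeSheaf U ⟶ F) :
    F.obj.obj (op U) :=
  (toSheafify (Opens.grothendieckTopology T) (freePresheaf U) ≫ ψ.hom).app (op U)
    (FreeAbelianGroup.of (𝟙 U))

lemma freeSection_add {U : Opens T}
    {F : Sheaf (Opens.grothendieckTopology T) AddCommGrpCat.{u}} (ψ ψ' : freeSheaf U ⟶ F) :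
    freeSection (ψ + ψ') = freeSection ψ + freeSection ψ' := rfl

lemma freeSection_neg {U : Opens T}
    {F : Sheaf (Opens.grothendieckTopology T) AddCommGrpCat.{u}} (ψ : freeSheaf U ⟶ F) :
    freeSection (-ψ) = -freeSection ψ := rfl

lemma freeSection_comp {U V : Opens T} (h : U ⟶ V)
    {F : Sheaf (Opens.grothendieckTopology T) AddCommGrpCat.{u}} (ψ : freeSheaf V ⟶ F) :
    freeSection ((presheafToSheaf _ _).map (freePresheafMap h) ≫ ψ) =
      F.obj.map h.op (freeSection ψ) := by
  have h1 : toSheafify (Opens.grothendieckTopology T) (freePresheaf U) ≫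
      ((presheafToSheaf _ _).map (freePresheafMap h) ≫ ψ).hom =
      freePresheafMap h ≫ toSheafify (Opens.grothendieckTopology T) (freePresheaf V) ≫ ψ.hom := by
    have := toSheafify_naturality (Opens.grothendieckTopology T) (freePresheafMap h)
    rw [← Category.assoc, this, Category.assoc]
    rfl
  have h2 := congr($((toSheafify (Opens.grothendieckTopology T) (freePresheaf V) ≫ ψ.hom).naturality
    h.op) (FreeAbelianGroup.of (𝟙 V)))
  refine (congr($(congr_app h1 (op U)) (FreeAbelianGroup.of (𝟙 U)))).trans ?_
  refine Eq.trans ?_ h2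
  change (toSheafify _ (freePresheaf V) ≫ ψ.hom).app (op U)
    ((freePresheafMap h).app (op U) (FreeAbelianGroup.of (𝟙 U))) =
    (toSheafify _ (freePresheaf V) ≫ ψ.hom).app (op U)
    ((freePresheaf V).map h.op (FreeAbelianGroup.of (𝟙 V)))
  congr 1

/-- Yoneda, followed by the universal properties of free abelian groups and of sheafification. -/
lemma exists_freeSection_eq {U : Opens T}
    {F : Sheaf (Opens.grothendieckTopology T) AddCommGrpCat.{u}} (c : F.obj.obj (op U)) :
    ∃ ψ : freeSheaf U ⟶ F, freeSection ψ = c := by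
  let η : freePresheaf U ⟶ F.obj :=
    { app := fun W => AddCommGrpCat.ofHom (FreeAbelianGroup.lift fun i : W.unop ⟶ U =>
        (F.obj.map i.op c : F.obj.obj W))
      naturality := fun W W' j => by
        refine free_hom_ext fun i => ?_
        have h1 : (F.obj.map (j.unop ≫ i).op c : F.obj.obj W') = F.obj.map j (F.obj.map i.op c) := by
          rw [op_comp, F.obj.map_comp]
          rfl
        refine Eq.trans ?_ (h1.trans ?_)
        · exact (FreeAbelianGroup.lift_apply_of _ _)
        · exact congrArg (F.obj.map j) (FreeAbelianGroup.lift_apply_of _ _).symm }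
  refine ⟨⟨sheafifyLift _ η F.property⟩, ?_⟩
  have h1 : toSheafify (Opens.grothendieckTopology T) (freePresheaf U) ≫
      sheafifyLift _ η F.property = η := toSheafify_sheafifyLift _ _ _
  refine (congr($(congr_app h1 (op U)) (FreeAbelianGroup.of (𝟙 U)))).trans ?_
  refine (FreeAbelianGroup.lift_apply_of _ _).trans ?_
  simp

/-- The free sheaf on the whole space is the constant sheaf. -/
noncomputable def freePresheafTopIso :
    freePresheaf (⊤ : Opens T) ≅
      (Functor.const _).obj (AddCommGrpCat.of (ULift.{u} ℤ)) :=
  NatIso.ofComponents (fun W =>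
    haveI : Unique (W.unop ⟶ (⊤ : Opens T)) := ⟨⟨homOfLE le_top⟩, fun _ => Subsingleton.elim _ _⟩
    ((FreeAbelianGroup.uniqueEquiv (W.unop ⟶ (⊤ : Opens T))).trans
      AddEquiv.ulift.symm).toAddCommGrpIso) (by
    intro W W' j
    have (V : Opens T) : Unique (V ⟶ (⊤ : Opens T)) :=
      ⟨⟨homOfLE le_top⟩, fun _ => Subsingleton.elim _ _⟩
    refine free_hom_ext fun i => ?_
    refine (congrArg ULift.up (FreeAbelianGroup.lift_apply_of (fun _ : W'.unop ⟶ ⊤ => (1 : ℤ))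
      (j.unop ≫ i))).trans ?_
    exact (congrArg ULift.up (FreeAbelianGroup.lift_apply_of
      (fun _ : W.unop ⟶ ⊤ => (1 : ℤ)) i)).symm)

/-- Regard `c` as a morphism from the free sheaf on `U ⊓ V`. In the long exact `Ext` sequence of `0
→ ℤ_{U ⊓ V} → ℤ_U ⊕ ℤ_V → ℤ_{U ⊔ V} → 0` the obstruction to extending it to the middle term lies in
`Ext¹` of the last term, which is `H¹` as `U ⊔ V` is everything. -/
theorem exists_sub_of_subsingleton_H {U V : Opens T} (hUV : U ⊔ V = ⊤)
    {F : Sheaf (Opens.grothendieckTopology T) AddCommGrpCat.{u}} (hF : Subsingleton (Sheaf.H F 1))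
    (c : F.obj.obj (op (U ⊓ V))) :
    ∃ (a : F.obj.obj (op U)) (b : F.obj.obj (op V)),
      c = F.obj.map (homOfLE inf_le_left).op a - F.obj.map (homOfLE inf_le_right).op b := by
  obtain ⟨φ, rfl⟩ := exists_freeSection_eq c
  let S := Opens.mayerVietorisSquare U V
  have h1 : Subsingleton (Ext (S.shortComplex.X₃) F 1) := by
    -- `Sheaf.H` is defined by `Ext` out of the constant sheaf, which is the free sheaf on `⊤ = U ⊔
    -- V`.
    let i : (constantSheaf (Opens.grothendieckTopology T) AddCommGrpCat.{u}).obj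
        (AddCommGrpCat.of (ULift.{u} ℤ)) ≅ S.shortComplex.X₃ :=
      (presheafToSheaf _ _).mapIso (freePresheafTopIso.symm ≪≫ eqToIso (by rw [← hUV]; rfl))
    refine ⟨fun x y => ?_⟩
    have h2 (x : Ext S.shortComplex.X₃ F 1) :
        x = (Ext.mk₀ i.inv).comp ((Ext.mk₀ i.hom).comp x (zero_add 1)) (zero_add 1) := by
      rw [← Ext.comp_assoc_of_second_deg_zero, Ext.mk₀_comp_mk₀, i.inv_hom_id, Ext.mk₀_id_comp]
    rw [h2 x, h2 y, hF.elim ((Ext.mk₀ i.hom).comp x (zero_add 1))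
      ((Ext.mk₀ i.hom).comp y (zero_add 1))]
  obtain ⟨ψ, hψ⟩ := Ext.contravariant_sequence_exact₁ S.shortComplex_shortExact F (Ext.mk₀ φ) (n₁ := 1) rfl
    (Subsingleton.elim _ _)
  obtain ⟨ψ, rfl⟩ := (Ext.mk₀_bijective _ _).2 ψ
  rw [Ext.mk₀_comp_mk₀] at hψ
  have h2 : φ = S.shortComplex.f ≫ ψ := ((Ext.mk₀_bijective _ _).1 hψ).symm
  refine ⟨freeSection (biprod.inl ≫ ψ), freeSection (biprod.inr ≫ ψ), ?_⟩
  rw [← freeSection_comp, ← freeSection_comp, sub_eq_add_neg, ← freeSection_neg,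
    ← freeSection_add, h2]
  exact congrArg freeSection (biprod_lift_neg_comp _ _ ψ)

/-- On a scheme with `H¹(X, 𝒪) = 0`, functions on `U ∩ V` are differences of functions on `U` and
on `V`, if `U` and `V` cover `X`. -/
theorem exists_resO_sub_resO {k : Type u} [Field k] {X : Scheme.{u}} (f : X ⟶ Spec (.of k))
    (hf : genus f = 0) {U V : X.Opens} (hUV : U ⊔ V = ⊤) (c : Γ(X, U ⊓ V)) :
    ∃ (a : Γ(X, U)) (b : Γ(X, V)), c = resO inf_le_left a - resO inf_le_right b :=
  have : Subsingleton (Cohomology f (structureModule X) 1) := rank_zero_iff.1 hf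
  exists_sub_of_subsingleton_H hUV (F := abSheaf (structureModule X)) this c

end MayerVietoris

/-! ### An affineness criterion from Zariski's main theorem. -/

section AffineCriterion

/-- A closed subset of a Noetherian sober space is finite if its points are closed. -/
lemma finite_of_isClosed_singletons {T : Type*} [TopologicalSpace T] [NoetherianSpace T] [QuasiSober T]
    {Z : Set T} (hZ : IsClosed Z) (h : ∀ z ∈ Z, IsClosed {z}) : Z.Finite := by
  obtain ⟨S, hSf, hSc, hS, rfl⟩ := NoetherianSpace.exists_finite_set_isClosed_irreducible hZ
  refine hSf.sUnion fun A hA => ?_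
  obtain ⟨z, hz⟩ := QuasiSober.sober (hS A hA) (hSc A hA)
  rw [← hz.def, (h z ⟨A, hA, hz.mem⟩).closure_eq]
  exact Set.finite_singleton z

/-- The complement is cut out by an ideal, hence by a single element, so the open set is basic. -/
lemma isAffineOpen_of_isPrincipalIdealRing {R : CommRingCat.{u}} [IsPrincipalIdealRing R]
    (U : (Spec R).Opens) : IsAffineOpen U := by
  obtain ⟨I, hI⟩ := (PrimeSpectrum.isOpen_iff (U : Set (Spec R))).1 U.2
  obtain ⟨r, hr⟩ := IsPrincipalIdealRing.principal (Ideal.span I)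
  have hU : U = PrimeSpectrum.basicOpen r := by
    refine TopologicalSpace.Opens.ext ?_
    refine compl_injective (hI.trans ?_)
    rw [← PrimeSpectrum.zeroLocus_span, hr, Ideal.submodule_span_eq, PrimeSpectrum.zeroLocus_span]
    change _ = (PrimeSpectrum.basicOpen r : Set (PrimeSpectrum R))ᶜ
    rw [PrimeSpectrum.basicOpen_eq_zeroLocus_compl, compl_compl]
  rw [hU]
  exact IsAffineOpen.Spec_basicOpen r

/-- A curve is affine if its ring of functions is a principal ideal domain with a nonzero element
vanishing at any given closed point. -/
theorem isAffine_of_isPrincipalIdealRing {k : Type u} [Field k] {Y : Scheme.{u}} [IsIntegral Y]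
    [IsNoetherian Y] (g : Y ⟶ Spec (.of k)) [LocallyOfFiniteType g] [IsSeparated g]
    [IsPrincipalIdealRing Γ(Y, ⊤)]
    (h : ∀ y : Y, y ≠ genericPoint Y → IsClosed {y} ∧
      ∃ r : Γ(Y, ⊤), r ≠ 0 ∧ y ∉ Y.basicOpen r) : IsAffine Y := by
  have hgen (r : Γ(Y, ⊤)) (hr : r ≠ 0) : genericPoint Y ∈ Y.basicOpen r := by
    rw [Scheme.mem_basicOpen_top, isUnit_iff_ne_zero]
    exact (map_ne_zero_iff _ (germ_injective_of_isIntegral Y (genericPoint Y)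
      (U := ⊤) trivial)).2 hr
  let φ := Y.toSpecΓ
  have h0 : g ≫ (Spec (.of k)).toSpecΓ = φ ≫ Spec.map g.appTop := Scheme.toSpecΓ_naturality g
  have h1 : LocallyOfFiniteType φ := by
    have : LocallyOfFiniteType (φ ≫ Spec.map g.appTop) := h0 ▸ inferInstance
    exact locallyOfFiniteType_of_comp φ (Spec.map g.appTop)
  have h2 : IsSeparated φ := by
    have : IsSeparated (φ ≫ Spec.map g.appTop) := h0 ▸ inferInstance
    exact IsSeparated.of_comp φ (Spec.map g.appTop)
  -- A fibre through a non-generic point `y` lies in the zero locus of a nonzero function vanishing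
  -- at `y`, a closed set consisting of closed points and therefore finite. Any other fibre contains
  -- at most the generic point.
  have h3 : LocallyQuasiFinite φ := by
    refine .of_finite_preimage_singleton φ fun x => ?_
    by_cases hx : ∃ y : Y, φ y = x ∧ y ≠ genericPoint Y
    · obtain ⟨y, rfl, hy⟩ := hx
      obtain ⟨-, r, hr, hyr⟩ := h y hy
      refine (finite_of_isClosed_singletons (Z := (Y.basicOpen r : Set Y)ᶜ)
        (Y.basicOpen r).2.isClosed_compl fun z hz => (h z ?_).1).subset ?_
      · rintro rfl
        exact hz (hgen r hr)
      · intro z hz hzr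
        rw [← Scheme.toSpecΓ_preimage_basicOpen] at hzr hyr
        have hz' : φ z = φ y := hz
        refine hyr ?_
        change φ y ∈ PrimeSpectrum.basicOpen r
        rw [← hz']
        exact hzr
    · push Not at hx
      exact (Set.finite_singleton (genericPoint Y)).subset fun z hz => hx z hz
  have h4 : IsAffine φ.normalization := isAffine_of_isAffineHom φ.fromNormalization
  -- Zariski's main theorem: `φ` is separated and quasi-finite, so `Y` embeds into its normalization
  -- in the affine target, which is affine. Then `Y` is quasi-affine, `φ` is an open immersion, and
  -- its image is affine because the target is the spectrum of a principal ideal ring.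
  have h5 : Y.IsQuasiAffine := .of_isImmersion φ.toNormalization
  have h6 := isAffineOpen_of_isPrincipalIdealRing φ.opensRange
  have : IsAffine φ.opensRange := h6
  exact .of_isIso (φ.isoOpensRange.hom)

end AffineCriterion

/-! ### Functions with poles at one point, as polynomials in one function. -/

section PoleOrder

open Polynomial IsLocalRing

variable {k F O S : Type*} [Field k] [Field F] [CommRing O] [IsDomain O] [IsDiscreteValuationRing O]
  [Algebra O F] [IsFractionRing O F] [CommRing S] {ι : S →+* F} {kS : k →+* S} {kO : k →+* O}
  {π u : O} {τ : S}

/-- A polynomial of degree at most `n` in a function `τ` with a simple pole has a pole of order at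
most `n`, and its leading term there is the coefficient of degree `n`. -/
lemma exists_leading (hk : ∀ c, ι (kS c) = algebraMap O F (kO c)) (hπ : π ∈ maximalIdeal O)
    (hu : u - 1 ∈ maximalIdeal O) (hτ : algebraMap O F π * ι τ = algebraMap O F u) (P : k[X]) {n : ℕ}
    (hn : P.natDegree ≤ n) :
    ∃ e : O, algebraMap O F π ^ n * ι (eval₂ kS τ P) = algebraMap O F e ∧
      e - kO (P.coeff n) ∈ maximalIdeal O := by
  -- Replace `π * τ` by `u` in each term of `π ^ n * P(τ)`. Modulo the maximal ideal only the term
  -- `i = n` survives, and `u` becomes `1`.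
  refine ⟨∑ i ∈ Finset.range (n + 1), kO (P.coeff i) * u ^ i * π ^ (n - i), ?_, ?_⟩
  · rw [eval₂_eq_sum_range' kS (Nat.lt_succ_of_le hn), map_sum, map_sum, Finset.mul_sum]
    refine Finset.sum_congr rfl fun i hi => ?_
    obtain ⟨j, rfl⟩ := Nat.exists_eq_add_of_le (Nat.lt_succ_iff.1 (Finset.mem_range.1 hi))
    simp only [map_mul, map_pow, ← hτ, hk, Nat.add_sub_cancel_left]
    ring
  · rw [← residue_eq_zero_iff] at hπ hu ⊢
    rw [map_sub, map_one, sub_eq_zero] at hu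
    rw [map_sub, map_sum, Finset.sum_range_succ, Finset.sum_eq_zero]
    · simp [hu]
    · intro i hi
      have : n - i ≠ 0 := by have := Finset.mem_range.1 hi; omega
      simp [hπ, this]

/-- For nonzero `P` of degree `n`, the residue of `π ^ n * P(τ)` is the leading coefficient, so
`P(τ)` cannot vanish. -/
lemma eval₂_injective_of_pole (hk : ∀ c, ι (kS c) = algebraMap O F (kO c)) (hπ : π ∈ maximalIdeal O)
    (hu : u - 1 ∈ maximalIdeal O) (hτ : algebraMap O F π * ι τ = algebraMap O F u) :
    Function.Injective (eval₂RingHom kS τ) := by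
  rw [injective_iff_map_eq_zero]
  intro P hP
  by_contra hP0
  obtain ⟨e, he, hem⟩ := exists_leading hk hπ hu hτ P le_rfl
  rw [coe_eval₂RingHom] at hP
  rw [hP, map_zero, mul_zero, eq_comm, map_eq_zero_iff _ (IsFractionRing.injective O F)] at he
  rw [he, zero_sub, neg_mem_iff] at hem
  exact hem ((IsUnit.mk0 _ (leadingCoeff_ne_zero.2 hP0)).map kO)

/-- The ring of functions with a pole only at one rational point is generated by a function with a
simple pole. -/
theorem eval₂_bijective_of_pole (hι : Function.Injective ι)
    (hk : ∀ c, ι (kS c) = algebraMap O F (kO c)) (hπ : maximalIdeal O = Ideal.span {π})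
    (hu : u - 1 ∈ maximalIdeal O) (hτ : algebraMap O F π * ι τ = algebraMap O F u)
    (hres : ∀ x : O, ∃ c, x - kO c ∈ maximalIdeal O)
    (hglob : ∀ b e, ι b = algebraMap O F e → ∃ c, b = kS c) :
    Function.Bijective (eval₂RingHom kS τ) := by
  have hπm : π ∈ maximalIdeal O := hπ ▸ Ideal.mem_span_singleton_self π
  have hπ0 : algebraMap O F π ≠ 0 := by
    rw [Ne, map_eq_zero_iff _ (IsFractionRing.injective O F)]
    rintro rfl
    exact IsDiscreteValuationRing.not_a_field O (by simpa using hπ)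
  -- Induction on a bound for the pole order: since all residues come from `k`, a multiple of `τ ^
  -- (n + 1)` cancels the leading term. Functions without a pole are constant by `hglob`.
  have key : ∀ (n : ℕ) (b : S) (e : O), algebraMap O F π ^ n * ι b = algebraMap O F e →
      ∃ P, eval₂ kS τ P = b := by
    intro n
    induction n with
    | zero =>
      intro b e h
      obtain ⟨c, rfl⟩ := hglob b e (by simpa using h)
      exact ⟨C c, eval₂_C _ _⟩
    | succ n ih =>
      intro b e h
      obtain ⟨c, hc⟩ := hres e
      obtain ⟨e', he', hem'⟩ := exists_leading hk hπm hu hτ (C c * X ^ (n + 1))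
        (natDegree_C_mul_X_pow_le _ _)
      rw [coeff_C_mul_X_pow, if_pos rfl] at hem'
      have h1 : e - e' ∈ maximalIdeal O := by
        have := sub_mem hc hem'
        rwa [sub_sub_sub_cancel_right] at this
      rw [hπ, Ideal.mem_span_singleton] at h1
      obtain ⟨e'', he''⟩ := h1
      obtain ⟨P, hP⟩ := ih (b - eval₂ kS τ (C c * X ^ (n + 1))) e'' (by
        refine mul_left_cancel₀ hπ0 ?_
        rw [← map_mul, ← he'', map_sub, map_sub, ← h, ← he']
        ring)
      exact ⟨P + C c * X ^ (n + 1), by rw [eval₂_add, hP, sub_add_cancel]⟩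
  refine ⟨eval₂_injective_of_pole hk hπm hu hτ, fun b => ?_⟩
  obtain ⟨x, y, hy, hxy⟩ := IsFractionRing.div_surjective (A := O) (ι b)
  obtain ⟨v, n, hv, rfl⟩ := exists_eq_unit_mul_pow hπ (nonZeroDivisors.ne_zero hy)
  obtain ⟨w, hw⟩ := hv.exists_left_inv
  refine key n b (w * x) ?_
  have hv0 : algebraMap O F v ≠ 0 := (hv.map (algebraMap O F)).ne_zero
  have hw' : algebraMap O F w * algebraMap O F v = 1 := by rw [← map_mul, hw, map_one]
  rw [← hxy, map_mul, map_pow, map_mul]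
  field_simp
  linear_combination (-algebraMap O F x) * hw'

/-- Functions regular at the pole of `τ` and regular elsewhere except possibly at the zeros of `τ`
are polynomials in `1 / τ`. -/
theorem eval₂_bijective_of_zero {S' : Type*} [CommRing S'] {ι' : S' →+* F} {kS' : k →+* S'} {σ : S'}
    (hι : Function.Injective ι) (hι' : Function.Injective ι') (hk : ∀ c, ι (kS c) = algebraMap O F (kO c))
    (hk' : ∀ c, ι' (kS' c) = algebraMap O F (kO c)) (hπ : π ∈ maximalIdeal O)
    (hu : u - 1 ∈ maximalIdeal O) (hτ : algebraMap O F π * ι τ = algebraMap O F u)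
    (hσ : ι' σ * ι τ = 1) (hreg : ∀ b, ∃ e, ι' b = algebraMap O F e)
    (hfrac : ∀ b, ∃ (N : ℕ) (P : k[X]), ι τ ^ N * ι' b = ι (eval₂ kS τ P)) :
    Function.Bijective (eval₂RingHom kS' σ) := by
  have hτ0 : ι τ ≠ 0 := right_ne_zero_of_mul_eq_one hσ
  have hrev : ∀ (P : k[X]) (n : ℕ), P.natDegree ≤ n →
      ι' (eval₂ kS' σ (reflect n P)) * ι τ ^ n = ι (eval₂ kS τ P) := by
    intro P n hn
    have : Invertible (ι τ) := invertibleOfNonzero hτ0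
    have h1 := eval₂_reflect_mul_pow (ι.comp kS) (ι τ) n P hn
    rw [hom_eval₂, hom_eval₂, ← h1]
    congr 2
    · ext c; simp [hk, hk']
    · exact (invOf_eq_left_inv hσ).symm
  constructor
  · rw [injective_iff_map_eq_zero]
    intro P hP
    rw [coe_eval₂RingHom] at hP
    have h1 := hrev (reflect P.natDegree P) P.natDegree (natDegree_reflect_le.trans (by simp))
    rw [reflect_reflect, hP, map_zero, zero_mul, eq_comm] at h1
    rw [map_eq_zero_iff _ hι, ← coe_eval₂RingHom,
      map_eq_zero_iff _ (eval₂_injective_of_pole hk hπ hu hτ)] at h1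
    simpa using congrArg (reflect P.natDegree) h1
  · intro b
    obtain ⟨N, P, hP⟩ := hfrac b
    -- `τ ^ N * b` has a pole of order at most `N`, as `b` is regular there, while `P(τ)` has one of
    -- order exactly `deg P`.
    have hPN : P.natDegree ≤ N := by
      by_contra! hlt
      obtain ⟨e, he, hem⟩ := exists_leading hk hπ hu hτ P le_rfl
      obtain ⟨x, hx⟩ := hreg b
      obtain ⟨j, hj⟩ := Nat.exists_eq_add_of_lt hlt
      have h1 : e = π * (π ^ j * u ^ N * x) := by
        refine IsFractionRing.injective O F ?_
        rw [← he, ← hP, hj]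
        simp only [map_mul, map_pow, ← hx, ← hτ]
        ring
      have h2 : e ∈ maximalIdeal O := h1 ▸ Ideal.mul_mem_right _ _ hπ
      have h3 : kO (P.coeff P.natDegree) ∈ maximalIdeal O := by
        have := sub_mem h2 hem
        rwa [sub_sub_cancel] at this
      have hP0 : P ≠ 0 := by rintro rfl; simp at hlt
      exact h3 ((IsUnit.mk0 _ (leadingCoeff_ne_zero.2 hP0)).map kO)
    refine ⟨reflect N P, hι' (mul_right_cancel₀ (pow_ne_zero N hτ0) ?_)⟩
    rw [coe_eval₂RingHom, hrev P N hPN, ← hP, mul_comm]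

end PoleOrder

/-! ### Closed points, rational points and uniformizers. -/

section Points

open Polynomial IsLocalRing

variable {k : Type u} [Field k] {X : Scheme.{u}} (f : X ⟶ Spec (.of k))

lemma eq_genericPoint_of_isField [IsIntegral X] {x : X} (h : IsField (X.presheaf.stalk x)) :
    x = genericPoint X := by
  have h1 : Order.coheight x = 0 := by
    have := ringKrullDim_stalk_eq_coheight x
    rw [ringKrullDim_eq_zero_of_isField h] at this
    exact_mod_cast this.symm
  have h2 : (⊤ : X) ≤ x := Order.coheight_eq_zero.1 h1 (le_top : x ≤ ⊤)
  have h3 : x ⤳ genericPoint X := h2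
  exact h3.antisymm (genericPoint_specializes x) |>.eq

lemma isField_stalk_genericPoint [IsIntegral X] : IsField (X.presheaf.stalk (genericPoint X)) :=
  Field.toIsField X.functionField

lemma isDiscreteValuationRing_stalk [IsIntegral X] [SmoothOfRelativeDimension 1 f] {x : X}
    (hx : x ≠ genericPoint X) : IsDiscreteValuationRing (X.presheaf.stalk x) := by
  rcases stalk_smoothCurve f x with ⟨h, -⟩ | ⟨⟨h, h'⟩, -⟩
  · exact (hx (eq_genericPoint_of_isField h)).elim
  · exact h'

lemma coheight_eq_one [IsIntegral X] [SmoothOfRelativeDimension 1 f] {x : X}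
    (hx : x ≠ genericPoint X) : Order.coheight x = 1 := by
  have := isDiscreteValuationRing_stalk f hx
  have h := ringKrullDim_stalk_eq_coheight x
  rw [IsDiscreteValuationRing.ringKrullDim_eq_one] at h
  exact_mod_cast h.symm

/-- A proper specialization of `x` would have coheight at least two, whereas non-generic points have
coheight one. -/
lemma isClosed_singleton_of_ne_genericPoint [IsIntegral X] [SmoothOfRelativeDimension 1 f] {x : X}
    (hx : x ≠ genericPoint X) : IsClosed {x} := by
  refine closure_subset_iff_isClosed.1 fun z hz => ?_
  by_contra hzx
  have hxz : x ⤳ z := specializes_iff_mem_closure.2 hz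
  have h1 : z < x := ⟨hxz, fun h => hzx (h.antisymm hxz).eq⟩
  have h2 : x < ⊤ := lt_of_le_not_ge le_top fun h =>
    hx (Specializes.antisymm h (genericPoint_specializes x)).eq
  have h3 : z ≠ genericPoint X := by
    rintro rfl
    exact hx (hxz.antisymm (genericPoint_specializes x)).eq
  have h4 := Order.coheight_add_one_le h1
  rw [coheight_eq_one f hx, coheight_eq_one f h3] at h4
  exact absurd h4 (by decide)

lemma exists_evalSection_notMem_basicOpen [IsIntegral X] [SmoothOfRelativeDimension 1 f] {x : X}
    (hx : x ≠ genericPoint X) {U : X.Opens} (hxU : x ∈ U) (a : Γ(X, U)) :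
    ∃ P : k[X], P ≠ 0 ∧ x ∉ X.basicOpen (evalSection f a P) := by
  rcases stalk_smoothCurve f x with ⟨h, -⟩ | ⟨-, h⟩
  · exact (hx (eq_genericPoint_of_isField h)).elim
  · exact h U hxU a

/-- A point at which every function takes a value in `k`. -/
def IsRationalPoint (p : X) : Prop :=
  ∀ (U : X.Opens), p ∈ U → ∀ a : Γ(X, U), ∃ c : k, p ∉ X.basicOpen (a - scalars f U c)

lemma exists_isRationalPoint (h : ∃ s : Spec (.of k) ⟶ X, s ≫ f = 𝟙 _) :
    ∃ p : X, IsRationalPoint f p := by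
  obtain ⟨s, hs⟩ := h
  have hsub : Subsingleton (Spec (.of k)) := inferInstanceAs (Subsingleton (PrimeSpectrum k))
  let o : Spec (.of k) := (⊥ : PrimeSpectrum k)
  refine ⟨s o, fun U hU a => ?_⟩
  have hUT : (⊤ : (Spec (.of k)).Opens) ≤ s ⁻¹ᵁ U := fun y _ => hsub.elim o y ▸ hU
  -- Pullback along the section is a retraction of `scalars`. The value of `a` is `ev a`: the
  -- difference pulls back to zero, so it is not invertible at the image point.
  let ev : Γ(X, U) →+* k := ((s.appLE U ⊤ hUT) ≫ (Scheme.ΓSpecIso (.of k)).hom).hom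
  have hev : ∀ c, ev (scalars f U c) = c := by
    intro c
    have h1 : (Scheme.ΓSpecIso (.of k)).inv ≫ (f.appTop ≫
        X.presheaf.map (homOfLE (le_top : U ≤ ⊤)).op) ≫ s.appLE U ⊤ hUT ≫
        (Scheme.ΓSpecIso (.of k)).hom = 𝟙 _ := by
      have h2 : f.appTop ≫ X.presheaf.map (homOfLE (le_top : U ≤ ⊤)).op ≫ s.appLE U ⊤ hUT =
          𝟙 _ := by
        rw [Scheme.Hom.map_appLE]
        have h3 := congr(($hs).appTop)
        rw [Scheme.Hom.comp_appTop] at h3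
        have h4 : s.appLE ⊤ ⊤ le_top = s.appTop := Scheme.Hom.appLE_eq_app s
        exact (congrArg (f.appTop ≫ ·) h4).trans h3
      rw [Category.assoc, reassoc_of% h2, Iso.inv_hom_id]
    exact congr($(h1) c)
  refine ⟨ev a, fun hmem => ?_⟩
  let b := a - scalars f U (ev a)
  have hb : ev b = 0 := by rw [map_sub, hev, sub_self]
  have hVT : (⊤ : (Spec (.of k)).Opens) ≤ s ⁻¹ᵁ X.basicOpen b :=
    fun y _ => hsub.elim o y ▸ hmem
  have h1 : IsUnit (s.appLE U ⊤ hUT b) := by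
    have h2 := (isUnit_resO_basicOpen b (X.basicOpen_le b) le_rfl).map
      (s.appLE (X.basicOpen b) ⊤ hVT).hom
    have h3 : X.presheaf.map (homOfLE (X.basicOpen_le b)).op ≫ s.appLE (X.basicOpen b) ⊤ hVT =
        s.appLE U ⊤ hUT := Scheme.Hom.map_appLE _ _ _
    rw [← h3]
    exact h2
  have h2 : IsUnit (ev b) := h1.map (Scheme.ΓSpecIso (.of k)).hom.hom
  rw [hb] at h2
  exact not_isUnit_zero h2

/-- At the generic point some function is transcendental, so subtracting a constant never makes it
non-invertible there. -/
lemma IsRationalPoint.ne_genericPoint {f : X ⟶ Spec (.of k)} [IsIntegral X]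
    [SmoothOfRelativeDimension 1 f] {p : X} (hp : IsRationalPoint f p) : p ≠ genericPoint X := by
  rintro rfl
  rcases stalk_smoothCurve f (genericPoint X) with ⟨-, U, hU, a, ha⟩ | ⟨⟨_, h⟩, -⟩
  · obtain ⟨c, hc⟩ := hp U hU a
    refine hc ?_
    have h1 := ha (Polynomial.X - C c) (X_sub_C_ne_zero c)
    simpa [evalSection] using h1
  · exact IsDiscreteValuationRing.not_isField _ (isField_stalk_genericPoint (X := X))

/-- Global functions on a universally closed integral scheme over a field form a field, and the
difference between `a` and its value at `p` is not a unit. -/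
lemma IsRationalPoint.exists_eq_scalars {f : X ⟶ Spec (.of k)} [IsIntegral X]
    [UniversallyClosed f] {p : X} (hp : IsRationalPoint f p) (a : Γ(X, ⊤)) :
    ∃ c, a = scalars f ⊤ c := by
  obtain ⟨c, hc⟩ := hp ⊤ trivial a
  refine ⟨c, ?_⟩
  by_contra h
  have h1 : IsField Γ(X, ⊤) := isField_of_universallyClosed k f
  let := h1.toField
  refine hc ((Scheme.mem_basicOpen_top _ _ _).2 ?_)
  exact (IsUnit.mk0 _ (sub_ne_zero.2 h)).map _

/-- Near a closed point of a smooth curve there is a function vanishing to first order there and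
nowhere else. -/
lemma exists_uniformizer [IsIntegral X] [CompactSpace X] [SmoothOfRelativeDimension 1 f] {p : X}
    (hp : p ≠ genericPoint X) :
    ∃ (V : X.Opens) (hV : p ∈ V) (z : Γ(X, V)), (∀ x ∈ V, x ∈ X.basicOpen z ↔ x ≠ p) ∧
      maximalIdeal (X.presheaf.stalk p) = Ideal.span {X.presheaf.germ V p hV z} := by
  have := SmoothOfRelativeDimension.smooth 1 f
  have : IsLocallyNoetherian X := LocallyOfFiniteType.isLocallyNoetherian f
  have : IsNoetherian X := {}
  have := isDiscreteValuationRing_stalk f hp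
  obtain ⟨V, hV, hpV, -⟩ := exists_etale_chart f p
  obtain ⟨q, hq, φ, hφ⟩ := exists_localRingEquiv hV hpV
  obtain ⟨π, hπ⟩ := IsDiscreteValuationRing.exists_irreducible (X.presheaf.stalk p)
  obtain ⟨⟨z, b⟩, hzb⟩ := IsLocalization.surj q.primeCompl (φ π)
  have hassoc : Associated π (X.presheaf.germ V p hpV z) := by
    have hb : IsUnit (X.presheaf.germ V p hpV b.1) := by
      rw [← MulEquiv.isUnit_map φ, hφ]
      exact IsLocalization.map_units _ b
    refine ⟨hb.unit, φ.injective ?_⟩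
    rw [map_mul, IsUnit.unit_spec, hφ, hφ]
    exact hzb
  have hspan : maximalIdeal (X.presheaf.stalk p) = Ideal.span {X.presheaf.germ V p hpV z} := by
    rw [hπ.maximalIdeal_eq, Ideal.span_singleton_eq_span_singleton]
    exact hassoc
  have hz0 : z ≠ 0 := by
    rintro rfl
    rw [map_zero] at hassoc
    exact hπ.ne_zero (associated_zero_iff_eq_zero _ |>.1 hassoc)
  have hcl : ∀ x ∈ (X.basicOpen z : Set X)ᶜ, IsClosed {x} := by
    intro x hx
    refine isClosed_singleton_of_ne_genericPoint f ?_
    rintro rfl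
    exact hx (((genericPoint_spec X).mem_open_set_iff (X.basicOpen z).2).2
      (by simpa using basicOpen_nonempty hz0))
  have hfin : ((X.basicOpen z : Set X)ᶜ).Finite := by
    refine finite_of_isClosed_singletons (X.basicOpen z).2.isClosed_compl hcl
  have hclosed : IsClosed ((X.basicOpen z : Set X)ᶜ \ {p}) := by
    rw [← Set.biUnion_of_singleton ((X.basicOpen z : Set X)ᶜ \ {p})]
    exact (hfin.subset Set.sdiff_subset).isClosed_biUnion fun x hx => hcl x hx.1
  -- Shrink by removing the other points of the complement of `D(z)`, of which there are finitely
  -- many, all closed.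
  let V' : X.Opens := V ⊓ ⟨((X.basicOpen z : Set X)ᶜ \ {p})ᶜ, hclosed.isOpen_compl⟩
  have hpV' : p ∈ V' := ⟨hpV, fun h => h.2 rfl⟩
  refine ⟨V', hpV', resO inf_le_left z, fun x hx => ?_, ?_⟩
  · have h1 : X.basicOpen (resO inf_le_left z : Γ(X, V')) = V' ⊓ X.basicOpen z :=
      X.basicOpen_res z (homOfLE inf_le_left).op
    have hpz : p ∉ X.basicOpen z := by
      rw [Scheme.mem_basicOpen _ _ _ hpV, ← hassoc.isUnit_iff]
      exact hπ.not_isUnit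
    rw [h1]
    constructor
    · rintro h rfl
      exact hpz h.2
    · intro hxp
      refine ⟨hx, ?_⟩
      by_contra h
      exact hx.2 ⟨h, hxp⟩
  · rw [germ_resO]
    exact hspan

end Points

/-! ### Two affine lines covering a curve of genus zero. -/

/-- Two affine lines over `K` with coordinates `t` and `s = 1 / t` that cover `X`. -/
structure ProjectiveLineCharts {K : Type u} [Field K] {X : Scheme.{u}} (f : X ⟶ Spec (.of K)) where
  /-- the first affine line -/
  U₀ : X.Opens
  /-- the second affine line -/
  U₁ : X.Opens
  affine₀ : IsAffineOpen U₀
  affine₁ : IsAffineOpen U₁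
  cover : U₀ ⊔ U₁ = ⊤
  /-- the coordinate of the first affine line -/
  t : Γ(X, U₀)
  /-- the coordinate of the second affine line -/
  s : Γ(X, U₁)
  inf_eq_basicOpen_t : U₀ ⊓ U₁ = X.basicOpen t
  inf_eq_basicOpen_s : U₀ ⊓ U₁ = X.basicOpen s
  mul_eq_one : resO (inf_le_left : U₀ ⊓ U₁ ≤ U₀) t * resO inf_le_right s = 1
  bijective₀ : Function.Bijective (evalSection f t)
  bijective₁ : Function.Bijective (evalSection f s)

section Charts

open Polynomial IsLocalRing

variable {k : Type u} [Field k] {X : Scheme.{u}} {f : X ⟶ Spec (.of k)}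

lemma isPrincipalIdealRing_of_bijective {U : X.Opens} {a : Γ(X, U)}
    (ha : Function.Bijective (evalSection f a)) : IsPrincipalIdealRing Γ(X, U) :=
  .of_surjective _ ha.2

lemma genericPoint_mem [IrreducibleSpace X] {U : X.Opens} {x : X} (hx : x ∈ U) :
    genericPoint X ∈ U :=
  (genericPoint_specializes x).mem_open U.2 hx

lemma mem_inf {U V : X.Opens} {x : X} (hU : x ∈ U) (hV : x ∈ V) : x ∈ U ⊓ V := ⟨hU, hV⟩

/-- The affineness criterion applies: the function vanishing at a given closed point is a polynomial
in `a`, which exists because residue fields at closed points are algebraic over `k`. -/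
lemma isAffineOpen_of_bijective [IsIntegral X] [IsProper f] [SmoothOfRelativeDimension 1 f]
    {U : X.Opens} {a : Γ(X, U)} (ha : Function.Bijective (evalSection f a)) : IsAffineOpen U := by
  by_cases hne : (U : Set X).Nonempty
  swap
  · rw [Set.not_nonempty_iff_eq_empty] at hne
    have : U = ⊥ := Opens.ext hne
    rw [this]
    exact isAffineOpen_bot X
  have : Nonempty U := hne.to_subtype
  have : IsLocallyNoetherian X := LocallyOfFiniteType.isLocallyNoetherian f
  have : CompactSpace X := (quasiCompact_iff_compactSpace f).1 inferInstance
  have : IsNoetherian X := {}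
  have : IsLocallyNoetherian U.toScheme := isLocallyNoetherian_of_isOpenImmersion U.ι
  have : CompactSpace U.toScheme :=
    isCompact_iff_compactSpace.1 (NoetherianSpace.isCompact (U : Set X))
  have : IsNoetherian U.toScheme := {}
  have := isPrincipalIdealRing_of_bijective ha
  have : IsPrincipalIdealRing Γ(U.toScheme, ⊤) :=
    .of_surjective U.topIso.inv.hom U.topIso.symm.commRingCatIsoToRingEquiv.surjective
  refine isAffine_of_isPrincipalIdealRing (U.ι ≫ f) fun y hy => ?_
  have hy' : y.1 ≠ genericPoint X := by
    intro h
    refine hy (Subtype.ext (h.trans ?_))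
    exact (genericPoint_eq_of_isOpenImmersion U.ι).symm
  constructor
  · have h1 := (isClosed_singleton_of_ne_genericPoint f hy').preimage
      U.ι.continuous
    have h2 : U.ι ⁻¹' {y.1} = {y} := by
      ext z
      exact Subtype.ext_iff.symm
    rwa [h2] at h1
  · obtain ⟨P, hP, hyP⟩ := exists_evalSection_notMem_basicOpen f hy' y.2 a
    refine ⟨U.topIso.inv (evalSection f a P), ?_, fun h => hyP ?_⟩
    · refine (map_ne_zero_iff U.topIso.inv.hom
        U.topIso.symm.commRingCatIsoToRingEquiv.injective).2 ?_
      exact (map_ne_zero_iff _ ha.1).2 hP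
    · rw [← Scheme.Opens.ι_image_basicOpen_topIso_inv]
      exact ⟨y, h, rfl⟩

lemma eq_of_germ_eq [IsIntegral X] {U : X.Opens} {x : X} (hx : x ∈ U) {a b : Γ(X, U)}
    (h : X.presheaf.germ U x hx a = X.presheaf.germ U x hx b) : a = b :=
  germ_injective_of_isIntegral X x hx h

lemma algebraMap_germ [IrreducibleSpace X] {U : X.Opens} {x : X} (hx : x ∈ U) (a : Γ(X, U)) :
    algebraMap (X.presheaf.stalk x) X.functionField (X.presheaf.germ U x hx a) =
      X.presheaf.germ U (genericPoint X) (genericPoint_mem hx) a :=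
  have : Nonempty U := ⟨⟨x, hx⟩⟩
  Scheme.algebraMap_germ_eq_germToFunctionField X hx a

lemma IsRationalPoint.exists_sub_mem {p : X} (hp : IsRationalPoint f p) {V : X.Opens} (hV : p ∈ V)
    (x : X.presheaf.stalk p) :
    ∃ c, x - X.presheaf.germ V p hV (scalars f V c) ∈ maximalIdeal (X.presheaf.stalk p) := by
  obtain ⟨U, hU, a, rfl⟩ := X.presheaf.exists_germ_eq x
  obtain ⟨c, hc⟩ := hp U hU a
  refine ⟨c, fun h => hc ?_⟩
  rw [Scheme.mem_basicOpen _ _ _ hU, map_sub]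
  rwa [germ_scalars f hV hU] at h

/-- A function that is regular both outside and at `p` is constant. -/
lemma IsRationalPoint.exists_eq_scalars_of_germ_eq [IsIntegral X] [UniversallyClosed f] {p : X}
    (hp : IsRationalPoint f p) {W : X.Opens} (hW : ∀ x, x ∈ W ↔ x ≠ p) (hη : genericPoint X ∈ W)
    {b : Γ(X, W)} {e : X.presheaf.stalk p}
    (h : X.presheaf.germ W (genericPoint X) hη b = algebraMap _ X.functionField e) :
    ∃ c, b = scalars f W c := by
  obtain ⟨V, hV, e, rfl⟩ := X.presheaf.exists_germ_eq e
  rw [algebraMap_germ] at h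
  obtain ⟨a, ha, -⟩ := exists_glueO₂ (le_top : W ≤ ⊤) (le_top : V ≤ ⊤)
    (fun x _ => by
      by_cases hx : x = p
      · exact Or.inr (hx ▸ hV)
      · exact Or.inl ((hW x).2 hx)) inf_le_left inf_le_right le_rfl b e
    (eq_of_germ_eq (x := genericPoint X) (mem_inf hη (genericPoint_mem hV)) (by
      rw [germ_resO, germ_resO]; exact h))
  obtain ⟨c, rfl⟩ := hp.exists_eq_scalars a
  exact ⟨c, by rw [← ha]; exact map_scalars f (homOfLE le_top) c⟩

/-- A smooth proper curve of genus `0` with a rational point is covered by two affine lines. -/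
theorem exists_projectiveLineCharts [IsIntegral X] [IsProper f] [SmoothOfRelativeDimension 1 f]
    {p : X} (hp : IsRationalPoint f p) (hf : genus f = 0) : Nonempty (ProjectiveLineCharts f) := by
  have : CompactSpace X := (quasiCompact_iff_compactSpace f).1 inferInstance
  have hpη := hp.ne_genericPoint
  have := isDiscreteValuationRing_stalk f hpη
  obtain ⟨V, hV, z, hVz, hz⟩ := exists_uniformizer f hpη
  let W : X.Opens := ⟨{p}ᶜ, (isClosed_singleton_of_ne_genericPoint f hpη).isOpen_compl⟩
  have hW : ∀ x, x ∈ W ↔ x ≠ p := fun x => Iff.rfl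
  have hηW : genericPoint X ∈ W := hpη.symm
  have hηV : genericPoint X ∈ V := genericPoint_mem hV
  have hVW : V ⊔ W = ⊤ := top_unique fun x _ => by
    by_cases hx : x = p
    · exact Or.inl (hx ▸ hV)
    · exact Or.inr hx
  have hWz : V ⊓ W ≤ X.basicOpen z := fun x hx => (hVz x hx.1).2 hx.2
  obtain ⟨c, hc⟩ := (isUnit_resO_basicOpen z inf_le_left hWz).exists_left_inv
  obtain ⟨a, b, hab⟩ := exists_resO_sub_resO f hf hVW c
  -- Here `c = 1 / z` and `1 / z = a - b` on the overlap, so `t = 1 / z - a` has the same principal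
  -- part at `p` as `1 / z`, and `u = z * t` takes the value `1` at `p`.
  let t : Γ(X, W) := -b
  let u : Γ(X, V) := 1 - z * a
  have hzt : resO inf_le_left z * resO inf_le_right t = (resO inf_le_left u : Γ(X, V ⊓ W)) := by
    simp only [t, u, map_neg, map_sub, map_one, map_mul]
    linear_combination hc - resO inf_le_left z * hab
  have hztF : X.presheaf.germ V _ hηV z * X.presheaf.germ W _ hηW t =
      X.presheaf.germ V _ hηV u := by
    have := congrArg (X.presheaf.germ (V ⊓ W) _ (mem_inf hηV hηW)) hzt
    rwa [map_mul, germ_resO, germ_resO, germ_resO] at this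
  have hzm : X.presheaf.germ V p hV z ∈ maximalIdeal (X.presheaf.stalk p) :=
    hz ▸ Ideal.mem_span_singleton_self _
  have hu : X.presheaf.germ V p hV u - 1 ∈ maximalIdeal (X.presheaf.stalk p) := by
    simp only [u, map_sub, map_one, map_mul]
    rw [sub_sub_cancel_left, neg_mem_iff]
    exact Ideal.mul_mem_right _ _ hzm
  have hpu : p ∈ X.basicOpen u := by
    rw [Scheme.mem_basicOpen _ _ _ hV]
    by_contra h
    have := sub_mem (show X.presheaf.germ V p hV u ∈ maximalIdeal _ from h) hu
    rw [sub_sub_cancel] at this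
    exact this isUnit_one
  let ι (U : X.Opens) (hU : genericPoint X ∈ U) : Γ(X, U) →+* X.functionField :=
    (X.presheaf.germ U _ hU).hom
  let kO : k →+* X.presheaf.stalk p := (X.presheaf.germ V p hV).hom.comp (scalars f V)
  have hk (U : X.Opens) (hU : genericPoint X ∈ U) (c : k) :
      ι U hU (scalars f U c) = algebraMap _ X.functionField (kO c) := by
    refine Eq.trans ?_ (algebraMap_germ hV _).symm
    exact germ_scalars f hU hηV c
  have hτ : algebraMap _ X.functionField (X.presheaf.germ V p hV z) * ι W hηW t =
      algebraMap _ _ (X.presheaf.germ V p hV u) := by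
    rw [algebraMap_germ, algebraMap_germ]
    exact hztF
  have hbij₀ : Function.Bijective (evalSection f t) :=
    eval₂_bijective_of_pole (F := X.functionField) (germ_injective_of_isIntegral X _ hηW)
      (hk W hηW) hz hu hτ
      (fun x => hp.exists_sub_mem hV x)
      (fun b e h => hp.exists_eq_scalars_of_germ_eq hW hηW h)
  have hWaff : IsAffineOpen W := isAffineOpen_of_bijective hbij₀
  -- `U₁` is the locus where `1 / t` is regular. Near `p`, where `t` has its pole, `1 / t` is `z /
  -- u`, regular where `u` is invertible.
  let U₁ : X.Opens := X.basicOpen t ⊔ X.basicOpen u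
  have hWU : W ⊓ U₁ = X.basicOpen t := by
    refine le_antisymm ?_ (le_inf (X.basicOpen_le t) le_sup_left)
    rintro x ⟨hxW, hx | hx⟩
    · exact hx
    · have hxV := X.basicOpen_le u hx
      have h1 := congrArg (X.presheaf.germ (V ⊓ W) _ (mem_inf hxV hxW)) hzt
      rw [map_mul, germ_resO, germ_resO, germ_resO] at h1
      have h2 := (Scheme.mem_basicOpen _ _ _ hxV).1 hx
      rw [← h1] at h2
      exact (Scheme.mem_basicOpen _ _ _ hxW).2 (isUnit_of_mul_isUnit_right h2)
  obtain ⟨t', ht'⟩ := (isUnit_resO_basicOpen t (X.basicOpen_le t) le_rfl).exists_left_inv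
  obtain ⟨u', hu'⟩ := (isUnit_resO_basicOpen u (X.basicOpen_le u) le_rfl).exists_left_inv
  have hηu : genericPoint X ∈ X.basicOpen u := genericPoint_mem hpu
  have hηt : genericPoint X ∈ X.basicOpen t := by
    rw [← hWU]
    exact ⟨hηW, Or.inr hηu⟩
  have ht'F := congrArg (X.presheaf.germ _ _ hηt) ht'
  have hu'F := congrArg (X.presheaf.germ _ _ hηu) hu'
  rw [map_mul, germ_resO, map_one] at ht'F hu'F
  obtain ⟨s, hst, hsu⟩ := exists_glueO₂ (le_sup_left : X.basicOpen t ≤ U₁) le_sup_right le_rfl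
    inf_le_left inf_le_right le_rfl t' (resO (X.basicOpen_le u) z * u')
    (eq_of_germ_eq (x := genericPoint X) (mem_inf hηt hηu) (by
      rw [germ_resO, germ_resO, map_mul, germ_resO]
      linear_combination (-X.presheaf.germ _ _ hηt t') * hu'F +
        (X.presheaf.germ _ _ hηt t') * X.presheaf.germ _ _ hηu u' * (-hztF) +
          X.presheaf.germ _ _ hηu u' * X.presheaf.germ _ _ hηV z * ht'F))
  have hηU₁ : genericPoint X ∈ U₁ := Or.inl hηt
  have hσ : ι U₁ hηU₁ s * ι W hηW t = 1 := by
    have h1 : X.presheaf.germ U₁ _ hηU₁ s = X.presheaf.germ _ _ hηt t' := by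
      rw [← hst, germ_resO]
    exact (congrArg (· * _) h1).trans ht'F
  have hsu' : resO le_sup_right s * resO (X.basicOpen_le u) u = resO (X.basicOpen_le u) z := by
    rw [hsu]
    linear_combination resO (X.basicOpen_le u) z * hu'
  have hpU₁ : p ∈ U₁ := Or.inr hpu
  have hmul : resO (inf_le_left : W ⊓ U₁ ≤ W) t * resO inf_le_right s = 1 :=
    eq_of_germ_eq (x := genericPoint X) (mem_inf hηW hηU₁) (by
      rw [map_mul, germ_resO, germ_resO, map_one, mul_comm]
      exact hσ)
  have hbij₁ : Function.Bijective (evalSection f s) := by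
    refine eval₂_bijective_of_zero (F := X.functionField) (germ_injective_of_isIntegral X _ hηW)
      (germ_injective_of_isIntegral X _ hηU₁) (hk W hηW) (hk U₁ hηU₁) hzm hu hτ hσ
      (fun b => ⟨X.presheaf.germ U₁ p hpU₁ b, (algebraMap_germ hpU₁ b).symm⟩) fun b => ?_
    have := hWaff.isLocalization_basicOpen t
    -- A function on `U₁` restricts to `D(t)`, where it is a polynomial in `t` divided by a power of
    -- `t`.
    obtain ⟨N, a, ha⟩ := IsLocalization.Away.surj t (resO le_sup_left b : Γ(X, X.basicOpen t))
    obtain ⟨P, hP⟩ := hbij₀.2 a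
    refine ⟨N, P, ?_⟩
    have h1 : resO le_sup_left b * resO (X.basicOpen_le t) t ^ N = resO (X.basicOpen_le t) a :=
      ha
    have h2 := congrArg (X.presheaf.germ _ _ hηt) h1
    rw [map_mul, map_pow, germ_resO, germ_resO, germ_resO, ← hP, mul_comm] at h2
    exact h2
  exact ⟨{
    U₀ := W
    U₁ := U₁
    affine₀ := hWaff
    affine₁ := isAffineOpen_of_bijective hbij₁
    cover := top_unique fun x _ => by
      by_cases hx : x = p
      · exact Or.inr (hx ▸ hpU₁)
      · exact Or.inl hx
    t := t
    s := s
    inf_eq_basicOpen_t := hWU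
    inf_eq_basicOpen_s := by
      refine le_antisymm (fun x hx => ?_) (le_inf (fun x hx => ?_) (X.basicOpen_le s))
      · have h1 := congrArg (X.presheaf.germ (W ⊓ U₁) _ hx) hmul
        rw [map_mul, germ_resO, germ_resO, map_one] at h1
        exact (Scheme.mem_basicOpen _ _ _ hx.2).2 (.of_mul_eq_one_right _ h1)
      · rintro rfl
        have h1 := congrArg (X.presheaf.germ _ _ hpu) hsu'
        rw [map_mul, germ_resO, germ_resO, germ_resO] at h1
        refine hzm ?_
        rw [← h1]
        exact ((Scheme.mem_basicOpen _ _ _ hpU₁).1 hx).mul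
          ((Scheme.mem_basicOpen _ _ _ hV).1 hpu)
    mul_eq_one := hmul
    bijective₀ := hbij₀
    bijective₁ := hbij₁ }⟩

end Charts

/-! ### Projective schemes are proper. -/

section Proper

attribute [local instance] MvPolynomial.gradedAlgebra

variable {k : Type u} [Field k]

/-- Homogeneous polynomials of degree zero are constants. So the second factor of `ProjSpace.toSpec`
is an isomorphism, and properness of `Proj` over its degree-zero part is properness over `k`. -/
lemma bijective_algebraMap_homogeneousSubmodule_zero (N : ℕ) : Function.Bijective
    (algebraMap k (MvPolynomial.homogeneousSubmodule (Fin (N + 1)) k 0)) := by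
  refine ⟨fun a b h => MvPolynomial.C_injective (Fin (N + 1)) k (congrArg Subtype.val h),
    fun p => ?_⟩
  obtain ⟨p, hp⟩ := p
  refine ⟨MvPolynomial.coeff 0 p, Subtype.ext ?_⟩
  have h0 : p.totalDegree = 0 := by
    have := (MvPolynomial.mem_homogeneousSubmodule 0 p).1 hp
    exact Nat.le_zero.1 this.totalDegree_le
  exact (MvPolynomial.totalDegree_eq_zero_iff_eq_C.1 h0).symm

instance isProper_projSpace (N : ℕ) : IsProper (ProjSpace.toSpec k N) := by
  have : Algebra.FiniteType (MvPolynomial.homogeneousSubmodule (Fin (N + 1)) k 0)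
      (MvPolynomial (Fin (N + 1)) k) :=
    have : IsScalarTower k (MvPolynomial.homogeneousSubmodule (Fin (N + 1)) k 0)
      (MvPolynomial (Fin (N + 1)) k) := ⟨fun a b c => smul_mul_assoc a b.1 c⟩
    Algebra.FiniteType.of_restrictScalars_finiteType k _ _
  have : IsIso (CommRingCat.ofHom
      (algebraMap k (MvPolynomial.homogeneousSubmodule (Fin (N + 1)) k 0))) :=
    (ConcreteCategory.isIso_iff_bijective _).2 (bijective_algebraMap_homogeneousSubmodule_zero N)
  unfold ProjSpace.toSpec
  infer_instance

lemma IsProjective.isProper {X : Scheme.{u}} {f : X ⟶ Spec (.of k)} (hf : IsProjective f) :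
    IsProper f := by
  obtain ⟨N, i, hi, rfl⟩ := hf
  infer_instance

end Proper

/-! ### Base change of the charts. -/

section BaseChange

open Polynomial

variable {k K : Type u} [Field k] [Field K] {φ : k →+* K} {X X' : Scheme.{u}}
  {f : X ⟶ Spec (.of k)} {g : X' ⟶ Spec (.of K)} {π : X' ⟶ X}

lemma le_preimage_top {Y : Scheme.{u}} (f : X ⟶ Y) (U : X.Opens) : U ≤ f ⁻¹ᵁ ⊤ :=
  fun _ _ => trivial

lemma ofHom_scalars (f : X ⟶ Spec (.of k)) (U : X.Opens) : CommRingCat.ofHom (scalars f U) =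
    (Scheme.ΓSpecIso (.of k)).inv ≫ f.appLE ⊤ U (le_preimage_top f U) := rfl

lemma app_scalars (h : π ≫ f = g ≫ Spec.map (CommRingCat.ofHom φ)) (U : X.Opens) (c : k) :
    π.app U (scalars f U c) = scalars g (π ⁻¹ᵁ U) (φ c) := by
  have h1 : CommRingCat.ofHom (scalars f U) ≫ π.app U =
      CommRingCat.ofHom φ ≫ CommRingCat.ofHom (scalars g (π ⁻¹ᵁ U)) := by
    rw [ofHom_scalars, ofHom_scalars, Scheme.ΓSpecIso_inv_naturality_assoc, Category.assoc,
      Scheme.Hom.app_eq_appLE, Scheme.Hom.appLE_comp_appLE, Scheme.Hom.appTop,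
      Scheme.Hom.app_eq_appLE]
    erw [Scheme.Hom.appLE_comp_appLE]
    simp only [h]
  exact congr($h1 c)

lemma app_evalSection (h : π ≫ f = g ≫ Spec.map (CommRingCat.ofHom φ)) {U : X.Opens} (a : Γ(X, U))
    (P : k[X]) : π.app U (evalSection f a P) = evalSection g (π.app U a) (P.map φ) := by
  simp only [evalSection, coe_eval₂RingHom]
  rw [eval₂_map]
  refine (hom_eval₂ P _ (π.app U).hom a).trans ?_
  congr 1
  ext c
  exact app_scalars h U c

/-- An affine line stays an affine line after base change. -/
lemma bijective_evalSection_app (h : IsPullback π g f (Spec.map (CommRingCat.ofHom φ)))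
    {U : X.Opens} (hU : IsAffineOpen U) {a : Γ(X, U)}
    (ha : Function.Bijective (evalSection f a)) :
    Function.Bijective (evalSection g (π.app U a)) := by
  have h1 := (isIso_pushoutSection_iff h (US := ⊤) (UT := ⊤) (UX := U) (UY := π ⁻¹ᵁ U)
    (le_preimage_top _ _) (le_preimage_top _ _) (by simp)).1 (isIso_pushoutSection_of_isAffineOpen h _ _ _
      (isAffineOpen_top _) (isAffineOpen_top _) hU)
  let e : CommRingCat.of k[X] ≅ Γ(X, U) := (RingEquiv.ofBijective _ ha).toCommRingCatIso
  have h2 : IsPushout (CommRingCat.ofHom (C : k →+* k[X])) (CommRingCat.ofHom φ)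
      (CommRingCat.ofHom ((π.app U).hom.comp (evalSection f a)))
      (CommRingCat.ofHom (scalars g (π ⁻¹ᵁ U))) := by
    refine h1.of_iso (Scheme.ΓSpecIso _) e.symm (Scheme.ΓSpecIso _) (Iso.refl _) ?_ ?_ ?_ ?_
    · rw [← Iso.inv_comp_eq, ← Category.assoc, ← ofHom_scalars, Iso.symm_hom, Iso.comp_inv_eq]
      symm
      refine CommRingCat.hom_ext (RingHom.ext fun c => ?_)
      exact eval₂_C _ _
    · rw [← Scheme.ΓSpecIso_naturality, Scheme.Hom.appTop, Scheme.Hom.app_eq_appLE]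
      rfl
    · rw [Iso.refl_hom, Category.comp_id, Iso.symm_hom, Iso.eq_inv_comp,
        ← Scheme.Hom.app_eq_appLE]
      rfl
    · rw [ofHom_scalars, Iso.refl_hom, Category.comp_id, Iso.hom_inv_id_assoc]
  have h3 : IsPushout (CommRingCat.ofHom (C : k →+* k[X])) (CommRingCat.ofHom φ)
      (CommRingCat.ofHom (mapRingHom φ)) (CommRingCat.ofHom (C : K →+* K[X])) := by
    let := φ.toAlgebra
    let := (mapRingHom φ).toAlgebra
    have : IsScalarTower k k[X] K[X] := .of_algebraMap_eq fun c => (map_C φ).symm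
    have : Algebra.IsPushout k K k[X] K[X] := inferInstance
    exact (CommRingCat.isPushout_of_isPushout k K k[X] K[X]).flip
  have h4 : CommRingCat.ofHom (evalSection g (π.app U a)) = (h3.isoIsPushout _ _ h2).hom := by
    refine h3.hom_ext ?_ ?_
    · rw [IsPushout.inl_isoIsPushout_hom]
      refine CommRingCat.hom_ext (RingHom.ext fun P => ?_)
      exact (app_evalSection h.w a P).symm
    · rw [IsPushout.inr_isoIsPushout_hom]
      ext c
      exact eval₂_C _ _
  have h5 : IsIso (CommRingCat.ofHom (evalSection g (π.app U a))) := h4 ▸ inferInstance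
  exact (ConcreteCategory.isIso_iff_bijective _).1 h5

lemma app_resO {U V : X.Opens} (hVU : V ≤ U) (a : Γ(X, U)) :
    π.app V (resO hVU a) = resO (π.preimage_mono hVU) (π.app U a) :=
  congr($(π.naturality (homOfLE hVU).op) a)

/-- The base change of an affine cover by two affine lines. -/
noncomputable def ProjectiveLineCharts.baseChange (ch : ProjectiveLineCharts f)
    (h : IsPullback π g f (Spec.map (CommRingCat.ofHom φ))) : ProjectiveLineCharts g where
  U₀ := π ⁻¹ᵁ ch.U₀
  U₁ := π ⁻¹ᵁ ch.U₁
  affine₀ :=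
    have : IsAffineHom π := MorphismProperty.of_isPullback h.flip inferInstance
    ch.affine₀.preimage π
  affine₁ :=
    have : IsAffineHom π := MorphismProperty.of_isPullback h.flip inferInstance
    ch.affine₁.preimage π
  cover := by rw [← Scheme.Hom.preimage_sup, ch.cover]; rfl
  t := π.app _ ch.t
  s := π.app _ ch.s
  inf_eq_basicOpen_t := by
    rw [← Scheme.preimage_basicOpen, ← ch.inf_eq_basicOpen_t]; rfl
  inf_eq_basicOpen_s := by
    rw [← Scheme.preimage_basicOpen, ← ch.inf_eq_basicOpen_s]; rfl
  mul_eq_one := by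
    have := congrArg (π.app (ch.U₀ ⊓ ch.U₁)) ch.mul_eq_one
    rw [map_mul, map_one, app_resO, app_resO] at this
    exact this
  bijective₀ := bijective_evalSection_app h ch.affine₀ ch.bijective₀
  bijective₁ := bijective_evalSection_app h ch.affine₁ ch.bijective₁

end BaseChange

/-! ### Consequences of the charts: integrality and Grothendieck's splitting theorem. -/

namespace ProjectiveLineCharts

open Polynomial

variable {K : Type u} [Field K] {X : Scheme.{u}} {f : X ⟶ Spec (.of K)}

section AffineLine

variable {U : X.Opens} {a : Γ(X, U)}

lemma isDomain_of_bijective (ha : Function.Bijective (evalSection f a)) : IsDomain Γ(X, U) :=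
  (RingEquiv.ofBijective _ ha).symm.toMulEquiv.isDomain _

lemma isIrreducible_of_isDomain (hU : IsAffineOpen U) [IsDomain Γ(X, U)] :
    IsIrreducible (U : Set X) := by
  have : IrreducibleSpace (Spec Γ(X, U)) := inferInstanceAs (IrreducibleSpace (PrimeSpectrum _))
  rw [← hU.range_fromSpec, ← Set.image_univ]
  exact (IrreducibleSpace.isIrreducible_univ _).image _ hU.fromSpec.continuous.continuousOn

lemma isReduced_stalk_of_isDomain (hU : IsAffineOpen U) [IsDomain Γ(X, U)] {x : X} (hx : x ∈ U) :
    _root_.IsReduced (X.presheaf.stalk x) := by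
  obtain ⟨q, hq, φ, -⟩ := exists_localRingEquiv hU hx
  exact isReduced_of_injective φ φ.injective

end AffineLine

variable (ch : ProjectiveLineCharts f)

lemma mem_or_mem (x : X) : x ∈ ch.U₀ ∨ x ∈ ch.U₁ := by
  have : x ∈ ch.U₀ ⊔ ch.U₁ := ch.cover ▸ trivial
  exact this

/-- If `D(t)` were empty, `t` would be nilpotent, but it corresponds to the variable of a polynomial
ring. -/
lemma nonempty_inf : ((ch.U₀ ⊓ ch.U₁ : X.Opens) : Set X).Nonempty := by
  rw [Set.nonempty_iff_ne_empty]
  intro h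
  have := isDomain_of_bijective ch.bijective₀
  have h1 := (Scheme.isNilpotent_iff_basicOpen_eq_bot_of_isCompact ch.affine₀.isCompact ch.t).2
    (ch.inf_eq_basicOpen_t.symm.trans (Opens.ext h))
  have h2 : evalSection f ch.t Polynomial.X = evalSection f ch.t 0 := by
    rw [map_zero]
    exact (eval₂_X _ _).trans h1.eq_zero
  exact X_ne_zero (ch.bijective₀.1 h2)

/-- Two irreducible reduced opens that meet and cover. Deducing this from the charts alone makes it
available on every base change. -/
lemma isIntegral (ch : ProjectiveLineCharts f) : IsIntegral X := by
  have := isDomain_of_bijective ch.bijective₀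
  have := isDomain_of_bijective ch.bijective₁
  have h0 := isIrreducible_of_isDomain ch.affine₀
  have h1 := isIrreducible_of_isDomain ch.affine₁
  have hd : Dense (ch.U₀ : Set X) := by
    rw [dense_iff_inter_open]
    rintro W hW ⟨x, hx⟩
    rcases ch.mem_or_mem x with hx0 | hx1
    · exact ⟨x, hx, hx0⟩
    · obtain ⟨y, hy⟩ := ch.nonempty_inf
      obtain ⟨z, -, hz⟩ := h1.2 W ch.U₀ hW ch.U₀.2 ⟨x, hx1, hx⟩ ⟨y, hy.2, hy.1⟩
      exact ⟨z, hz⟩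
  have h2 := h0.closure
  rw [hd.closure_eq] at h2
  have : IrreducibleSpace X := (irreducibleSpace_def X).2 h2
  have (x : X) : _root_.IsReduced (X.presheaf.stalk x) :=
    (ch.mem_or_mem x).elim (fun h => isReduced_stalk_of_isDomain ch.affine₀ h)
      fun h => isReduced_stalk_of_isDomain ch.affine₁ h
  have := isReduced_of_isReduced_stalk X
  exact isIntegral_of_irreducibleSpace_of_isReduced X

lemma isLocallyNoetherian (ch : ProjectiveLineCharts f) : IsLocallyNoetherian X := by
  have := isPrincipalIdealRing_of_bijective ch.bijective₀
  have := isPrincipalIdealRing_of_bijective ch.bijective₁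
  refine isLocallyNoetherian_of_affine_cover (ι := Bool)
    (S := fun i => bif i then ⟨ch.U₀, ch.affine₀⟩ else ⟨ch.U₁, ch.affine₁⟩) ?_ ?_
  · rw [iSup_bool_eq]
    exact ch.cover
  · rintro (_ | _) <;> dsimp only [cond] <;> infer_instance

/-- The coordinate `t` as a unit on the intersection of the two affine lines. -/
noncomputable def unit : Γ(X, ch.U₀ ⊓ ch.U₁)ˣ :=
  ⟨resO inf_le_left ch.t, resO inf_le_right ch.s, ch.mul_eq_one, (mul_comm _ _).trans ch.mul_eq_one⟩

/-- Functions on the overlap are Laurent polynomials in `t`. Allowing every `M ≥ N` lets one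
exponent serve all entries of a matrix. -/
lemma exists_mul_pow_eq (a : Γ(X, ch.U₀ ⊓ ch.U₁)) : ∃ N : ℕ, ∀ M, N ≤ M → ∃ P : K[X],
    a * (ch.unit : Γ(X, ch.U₀ ⊓ ch.U₁)) ^ M = evalSection f (ch.unit : Γ(X, ch.U₀ ⊓ ch.U₁)) P := by
  let := (resO (inf_le_left : ch.U₀ ⊓ ch.U₁ ≤ ch.U₀)).toAlgebra
  have : IsLocalization.Away ch.t Γ(X, ch.U₀ ⊓ ch.U₁) :=
    ch.affine₀.isLocalization_of_eq_basicOpen ch.t (homOfLE inf_le_left) ch.inf_eq_basicOpen_t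
  obtain ⟨N, b, hb⟩ := IsLocalization.Away.surj ch.t a
  obtain ⟨P, rfl⟩ := ch.bijective₀.2 b
  refine ⟨N, fun M hM => ⟨P * Polynomial.X ^ (M - N), ?_⟩⟩
  have h1 : a * resO inf_le_left ch.t ^ N = resO inf_le_left (evalSection f ch.t P) := hb
  rw [map_evalSection] at h1
  rw [← Nat.add_sub_cancel' hM, pow_add, ← mul_assoc, Nat.add_sub_cancel_left, map_mul]
  congr 1
  exact (eval₂_X_pow _ _).symm

lemma evalSection_unit_injective :
    Function.Injective (evalSection f (ch.unit : Γ(X, ch.U₀ ⊓ ch.U₁))) := by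
  have := ch.isIntegral
  intro P Q h
  refine ch.bijective₀.1 (resO_injective inf_le_left ch.nonempty_inf ?_)
  rwa [map_evalSection, map_evalSection]

/-- A polynomial that is invertible away from the origin is a monomial. -/
lemma exists_eq_C_mul_X_pow {P : K[X]}
    (hP : IsUnit (evalSection f (ch.unit : Γ(X, ch.U₀ ⊓ ch.U₁)) P)) :
    ∃ (c : K) (m : ℕ), c ≠ 0 ∧ P = C c * Polynomial.X ^ m := by
  obtain ⟨b, hb⟩ := hP.exists_right_inv
  obtain ⟨N, hN⟩ := ch.exists_mul_pow_eq b
  obtain ⟨Q, hQ⟩ := hN N le_rfl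
  have h1 : P * Q = Polynomial.X ^ N := by
    apply ch.evalSection_unit_injective
    rw [map_mul, ← hQ, ← mul_assoc, hb, one_mul]
    exact (eval₂_X_pow _ _).symm
  obtain ⟨m, -, u, hu⟩ := (dvd_prime_pow prime_X N).1 ⟨Q, h1.symm⟩
  obtain ⟨c, hc, hcu⟩ := Polynomial.isUnit_iff.1 u⁻¹.isUnit
  refine ⟨c, m, hc.ne_zero, ?_⟩
  rw [hcu, ← hu, mul_comm, mul_assoc, Units.mul_inv, mul_one]

/-- `E` is glued from two trivial bundles along the diagonal matrix with entries `t ^ n i`. -/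
def IsSplit (E : X.Modules) {r : ℕ} (n : Fin r → ℤ) : Prop :=
  ∃ (e : Fin r → Γ(E, ch.U₀)) (b : Fin r → Γ(E, ch.U₁)), IsFrame E e ∧ IsFrame E b ∧
    ∀ i, res E inf_le_left (e i) =
      ((ch.unit ^ n i : Γ(X, ch.U₀ ⊓ ch.U₁)ˣ) : Γ(X, ch.U₀ ⊓ ch.U₁)) • res E inf_le_right (b i)

variable {r : ℕ}

lemma exists_isSplit (n : Fin r → ℤ) : ∃ E : X.Modules, ch.IsSplit E n :=
  exists_frames_of_transition (g' := fun i => ((ch.unit ^ n i)⁻¹ : Γ(X, ch.U₀ ⊓ ch.U₁)ˣ))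
    fun _ => Units.mul_inv _

variable {ch} in
lemma IsSplit.isVectorBundle {E : X.Modules} {n : Fin r → ℤ} (h : ch.IsSplit E n) :
    IsVectorBundle E r := by
  obtain ⟨e, b, he, hb, -⟩ := h
  exact fun x => (ch.mem_or_mem x).elim (fun hx => ⟨_, hx, e, he⟩) fun hx => ⟨_, hx, b, hb⟩

/-- Grothendieck's theorem: every vector bundle on the projective line splits. -/
theorem exists_isSplit_of_isVectorBundle {E : X.Modules} (hE : IsVectorBundle E r) :
    ∃ n : Fin r → ℤ, ch.IsSplit E n := by
  have := ch.isIntegral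
  have := isPrincipalIdealRing_of_bijective ch.bijective₀
  have := isPrincipalIdealRing_of_bijective ch.bijective₁
  obtain ⟨x, hx⟩ := ch.nonempty_inf
  obtain ⟨e, he⟩ := exists_frame_of_isPrincipalIdealRing hE ch.affine₀ ⟨x, hx.1⟩
  obtain ⟨b, hb⟩ := exists_frame_of_isPrincipalIdealRing hE ch.affine₁ ⟨x, hx.2⟩
  obtain ⟨G, G', hG, hGe⟩ := exists_mul_eq_one_of_bases
    (hb.basis (inf_le_right : ch.U₀ ⊓ ch.U₁ ≤ ch.U₁)) (he.basis inf_le_left)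
  simp only [IsFrame.basis_apply] at hGe
  obtain ⟨N, A, hA⟩ : ∃ (N : ℕ) (A : Matrix (Fin r) (Fin r) K[X]), ∀ i j,
      G i j * (ch.unit : Γ(X, ch.U₀ ⊓ ch.U₁)) ^ N =
        evalSection f (ch.unit : Γ(X, ch.U₀ ⊓ ch.U₁)) (A i j) := by
    choose M hM using fun i j => ch.exists_mul_pow_eq (G i j)
    have hN : ∀ i j, M i j ≤ ∑ i, ∑ j, M i j := fun i j =>
      (Finset.single_le_sum (f := fun j => M i j) (fun _ _ => Nat.zero_le _)
        (Finset.mem_univ j)).trans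
        (Finset.single_le_sum (f := fun i => ∑ j, M i j) (fun _ _ => Nat.zero_le _)
          (Finset.mem_univ i))
    choose A hA using fun i j => hM i j _ (hN i j)
    exact ⟨_, Matrix.of A, hA⟩
  let ev : K[X] →+* Γ(X, ch.U₀ ⊓ ch.U₁) := evalSection f (ch.unit : Γ(X, ch.U₀ ⊓ ch.U₁))
  have hA' : A.map ev = (ch.unit : Γ(X, ch.U₀ ⊓ ch.U₁)) ^ N • G := by
    ext i j
    rw [Matrix.map_apply, Matrix.smul_apply, smul_eq_mul, mul_comm]
    exact (hA i j).symm
  have hdet : IsUnit (ev A.det) := by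
    rw [RingHom.map_det, RingHom.mapMatrix_apply, hA', Matrix.det_smul]
    refine ((ch.unit.isUnit.pow N).pow _).mul ?_
    exact .of_mul_eq_one G'.det (by rw [← Matrix.det_mul, hG, Matrix.det_one])
  obtain ⟨c, m, hc, hcm⟩ := ch.exists_eq_C_mul_X_pow hdet
  obtain ⟨P, Q, d, hP, hQ, hQd, hPQ⟩ := exists_birkhoff A hc hcm
  have hmap {U : X.Opens} (a : Γ(X, U)) {P : Matrix (Fin r) (Fin r) K[X]} (hP : IsUnit P.det) :
      P.map (evalSection f a) * P⁻¹.map (evalSection f a) = 1 := by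
    rw [← Matrix.map_mul, Matrix.mul_nonsing_inv _ hP, Matrix.map_one _ (map_zero _) (map_one _)]
  -- With `A = t ^ N * G` and `P * A = diag (t ^ d i) * Q(s)`, the frames `P(t) e` and `Q(s) b`
  -- differ by `diag (t ^ (d i - N))`.
  refine ⟨fun i => d i - N, _, _, he.mul (hmap ch.t hP), hb.mul (hmap ch.s hQ), fun i => ?_⟩
  have hs (q : K[X]) (m : ℕ) (hq : q.natDegree ≤ m) : (ch.unit : Γ(X, ch.U₀ ⊓ ch.U₁)) ^ m *
      evalSection f (resO inf_le_right ch.s) q = ev (reflect m q) := by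
    let : Invertible (resO inf_le_right ch.s : Γ(X, ch.U₀ ⊓ ch.U₁)) :=
      ⟨ch.unit, ch.unit.mul_inv, ch.unit.inv_mul⟩
    have h1 := eval₂_reflect_mul_pow (scalars f (ch.U₀ ⊓ ch.U₁))
      (resO inf_le_right ch.s : Γ(X, ch.U₀ ⊓ ch.U₁)) m q hq
    have h2 : (ch.unit : Γ(X, ch.U₀ ⊓ ch.U₁)) ^ m * resO inf_le_right ch.s ^ m = 1 := by
      rw [← mul_pow]
      exact (congrArg (· ^ m) ch.unit.mul_inv).trans (one_pow m)
    change _ * eval₂ _ _ q = _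
    rw [← h1, mul_left_comm, h2, mul_one]
    rfl
  have key : (ch.unit : Γ(X, ch.U₀ ⊓ ch.U₁)) ^ N •
      res E (inf_le_left : ch.U₀ ⊓ ch.U₁ ≤ ch.U₀) (∑ j, P.map (evalSection f ch.t) i j • e j) =
      (ch.unit : Γ(X, ch.U₀ ⊓ ch.U₁)) ^ d i •
        res E (inf_le_right : ch.U₀ ⊓ ch.U₁ ≤ ch.U₁)
          (∑ j, Q.map (evalSection f ch.s) i j • b j) := by
    rw [res_sum_smul, res_sum_smul]
    simp only [hGe, Matrix.map_apply, map_evalSection]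
    rw [sum_smul_matrix, Finset.smul_sum, Finset.smul_sum]
    refine Finset.sum_congr rfl fun l _ => ?_
    rw [smul_smul, smul_smul, hs _ _ (hQd i l), ← hPQ]
    congr 1
    have h1 := congrFun (congrFun (Matrix.map_mul (f := ev) (L := P) (M := A)) i) l
    rw [hA', Matrix.mul_smul] at h1
    exact h1.symm
  rw [zpow_sub, zpow_natCast, zpow_natCast, mul_comm, Units.val_mul, mul_smul, Units.val_pow_eq_pow_val,
    ← key, smul_smul, ← Units.val_pow_eq_pow_val, Units.inv_mul, one_smul]

end ProjectiveLineCharts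

/-! ### Determinants of transition functions. -/

section TransitionDet

variable {X : Scheme.{u}} [IsIntegral X] {E : X.Modules} {r : ℕ} {U V W : X.Opens}

lemma germToFunctionField_resO [Nonempty U] [Nonempty V] (h : V ≤ U) (a : Γ(X, U)) :
    X.germToFunctionField V (resO h a) = X.germToFunctionField U a :=
  X.presheaf.germ_res_apply (homOfLE h) _ _ a

lemma IsFrame.coe_basis {e : Fin r → Γ(E, U)} (he : IsFrame E e) (h : V ≤ U) :
    ⇑(he.basis h) = fun i => res E h (e i) :=
  funext fun i => he.basis_apply h i

lemma IsFrame.det_res {b : Fin r → Γ(E, U)} (hb : IsFrame E b) (h : V ≤ U) (h' : W ≤ V)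
    (a : Fin r → Γ(E, V)) : (hb.basis (h'.trans h)).det (fun i => res E h' (a i)) =
      resO h' ((hb.basis h).det a) := by
  rw [Module.Basis.det_apply, Module.Basis.det_apply, RingHom.map_det]
  congr 1
  ext i j
  exact congrFun (hb.coord_res h h' (a j)) i

/-- Determinants commute with restriction, so any nonempty open set in both domains may be used;
this is what lets three frames be compared at once. -/
lemma transitionDet_eq {e : Fin r → Γ(E, U)} {b : Fin r → Γ(E, V)} (hU : Nonempty U)
    (hV : Nonempty V) (hb : IsFrame E b) [Nonempty W] (hWU : W ≤ U) (hWV : W ≤ V) :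
    transitionDet hU hV e hb =
      X.germToFunctionField W ((hb.basis hWV).det fun i => res E hWU (e i)) := by
  have hW : W ≤ U ⊓ V := le_inf hWU hWV
  have : Nonempty (U ⊓ V : X.Opens) := .map (fun x => ⟨x.1, hW x.2⟩) ‹Nonempty W›
  have h1 := hb.det_res (inf_le_right : U ⊓ V ≤ V) hW (fun i => res E inf_le_left (e i))
  simp only [res_res] at h1
  rw [h1, germToFunctionField_resO]
  rfl

lemma nonempty_inf_coe (hU : Nonempty U) (hV : Nonempty V) : Nonempty (U ⊓ V : X.Opens) := by
  obtain ⟨⟨x, hx⟩⟩ := hU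
  obtain ⟨⟨y, hy⟩⟩ := hV
  exact (nonempty_inf ⟨x, hx⟩ ⟨y, hy⟩).to_subtype

lemma exists_isUnit_transitionDet {e : Fin r → Γ(E, U)} {b : Fin r → Γ(E, V)} (hU : Nonempty U)
    (hV : Nonempty V) (he : IsFrame E e) (hb : IsFrame E b) :
    ∃ (_ : Nonempty (U ⊓ V : X.Opens)) (a : Γ(X, U ⊓ V)), IsUnit a ∧
      transitionDet hU hV e hb = X.germToFunctionField (U ⊓ V) a := by
  have := nonempty_inf_coe hU hV
  refine ⟨this, _, ?_, transitionDet_eq hU hV hb inf_le_left inf_le_right⟩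
  rw [← he.coe_basis]
  exact Module.Basis.isUnit_det _ _

lemma transitionDet_ne_zero {e : Fin r → Γ(E, U)} {b : Fin r → Γ(E, V)} (hU : Nonempty U)
    (hV : Nonempty V) (he : IsFrame E e) (hb : IsFrame E b) : transitionDet hU hV e hb ≠ 0 := by
  obtain ⟨h, a, ha, h1⟩ := exists_isUnit_transitionDet hU hV he hb
  rw [h1]
  exact (ha.map (X.germToFunctionField (U ⊓ V)).hom).ne_zero

lemma ord_transitionDet [IsLocallyNoetherian X] {e : Fin r → Γ(E, U)} {b : Fin r → Γ(E, V)}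
    (hU : Nonempty U) (hV : Nonempty V) (he : IsFrame E e) (hb : IsFrame E b) {x : X} (hxU : x ∈ U)
    (hxV : x ∈ V) : Scheme.ord (transitionDet hU hV e hb) x = 0 := by
  obtain ⟨h, a, ha, h1⟩ := exists_isUnit_transitionDet hU hV he hb
  rw [h1]
  exact Scheme.ord_of_isUnit ha (mem_inf hxU hxV)

lemma transitionDet_mul {e : Fin r → Γ(E, U)} {b : Fin r → Γ(E, V)} {c : Fin r → Γ(E, W)}
    (hU : Nonempty U) (hV : Nonempty V) (hW : Nonempty W) (he : IsFrame E e) (hb : IsFrame E b)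
    (hc : IsFrame E c) :
    transitionDet hU hV e hb * transitionDet hV hW b hc = transitionDet hU hW e hc := by
  have := nonempty_inf_coe (nonempty_inf_coe hU hV) hW
  have hU' : U ⊓ V ⊓ W ≤ U := inf_le_left.trans inf_le_left
  have hV' : U ⊓ V ⊓ W ≤ V := inf_le_left.trans inf_le_right
  have hW' : U ⊓ V ⊓ W ≤ W := inf_le_right
  rw [transitionDet_eq hU hV hb hU' hV', transitionDet_eq hV hW hc hV' hW',
    transitionDet_eq hU hW hc hU' hW', ← map_mul, ← hb.coe_basis, ← he.coe_basis, mul_comm,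
    Module.Basis.det_mul_det]

lemma transitionDet_of_smul {e : Fin r → Γ(E, U)} {b : Fin r → Γ(E, V)} (hU : Nonempty U)
    (hV : Nonempty V) (hb : IsFrame E b) {g : Fin r → Γ(X, U ⊓ V)ˣ}
    (hg : ∀ i, res E inf_le_left (e i) = (g i : Γ(X, U ⊓ V)) • res E inf_le_right (b i))
    [Nonempty (U ⊓ V : X.Opens)] :
    transitionDet hU hV e hb = X.germToFunctionField (U ⊓ V) (∏ i, (g i : Γ(X, U ⊓ V))) := by
  rw [transitionDet_eq hU hV hb inf_le_left inf_le_right,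
    ← (hb.basis inf_le_right).det_unitsSMul_self g]
  congr 2
  ext i
  rw [Module.Basis.unitsSMul_apply, hb.basis_apply, hg]
  rfl

end TransitionDet

/-! ### Points of an affine open as prime ideals. -/

section PointsOfAffineOpen

open IsLocalRing

variable {X : Scheme.{u}} {U : X.Opens} (hU : IsAffineOpen U)

lemma notMem_basicOpen_iff {x : X} (hx : x ∈ U) (c : Γ(X, U)) :
    x ∉ X.basicOpen c ↔ c ∈ (hU.primeIdealOf ⟨x, hx⟩).asIdeal := by
  let := (X.presheaf.germ U x hx).hom.toAlgebra
  have : IsLocalization.AtPrime (X.presheaf.stalk x) (hU.primeIdealOf ⟨x, hx⟩).asIdeal :=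
    hU.isLocalization_stalk ⟨x, hx⟩
  rw [Scheme.mem_basicOpen _ _ _ hx]
  have h := IsLocalization.AtPrime.isUnit_to_map_iff (X.presheaf.stalk x)
    (hU.primeIdealOf ⟨x, hx⟩).asIdeal c
  refine (not_congr h).trans ?_
  exact not_not

lemma maximalIdeal_stalk_eq {x : X} (hx : x ∈ U) {c : Γ(X, U)}
    (hc : (hU.primeIdealOf ⟨x, hx⟩).asIdeal = Ideal.span {c}) :
    maximalIdeal (X.presheaf.stalk x) = Ideal.span {X.presheaf.germ U x hx c} := by
  let := (X.presheaf.germ U x hx).hom.toAlgebra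
  have : IsLocalization.AtPrime (X.presheaf.stalk x) (hU.primeIdealOf ⟨x, hx⟩).asIdeal :=
    hU.isLocalization_stalk ⟨x, hx⟩
  rw [← IsLocalization.AtPrime.map_eq_maximalIdeal (hU.primeIdealOf ⟨x, hx⟩).asIdeal, hc,
    Ideal.map_span, Set.image_singleton]
  rfl

lemma ker_evaluation {x : X} (hx : x ∈ U) (c : Γ(X, U)) :
    X.evaluation U x hx c = 0 ↔ x ∉ X.basicOpen c :=
  Scheme.evaluation_eq_zero_iff_notMem_basicOpen X x hx c

lemma evaluation_surjective {x : X} (hx : x ∈ U)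
    (hmax : (hU.primeIdealOf ⟨x, hx⟩).asIdeal.IsMaximal) :
    Function.Surjective (X.evaluation U x hx) := by
  let := (X.presheaf.germ U x hx).hom.toAlgebra
  have : IsLocalization.AtPrime (X.presheaf.stalk x) (hU.primeIdealOf ⟨x, hx⟩).asIdeal :=
    hU.isLocalization_stalk ⟨x, hx⟩
  intro z
  obtain ⟨w, rfl⟩ := (IsLocalization.AtPrime.equivQuotMaximalIdeal
    (hU.primeIdealOf ⟨x, hx⟩).asIdeal (X.presheaf.stalk x)).surjective z
  obtain ⟨a, rfl⟩ := Ideal.Quotient.mk_surjective w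
  exact ⟨a, rfl⟩

lemma exists_primeIdealOf_eq (q : PrimeSpectrum Γ(X, U)) :
    ∃ (x : X) (hx : x ∈ U), hU.primeIdealOf ⟨x, hx⟩ = q := by
  obtain ⟨x, hx⟩ := (hU.isoSpec.hom.homeomorph).surjective q
  exact ⟨x.1, x.2, hx⟩

lemma eq_of_primeIdealOf_eq {x y : X} (hx : x ∈ U) (hy : y ∈ U)
    (h : hU.primeIdealOf ⟨x, hx⟩ = hU.primeIdealOf ⟨y, hy⟩) : x = y :=
  (hU.fromSpec_primeIdealOf ⟨x, hx⟩).symm.trans (h ▸ hU.fromSpec_primeIdealOf ⟨y, hy⟩)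

end PointsOfAffineOpen

/-! ### Closed points of the affine line: orders and residue degrees. -/

section AffineLine

open Polynomial IsLocalRing

variable {K : Type u} [Field K] {X : Scheme.{u}} {f : X ⟶ Spec (.of K)} {U : X.Opens}
  {a : Γ(X, U)} {P : K[X]}

lemma isMaximal_of_isField {R : Type*} [CommRing R] (hR : IsField R) (q : Ideal R) [q.IsPrime] :
    q.IsMaximal := by
  let := hR.toField
  rw [Ideal.eq_bot_of_prime q]
  exact Ideal.bot_isMaximal

lemma isMaximal_span_evalSection (ha : Function.Bijective (evalSection f a)) (hP : Irreducible P) :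
    (Ideal.span {evalSection f a P}).IsMaximal := by
  have h1 : (Ideal.span {P}).IsMaximal := PrincipalIdealRing.isMaximal_of_irreducible hP
  have h2 := Ideal.map_isMaximal_of_equiv (RingEquiv.ofBijective _ ha) (p := Ideal.span {P})
  rwa [Ideal.map_span, Set.image_singleton] at h2

/-- The points of the affine line that correspond to irreducible polynomials. -/
lemma exists_notMem_basicOpen (hU : IsAffineOpen U) (ha : Function.Bijective (evalSection f a))
    (hP : Irreducible P) : ∃ x ∈ U, x ∉ X.basicOpen (evalSection f a P) := by
  have := isMaximal_span_evalSection ha hP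
  obtain ⟨x, hx, h⟩ := exists_primeIdealOf_eq hU ⟨_, this.isPrime⟩
  refine ⟨x, hx, (notMem_basicOpen_iff hU hx _).2 ?_⟩
  rw [h]
  exact Ideal.mem_span_singleton_self _

lemma primeIdealOf_eq_span (hU : IsAffineOpen U) (ha : Function.Bijective (evalSection f a))
    (hP : Irreducible P) {x : X} (hx : x ∈ U) (hxP : x ∉ X.basicOpen (evalSection f a P)) :
    (hU.primeIdealOf ⟨x, hx⟩).asIdeal = Ideal.span {evalSection f a P} := by
  refine ((isMaximal_span_evalSection ha hP).eq_of_le (hU.primeIdealOf ⟨x, hx⟩).2.ne_top ?_).symm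
  rw [Ideal.span_singleton_le_iff_mem]
  exact (notMem_basicOpen_iff hU hx _).1 hxP

lemma eq_of_notMem_basicOpen (hU : IsAffineOpen U) (ha : Function.Bijective (evalSection f a))
    (hP : Irreducible P) {x y : X} (hx : x ∈ U) (hxP : x ∉ X.basicOpen (evalSection f a P))
    (hy : y ∈ U) (hyP : y ∉ X.basicOpen (evalSection f a P)) : x = y :=
  eq_of_primeIdealOf_eq hU hx hy <| PrimeSpectrum.ext <|
    (primeIdealOf_eq_span hU ha hP hx hxP).trans (primeIdealOf_eq_span hU ha hP hy hyP).symm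

lemma notMem_basicOpen_evalSection_iff (hU : IsAffineOpen U)
    (ha : Function.Bijective (evalSection f a)) (hP : Irreducible P) {x : X} (hx : x ∈ U)
    (hxP : x ∉ X.basicOpen (evalSection f a P)) (Q : K[X]) :
    x ∉ X.basicOpen (evalSection f a Q) ↔ P ∣ Q := by
  rw [notMem_basicOpen_iff hU hx, primeIdealOf_eq_span hU ha hP hx hxP,
    Ideal.mem_span_singleton]
  exact map_dvd_iff (RingEquiv.ofBijective _ ha)

/-- `P` generates the prime of `x`, hence the maximal ideal of its stalk. The stalk is then a
discrete valuation ring with `P` as uniformizer. -/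
lemma ord_evalSection [IsIntegral X] [IsLocallyNoetherian X] (hU : IsAffineOpen U)
    (ha : Function.Bijective (evalSection f a)) (hP : Irreducible P) {x : X} (hx : x ∈ U)
    (hxP : x ∉ X.basicOpen (evalSection f a P)) [Nonempty U] :
    Scheme.ord (X.germToFunctionField U (evalSection f a P)) x = 1 := by
  have h1 := maximalIdeal_stalk_eq hU hx (primeIdealOf_eq_span hU ha hP hx hxP)
  have h0 : evalSection f a P ≠ 0 := (map_ne_zero_iff _ ha.1).2 hP.ne_zero
  have h0' : X.presheaf.germ U x hx (evalSection f a P) ≠ 0 :=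
    (map_ne_zero_iff _ (germ_injective_of_isIntegral X x hx)).2 h0
  obtain ⟨_, hdvr⟩ := isDiscreteValuationRing_of_span_singleton h1 (.of_ne_zero h0')
  have : IsDiscreteValuationRing (X.presheaf.stalk x) := hdvr
  have hc : Order.coheight x = 1 := by
    have h := ringKrullDim_stalk_eq_coheight x
    rw [IsDiscreteValuationRing.ringKrullDim_eq_one] at h
    exact_mod_cast h.symm
  rw [Scheme.ord_eq_iff hc ((map_ne_zero_iff _ (Scheme.germToFunctionField_injective X U)).2 h0),
    ← Scheme.algebraMap_germ_eq_germToFunctionField X hx]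
  exact Ring.ordFrac_irreducible (K := X.functionField)
    ((IsDiscreteValuationRing.irreducible_iff_uniformizer _).2 h1)

/-- Evaluation at `x` identifies the residue field with `K[X] / (P)`. -/
lemma residueDegree_evalSection (hU : IsAffineOpen U)
    (ha : Function.Bijective (evalSection f a)) (hP : Irreducible P) {x : X} (hx : x ∈ U)
    (hxP : x ∉ X.basicOpen (evalSection f a P)) : f.residueDegree x = P.natDegree := by
  have hq := primeIdealOf_eq_span hU ha hP hx hxP
  have hsurj := evaluation_surjective hU hx (hq ▸ isMaximal_span_evalSection ha hP)
  let ψ : K[X] →+* X.residueField x := (X.evaluation U x hx).hom.comp (evalSection f a)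
  have hψ : Function.Surjective ψ := hsurj.comp ha.2
  have hker : RingHom.ker ψ = Ideal.span {P} := by
    ext Q
    rw [RingHom.mem_ker, Ideal.mem_span_singleton,
      ← notMem_basicOpen_evalSection_iff hU ha hP hx hxP]
    exact ker_evaluation hx _
  -- The residue degree is taken over the residue field of `Spec K` at `f x`, which has to be
  -- identified with `K`.
  let σ : K →+* (Spec (CommRingCat.of K)).residueField (f x) :=
    ((Scheme.ΓSpecIso (.of K)).inv ≫ (Spec (CommRingCat.of K)).Γevaluation (f x)).hom
  have hσ : Function.Bijective σ := by
    refine ⟨σ.injective, ?_⟩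
    have hfield : IsField Γ(Spec (CommRingCat.of K), ⊤) :=
      (Scheme.ΓSpecIso (.of K)).commRingCatIsoToRingEquiv.toMulEquiv.isField
        (Field.toIsField K)
    have h1 := evaluation_surjective (isAffineOpen_top (Spec (CommRingCat.of K))) (x := f x)
      (show f x ∈ (⊤ : (Spec (CommRingCat.of K)).Opens) from trivial)
      (isMaximal_of_isField hfield _)
    exact h1.comp (Scheme.ΓSpecIso (.of K)).symm.commRingCatIsoToRingEquiv.surjective
  let j : (K[X] ⧸ Ideal.span {P}) ≃+* X.residueField x :=
    (Ideal.quotEquivOfEq hker.symm).trans (RingHom.quotientKerEquivOfSurjective hψ)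
  rw [← finrank_quotient_span_eq_natDegree (f := P)]
  let := (f.residueFieldMap x).hom.toAlgebra
  refine (Algebra.finrank_eq_of_equiv_equiv (RingEquiv.ofBijective σ hσ) j ?_).symm
  ext c
  have hx' : x ∈ (⊤ : X.Opens) := trivial
  have h1 : f.residueFieldMap x (σ c) = X.evaluation ⊤ x hx' (scalars f ⊤ c) := by
    refine (congr($(Scheme.Γevaluation_naturality f x)
      ((Scheme.ΓSpecIso (.of K)).inv c))).trans ?_
    exact congrArg (X.evaluation ⊤ x hx') (resO_self le_top _).symm
  refine h1.trans ?_
  refine (congrArg (X.residue x) (germ_scalars f hx' hx c)).trans ?_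
  change X.evaluation U x hx (scalars f U c) = X.evaluation U x hx (evalSection f a (C c))
  congr 1
  exact (eval₂_C _ _).symm

end AffineLine

/-! ### Principal divisors and degrees of split bundles. -/

namespace ProjectiveLineCharts

open Polynomial

variable {K : Type u} [Field K] {X : Scheme.{u}} {f : X ⟶ Spec (.of K)}
  (ch : ProjectiveLineCharts f)

lemma basicOpen_evalSection_X :
    X.basicOpen (evalSection f ch.s Polynomial.X) = ch.U₀ ⊓ ch.U₁ := by
  rw [ch.inf_eq_basicOpen_s]
  congr 1
  exact eval₂_X _ _

lemma exists_infinity : ∃ x ∈ ch.U₁, x ∉ X.basicOpen (evalSection f ch.s Polynomial.X) :=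
  exists_notMem_basicOpen ch.affine₁ ch.bijective₁ irreducible_X

/-- The point outside the first affine line. -/
noncomputable def infinity : X := ch.exists_infinity.choose

lemma infinity_mem : ch.infinity ∈ ch.U₁ := ch.exists_infinity.choose_spec.1

lemma infinity_notMem_basicOpen :
    ch.infinity ∉ X.basicOpen (evalSection f ch.s Polynomial.X) :=
  ch.exists_infinity.choose_spec.2

lemma infinity_notMem : ch.infinity ∉ ch.U₀ := fun h =>
  ch.infinity_notMem_basicOpen (ch.basicOpen_evalSection_X ▸ mem_inf h ch.infinity_mem)

/-- The complement of `U₀` is the zero locus of `s` on the second line, a single point. -/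
lemma eq_infinity {x : X} (hx : x ∉ ch.U₀) : x = ch.infinity :=
  eq_of_notMem_basicOpen ch.affine₁ ch.bijective₁ irreducible_X
    ((ch.mem_or_mem x).resolve_left hx)
    (fun h => hx (ch.basicOpen_evalSection_X ▸ h : x ∈ ch.U₀ ⊓ ch.U₁).1)
    ch.infinity_mem ch.infinity_notMem_basicOpen

lemma residueDegree_infinity : f.residueDegree ch.infinity = 1 :=
  (residueDegree_evalSection ch.affine₁ ch.bijective₁ irreducible_X ch.infinity_mem
    ch.infinity_notMem_basicOpen).trans natDegree_X

lemma nonempty₀ : Nonempty ch.U₀ := by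
  obtain ⟨x, hx⟩ := ch.nonempty_inf
  exact ⟨⟨x, hx.1⟩⟩

lemma nonempty₁ : Nonempty ch.U₁ := ⟨⟨_, ch.infinity_mem⟩⟩

lemma nonempty_inf' : Nonempty (ch.U₀ ⊓ ch.U₁ : X.Opens) := ch.nonempty_inf.to_subtype

section FunctionField

variable [IsIntegral X]

/-- The rational function given by a polynomial in the coordinate of the first affine line. -/
noncomputable def ratFun : K[X] →+* X.functionField :=
  have := ch.nonempty₀
  (X.germToFunctionField ch.U₀).hom.comp (evalSection f ch.t)

lemma ratFun_injective : Function.Injective ch.ratFun := by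
  have := ch.nonempty₀
  exact (Scheme.germToFunctionField_injective X ch.U₀).comp ch.bijective₀.1

lemma exists_ratFun_div (φ : X.functionField) :
    ∃ P Q : K[X], Q ≠ 0 ∧ φ * ch.ratFun Q = ch.ratFun P := by
  have := ch.nonempty₀
  have := functionField_isFractionRing_of_isAffineOpen X ch.U₀ ch.affine₀
  obtain ⟨⟨p, q⟩, h⟩ := IsLocalization.surj (nonZeroDivisors Γ(X, ch.U₀)) φ
  obtain ⟨P, rfl⟩ := ch.bijective₀.2 p
  obtain ⟨Q, hQ⟩ := ch.bijective₀.2 q.1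
  refine ⟨P, Q, ?_, ?_⟩
  · rintro rfl
    have := isDomain_of_bijective ch.bijective₀
    exact nonZeroDivisors.coe_ne_zero q (hQ.symm.trans (map_zero _))
  · change φ * X.germToFunctionField ch.U₀ (evalSection f ch.t Q) = _
    rw [hQ]
    exact h

variable [IsLocallyNoetherian X]

lemma ord_ratFun_C {c : K} (hc : c ≠ 0) (x : X) : Scheme.ord (ch.ratFun (C c)) x = 0 := by
  have hx : x ∈ (⊤ : X.Opens) := trivial
  have : Nonempty (⊤ : X.Opens) := ⟨⟨x, hx⟩⟩
  have := ch.nonempty₀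
  have h1 : ch.ratFun (C c) = X.germToFunctionField ⊤ (scalars f ⊤ c) := by
    rw [← germToFunctionField_resO (le_top : ch.U₀ ≤ ⊤)]
    change X.germToFunctionField ch.U₀ (evalSection f ch.t (C c)) = _
    congr 1
    exact (eval₂_C _ _).trans (map_scalars f (homOfLE le_top) c).symm
  rw [h1]
  exact Scheme.ord_of_isUnit ((isUnit_iff_ne_zero.2 hc).map _) hx

lemma ord_ratFun_X_infinity : Scheme.ord (ch.ratFun Polynomial.X) ch.infinity = -1 := by
  have := ch.nonempty₀
  have := ch.nonempty₁
  have := ch.nonempty_inf'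
  have h1 := ord_evalSection ch.affine₁ ch.bijective₁ irreducible_X ch.infinity_mem
    ch.infinity_notMem_basicOpen
  have h2 : ch.ratFun Polynomial.X *
      X.germToFunctionField ch.U₁ (evalSection f ch.s Polynomial.X) = 1 := by
    have h3 := congrArg (X.germToFunctionField (ch.U₀ ⊓ ch.U₁)) ch.mul_eq_one
    rw [map_mul, map_one, germToFunctionField_resO, germToFunctionField_resO] at h3
    rw [← h3]
    congr 1
    · exact congrArg _ (eval₂_X _ _)
    · exact congrArg _ (eval₂_X _ _)
  have h4 := Scheme.ord_mul (x := ch.infinity) (left_ne_zero_of_mul_eq_one h2)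
    (right_ne_zero_of_mul_eq_one h2)
  have h5 : Scheme.ord (1 : X.functionField) ch.infinity = 0 := by
    rw [← map_one ch.ratFun, ← C_1, ch.ord_ratFun_C one_ne_zero]
  rw [h2, h1, h5] at h4
  omega

lemma ord_pow {φ : X.functionField} (hφ : φ ≠ 0) (n : ℕ) (x : X) :
    Scheme.ord (φ ^ n) x = n * Scheme.ord φ x := by
  induction n with
  | zero =>
    have h := Scheme.ord_mul (x := x) (one_ne_zero (α := X.functionField)) one_ne_zero
    rw [mul_one] at h
    simp only [pow_zero, Nat.cast_zero, zero_mul]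
    omega
  | succ n ih =>
    rw [pow_succ, Scheme.ord_mul (pow_ne_zero n hφ) hφ, ih]
    push_cast
    ring

lemma ord_germToFunctionField {U : X.Opens} [Nonempty U] {c : Γ(X, U)} {x : X}
    (hx : x ∈ X.basicOpen c) : Scheme.ord (X.germToFunctionField U c) x = 0 := by
  have : Nonempty (X.basicOpen c) := ⟨⟨x, hx⟩⟩
  rw [← germToFunctionField_resO (X.basicOpen_le c)]
  exact Scheme.ord_of_isUnit (isUnit_resO_basicOpen c _ le_rfl) hx

/-- `P(t)` is `t ^ deg P` times the reverse of `P` at `s`. The latter has nonzero constant term, so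
it is a unit at infinity, and `t` has order `-1` there. -/
lemma ord_ratFun_infinity {P : K[X]} (hP : P ≠ 0) :
    Scheme.ord (ch.ratFun P) ch.infinity = -P.natDegree := by
  have := ch.nonempty₀
  have := ch.nonempty₁
  have := ch.nonempty_inf'
  have hX : ch.ratFun Polynomial.X ≠ 0 := (map_ne_zero_iff _ ch.ratFun_injective).2 X_ne_zero
  have hrev : ch.infinity ∈ X.basicOpen (evalSection f ch.s P.reverse) := by
    by_contra h
    rw [notMem_basicOpen_evalSection_iff ch.affine₁ ch.bijective₁ irreducible_X ch.infinity_mem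
      ch.infinity_notMem_basicOpen, X_dvd_iff, coeff_zero_reverse, leadingCoeff_eq_zero] at h
    exact hP h
  have hev : X.germToFunctionField ch.U₁ (evalSection f ch.s P.reverse) *
      ch.ratFun Polynomial.X ^ P.natDegree = ch.ratFun P := by
    let : Invertible (resO inf_le_left ch.t : Γ(X, ch.U₀ ⊓ ch.U₁)) :=
      ⟨resO inf_le_right ch.s, (mul_comm _ _).trans ch.mul_eq_one, ch.mul_eq_one⟩
    have h1 := congrArg (X.germToFunctionField (ch.U₀ ⊓ ch.U₁))
      (eval₂_reflect_mul_pow (scalars f (ch.U₀ ⊓ ch.U₁))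
        (resO inf_le_left ch.t : Γ(X, ch.U₀ ⊓ ch.U₁)) P.natDegree P le_rfl)
    rw [map_mul, map_pow, germToFunctionField_resO] at h1
    have h2 : ch.ratFun Polynomial.X = X.germToFunctionField ch.U₀ ch.t :=
      congrArg _ (eval₂_X _ _)
    have h3 (U : X.Opens) [Nonempty U] (h : ch.U₀ ⊓ ch.U₁ ≤ U) (a : Γ(X, U)) (Q : K[X]) :
        X.germToFunctionField U (evalSection f a Q) =
          X.germToFunctionField (ch.U₀ ⊓ ch.U₁) (eval₂ (scalars f _) (resO h a) Q) :=
      (germToFunctionField_resO h _).symm.trans (congrArg _ (map_evalSection f h a Q))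
    rw [h2, h3 _ inf_le_right]
    exact h1.trans (h3 _ inf_le_left _ _).symm
  rw [← hev, Scheme.ord_mul (left_ne_zero_of_mul (hev ▸
    (map_ne_zero_iff _ ch.ratFun_injective).2 hP)) (pow_ne_zero _ hX), ord_pow hX,
    ord_germToFunctionField hrev, ch.ord_ratFun_X_infinity]
  ring

lemma ord_ratFun_of_mem {P : K[X]} (hP : Irreducible P) {x : X} (hx : x ∈ ch.U₀)
    (hxP : x ∉ X.basicOpen (evalSection f ch.t P)) : Scheme.ord (ch.ratFun P) x = 1 := by
  have := ch.nonempty₀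
  exact ord_evalSection ch.affine₀ ch.bijective₀ hP hx hxP

/-- A rational function whose divisor has finite support and degree zero. -/
def HasDegreeZero (f : X ⟶ Spec (.of K)) (φ : X.functionField) : Prop :=
  (Function.support fun x => Scheme.ord φ x * (f.residueDegree x : ℤ)).Finite ∧
    ∑ᶠ x, Scheme.ord φ x * (f.residueDegree x : ℤ) = 0

/-- Finiteness of the support is carried along because it is what makes `finsum` additive. -/
lemma HasDegreeZero.mul {φ ψ : X.functionField} (hφ : HasDegreeZero f φ) (hψ : HasDegreeZero f ψ)
    (hφ0 : φ ≠ 0) (hψ0 : ψ ≠ 0) : HasDegreeZero f (φ * ψ) := by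
  have h : (fun x => Scheme.ord (φ * ψ) x * (f.residueDegree x : ℤ)) = fun x =>
      Scheme.ord φ x * (f.residueDegree x : ℤ) + Scheme.ord ψ x * (f.residueDegree x : ℤ) := by
    ext x
    rw [Scheme.ord_mul hφ0 hψ0, add_mul]
  refine ⟨?_, ?_⟩
  · rw [h]
    exact (hφ.1.union hψ.1).subset (Function.support_add _ _)
  · rw [h, finsum_add_distrib hφ.1 hψ.1, hφ.2, hψ.2, add_zero]

lemma HasDegreeZero.of_mul {φ ψ : X.functionField} (h : HasDegreeZero f (φ * ψ))
    (hψ : HasDegreeZero f ψ) (hφ0 : φ ≠ 0) (hψ0 : ψ ≠ 0) : HasDegreeZero f φ := by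
  have h1 : (fun x => Scheme.ord φ x * (f.residueDegree x : ℤ)) = fun x =>
      Scheme.ord (φ * ψ) x * (f.residueDegree x : ℤ) -
        Scheme.ord ψ x * (f.residueDegree x : ℤ) := by
    ext x
    rw [Scheme.ord_mul hφ0 hψ0]
    ring
  refine ⟨?_, ?_⟩
  · rw [h1]
    exact (h.1.union hψ.1).subset (Function.support_sub _ _)
  · rw [h1, finsum_sub_distrib h.1 hψ.1, h.2, hψ.2, sub_zero]

/-- The divisor consists of a simple zero at a point of residue degree `deg P` and a pole of order
`deg P` at infinity, of residue degree one. -/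
lemma hasDegreeZero_ratFun_of_irreducible {P : K[X]} (hP : Irreducible P) :
    HasDegreeZero f (ch.ratFun P) := by
  have := ch.nonempty₀
  obtain ⟨y, hy, hyP⟩ := exists_notMem_basicOpen ch.affine₀ ch.bijective₀ hP
  have hy' : ch.infinity ≠ y := fun h => ch.infinity_notMem (h ▸ hy)
  classical
  have h : (fun x => Scheme.ord (ch.ratFun P) x * (f.residueDegree x : ℤ)) =
      Pi.single y (P.natDegree : ℤ) + Pi.single ch.infinity (-P.natDegree : ℤ) := by
    ext x
    by_cases hx : x ∈ ch.U₀
    · have hx' : x ≠ ch.infinity := fun h => ch.infinity_notMem (h ▸ hx)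
      by_cases hxP : x ∈ X.basicOpen (evalSection f ch.t P)
      · have hxy : x ≠ y := fun h => hyP (h ▸ hxP)
        have h1 : Scheme.ord (ch.ratFun P) x = 0 := ord_germToFunctionField hxP
        simp [h1, hxy, hx']
      · obtain rfl := eq_of_notMem_basicOpen ch.affine₀ ch.bijective₀ hP hx hxP hy hyP
        rw [ch.ord_ratFun_of_mem hP hx hxP,
          residueDegree_evalSection ch.affine₀ ch.bijective₀ hP hx hxP]
        simp [hx']
    · obtain rfl := ch.eq_infinity hx
      rw [ch.ord_ratFun_infinity hP.ne_zero, ch.residueDegree_infinity]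
      simp [hy']
  have hfin (z : X) (n : ℤ) : (Function.support (Pi.single z n : X → ℤ)).Finite :=
    (Set.finite_singleton z).subset Pi.support_single_subset
  have hsum (z : X) (n : ℤ) : ∑ᶠ x, (Pi.single z n : X → ℤ) x = n := by
    rw [finsum_eq_single _ z fun x hx => Pi.single_eq_of_ne hx _, Pi.single_eq_same]
  refine ⟨?_, ?_⟩
  · rw [h]
    exact ((hfin _ _).union (hfin _ _)).subset (Function.support_add _ _)
  · rw [h]
    refine (finsum_add_distrib (hfin _ _) (hfin _ _)).trans ?_
    rw [hsum, hsum, add_neg_cancel]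

lemma hasDegreeZero_ratFun {P : K[X]} (hP : P ≠ 0) : HasDegreeZero f (ch.ratFun P) := by
  induction P using WfDvdMonoid.induction_on_irreducible with
  | zero => exact (hP rfl).elim
  | unit u hu =>
    obtain ⟨c, hc, rfl⟩ := Polynomial.isUnit_iff.1 hu
    simp [HasDegreeZero, ch.ord_ratFun_C hc.ne_zero]
  | mul a i ha hi ih =>
    rw [map_mul]
    exact (ch.hasDegreeZero_ratFun_of_irreducible hi).mul (ih ha)
      ((map_ne_zero_iff _ ch.ratFun_injective).2 hi.ne_zero)
      ((map_ne_zero_iff _ ch.ratFun_injective).2 ha)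

/-- The divisor of a rational function on the projective line has degree zero. -/
theorem hasDegreeZero (ch : ProjectiveLineCharts f) {φ : X.functionField} (hφ : φ ≠ 0) : HasDegreeZero f φ := by
  obtain ⟨P, Q, hQ, h⟩ := ch.exists_ratFun_div φ
  have hQ' : ch.ratFun Q ≠ 0 := (map_ne_zero_iff _ ch.ratFun_injective).2 hQ
  have hP : P ≠ 0 := by
    rintro rfl
    rw [map_zero] at h
    exact mul_ne_zero hφ hQ' h
  exact .of_mul (h ▸ ch.hasDegreeZero_ratFun hP) (ch.hasDegreeZero_ratFun hQ) hφ hQ'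

variable {r : ℕ}

/-- The determinant is the product of the `t ^ n i`, and `t` has order `-1` at infinity. -/
lemma ord_transitionDet_infinity {E : X.Modules} {n : Fin r → ℤ} {e : Fin r → Γ(E, ch.U₀)}
    {b : Fin r → Γ(E, ch.U₁)} (hb : IsFrame E b)
    (h : ∀ i, res E inf_le_left (e i) =
      ((ch.unit ^ n i : Γ(X, ch.U₀ ⊓ ch.U₁)ˣ) : Γ(X, ch.U₀ ⊓ ch.U₁)) • res E inf_le_right (b i)) :
    Scheme.ord (transitionDet ch.nonempty₀ ch.nonempty₁ e hb) ch.infinity = -∑ i, n i := by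
  have := ch.nonempty₀
  have := ch.nonempty_inf'
  have h1 : X.germToFunctionField (ch.U₀ ⊓ ch.U₁) (ch.unit : Γ(X, ch.U₀ ⊓ ch.U₁)) =
      ch.ratFun Polynomial.X :=
    (germToFunctionField_resO inf_le_left ch.t).trans (congrArg _ (eval₂_X _ _).symm)
  -- As a homomorphism on units, the order commutes with the integer powers, negative ones included.
  let L : Γ(X, ch.U₀ ⊓ ch.U₁)ˣ →* Multiplicative ℤ :=
    MonoidHom.mk' (fun u => .ofAdd <| Scheme.ord
      (X.germToFunctionField (ch.U₀ ⊓ ch.U₁) (u : Γ(X, ch.U₀ ⊓ ch.U₁))) ch.infinity) fun u v => by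
        have h0 (w : Γ(X, ch.U₀ ⊓ ch.U₁)ˣ) : X.germToFunctionField (ch.U₀ ⊓ ch.U₁)
            (w : Γ(X, ch.U₀ ⊓ ch.U₁)) ≠ 0 :=
          (w.isUnit.map (X.germToFunctionField (ch.U₀ ⊓ ch.U₁)).hom).ne_zero
        rw [Units.val_mul, map_mul, Scheme.ord_mul (h0 u) (h0 v), ofAdd_add]
  have hL : L ch.unit = .ofAdd (-1) :=
    congrArg Multiplicative.ofAdd ((congrArg (Scheme.ord · _) h1).trans ch.ord_ratFun_X_infinity)
  have h2 : L (∏ i, ch.unit ^ n i) = .ofAdd (-∑ i, n i) := by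
    simp only [map_prod, map_zpow, hL]
    rw [← Finset.sum_neg_distrib, ofAdd_sum]
    refine Finset.prod_congr rfl fun i _ => ?_
    rw [← ofAdd_zsmul, smul_eq_mul, mul_neg_one]
  rw [transitionDet_of_smul ch.nonempty₀ ch.nonempty₁ hb h, ← Units.coe_prod]
  exact congrArg Multiplicative.toAdd h2

variable {ch}

/-- The frame over `U₀` gives a rational section of the determinant whose divisor is concentrated at
infinity. -/
lemma IsSplit.hasDegree {E : X.Modules} {n : Fin r → ℤ} (h : ch.IsSplit E n) :
    HasDegree f E r (-∑ i, n i) := by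
  classical
  obtain ⟨e, b, he, hb, heb⟩ := h
  refine ⟨inferInstance, inferInstance, ch.U₀, ch.nonempty₀, e,
    Pi.single ch.infinity (-∑ i, n i), he, fun x V hx b' hb' => ?_, ?_⟩
  · by_cases hx₀ : x ∈ ch.U₀
    · have hx' : x ≠ ch.infinity := fun h => ch.infinity_notMem (h ▸ hx₀)
      rw [Pi.single_eq_of_ne hx', ord_transitionDet _ _ he hb' hx₀ hx]
    · obtain rfl := ch.eq_infinity hx₀
      rw [Pi.single_eq_same, ← transitionDet_mul ch.nonempty₀ ch.nonempty₁ ⟨⟨_, hx⟩⟩ he hb hb',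
        Scheme.ord_mul (transitionDet_ne_zero _ _ he hb) (transitionDet_ne_zero _ _ hb hb'),
        ch.ord_transitionDet_infinity hb heb, ord_transitionDet _ _ hb hb' ch.infinity_mem hx,
        add_zero]
  · rw [finsum_eq_single _ ch.infinity fun x hx => by rw [Pi.single_eq_of_ne hx, zero_mul],
      Pi.single_eq_same, ch.residueDegree_infinity, Nat.cast_one, mul_one]

/-- `HasDegree` only asserts some frame with the right divisor. Its divisor and that of `e` differ
by the divisor of a rational function, which has degree zero. -/
lemma IsSplit.eq_of_hasDegree {E : X.Modules} {n : Fin r → ℤ} (h : ch.IsSplit E n) {d : ℤ}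
    (hd : HasDegree f E r d) : d = -∑ i, n i := by
  classical
  obtain ⟨e, b, he, hb, heb⟩ := h
  obtain ⟨_, _, U, hU, e', D, he', hD, rfl⟩ := hd
  let φ := transitionDet hU ch.nonempty₀ e' he
  have hφ : φ ≠ 0 := transitionDet_ne_zero _ _ he' he
  have h1 : (fun x => D x * (f.residueDegree x : ℤ)) =
      (fun x => Scheme.ord φ x * (f.residueDegree x : ℤ)) +
        Pi.single ch.infinity (-∑ i, n i) := by
    ext x
    by_cases hx : x ∈ ch.U₀
    · have hx' : x ≠ ch.infinity := fun h => ch.infinity_notMem (h ▸ hx)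
      rw [hD x ch.U₀ hx e he, Pi.add_apply, Pi.single_eq_of_ne hx', add_zero]
    · obtain rfl := ch.eq_infinity hx
      rw [hD _ ch.U₁ ch.infinity_mem b hb, Pi.add_apply, Pi.single_eq_same,
        ← transitionDet_mul hU ch.nonempty₀ ch.nonempty₁ he' he hb,
        Scheme.ord_mul hφ (transitionDet_ne_zero _ _ he hb), ch.ord_transitionDet_infinity hb heb,
        ch.residueDegree_infinity, Nat.cast_one, mul_one, mul_one]
  have hfin := ch.hasDegreeZero hφ
  rw [h1]
  refine (finsum_add_distrib hfin.1
    ((Set.finite_singleton ch.infinity).subset Pi.support_single_subset)).trans ?_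
  rw [hfin.2, zero_add, finsum_eq_single _ ch.infinity fun x hx => Pi.single_eq_of_ne hx _,
    Pi.single_eq_same]

end FunctionField

end ProjectiveLineCharts

/-! ### Descent of split bundles. -/

section Descent

variable {k K : Type u} [Field k] [Field K] {φ : k →+* K} {X X' : Scheme.{u}}
  {f : X ⟶ Spec (.of k)} {g : X' ⟶ Spec (.of K)} {π : X' ⟶ X} {ch : ProjectiveLineCharts f} {r : ℕ}

lemma ProjectiveLineCharts.app_unit (h : IsPullback π g f (Spec.map (CommRingCat.ofHom φ))) (n : ℤ) :
    π.app (ch.U₀ ⊓ ch.U₁) ((ch.unit ^ n : Γ(X, ch.U₀ ⊓ ch.U₁)ˣ) : Γ(X, ch.U₀ ⊓ ch.U₁)) =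
      (((ch.baseChange h).unit ^ n :
        Γ(X', (ch.baseChange h).U₀ ⊓ (ch.baseChange h).U₁)ˣ) :
          Γ(X', (ch.baseChange h).U₀ ⊓ (ch.baseChange h).U₁)) := by
  have h1 : Units.map (π.app (ch.U₀ ⊓ ch.U₁)).hom.toMonoidHom ch.unit = (ch.baseChange h).unit :=
    Units.ext (app_resO inf_le_left ch.t)
  have h2 := map_zpow (Units.map (π.app (ch.U₀ ⊓ ch.U₁)).hom.toMonoidHom) ch.unit n
  exact congrArg Units.val (h2.trans (congrArg (· ^ n) h1))

/-- Split bundles with the same exponents correspond to each other under base change. -/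
lemma ProjectiveLineCharts.IsSplit.nonempty_pullback_iso
    (h : IsPullback π g f (Spec.map (CommRingCat.ofHom φ))) {E : X.Modules} {E' : X'.Modules}
    {n : Fin r → ℤ} (hE : ch.IsSplit E n) (hE' : (ch.baseChange h).IsSplit E' n) :
    Nonempty ((Scheme.Modules.pullback π).obj E ≅ E') := by
  obtain ⟨e, b, he, hb, heb⟩ := hE
  obtain ⟨e', b', he', hb', heb'⟩ := hE'
  refine CurveBundles.nonempty_pullback_iso π ch.cover he hb heb he' hb' fun i => ?_
  rw [app_unit h]
  exact heb' i

end Descent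

/-! ### Fields of definition and essential dimension. -/

section EssentialDimension

variable {k : Type u} [Field k] {C : Scheme.{u}} (f : C ⟶ Spec (.of k))

lemma isPullback_baseChange (K : Type u) [Field K] [Algebra k K] :
    IsPullback (baseChangeFst f K) (baseChangeStr f K) f
      (Spec.map (CommRingCat.ofHom (algebraMap k K))) :=
  .of_hasPullback _ _

lemma isPullback_baseChangeMap (K' K : Type u) [Field K'] [Field K] [Algebra k K'] [Algebra k K]
    [Algebra K' K] [IsScalarTower k K' K] :
    IsPullback (baseChangeMap f K' K) (baseChangeStr f K) (baseChangeStr f K')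
      (Spec.map (CommRingCat.ofHom (algebraMap K' K))) := by
  refine .of_right ?_ (Limits.pullback.lift_snd _ _ _) (isPullback_baseChange f K')
  rw [← Spec.map_comp, ← CommRingCat.ofHom_comp, ← IsScalarTower.algebraMap_eq]
  have h1 : baseChangeMap f K' K ≫ baseChangeFst f K' = baseChangeFst f K :=
    Limits.pullback.lift_fst _ _ _
  rw [h1]
  exact isPullback_baseChange f K

variable {f}

lemma ProjectiveLineCharts.IsSplit.isBun {K : Type u} [Field K] [Algebra k K] {r : ℕ}
    {n : Fin r → ℤ} {ch : ProjectiveLineCharts (baseChangeStr f K)}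
    {E : (CurveBundles.baseChange f K).Modules} (hE : ch.IsSplit E n) :
    IsBun f r (-∑ i, n i) K E :=
  have := ch.isIntegral
  have := ch.isLocallyNoetherian
  ⟨hE.isVectorBundle, hE.hasDegree⟩

/-- The bundle with the same exponents over `C_{K'}` pulls back to `E`. Its degree depends only on
the exponents, so it has the required degree `d`. -/
lemma ProjectiveLineCharts.isDefinedOver (ch : ProjectiveLineCharts f) {K : Type u} [Field K]
    [Algebra k K] {r : ℕ} {d : ℤ} {E : (CurveBundles.baseChange f K).Modules}
    (hE : IsBun f r d K E) (K' : IntermediateField k K) : IsDefinedOver f r d E K' := by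
  let ch' := ch.baseChange (isPullback_baseChange f K')
  have h := isPullback_baseChangeMap f K' K
  have := (ch'.baseChange h).isIntegral
  have := (ch'.baseChange h).isLocallyNoetherian
  obtain ⟨n, hn⟩ := (ch'.baseChange h).exists_isSplit_of_isVectorBundle hE.1
  obtain rfl := hn.eq_of_hasDegree hE.2
  obtain ⟨E', hE'⟩ := ch'.exists_isSplit n
  exact ⟨E', hE'.isBun, hE'.nonempty_pullback_iso h hn⟩

theorem ProjectiveLineCharts.essDimBun_eq_zero (ch : ProjectiveLineCharts f) {r : ℕ} (hr : 1 ≤ r)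
    (d : ℤ) : essDimBun f r d = 0 := by
  refine le_antisymm ?_ ?_
  · refine iSup_le fun K => iSup_le fun _ => iSup_le fun _ => iSup_le fun E => iSup_le fun hE => ?_
    have h1 : essDimObj f r d E ≤ 0 := by
      refine (iInf₂_le (⊥ : IntermediateField k K) (ch.isDefinedOver hE ⊥)).trans ?_
      rw [trdeg_eq_zero, map_zero]
    exact_mod_cast h1
  -- The sign is due to the degree being `-∑ i, n i`; `1 ≤ r` provides the index `0`. One object
  -- suffices, since it excludes the value `⊥`.
  · let n : Fin r → ℤ := Pi.single ⟨0, hr⟩ (-d)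
    obtain ⟨E, hE⟩ := (ch.baseChange (isPullback_baseChange f k)).exists_isSplit n
    have hE' := hE.isBun
    have hn : -∑ i, n i = d := by simp [n]
    rw [hn] at hE'
    refine le_trans ?_ (le_iSup_of_le k <| le_iSup_of_le inferInstance <|
      le_iSup_of_le inferInstance <| le_iSup_of_le E <| le_iSup_of_le hE' le_rfl)
    exact_mod_cast (zero_le : 0 ≤ essDimObj f r d E)

theorem exists_charts_of_genus_eq_zero [SmoothOfRelativeDimension 1 f] (hproj : IsProjective f)
    [IrreducibleSpace C] (hpoint : ∃ s : Spec (.of k) ⟶ C, s ≫ f = 𝟙 _) (hgenus : genus f = 0) :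
    Nonempty (ProjectiveLineCharts f) := by
  have := hproj.isProper
  have := isIntegral_of_smoothCurve f
  obtain ⟨p, hp⟩ := exists_isRationalPoint f hpoint
  exact exists_projectiveLineCharts hp hgenus

theorem ProjectiveLineCharts.exists_iso_pullback (ch : ProjectiveLineCharts f) {K : Type u}
    [Field K] [Algebra k K] {r : ℕ} {E : (CurveBundles.baseChange f K).Modules}
    (hE : IsVectorBundle E r) : ∃ E₀ : C.Modules, IsVectorBundle E₀ r ∧
      Nonempty ((Scheme.Modules.pullback (baseChangeFst f K)).obj E₀ ≅ E) := by
  have h := isPullback_baseChange f K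
  obtain ⟨n, hn⟩ := (ch.baseChange h).exists_isSplit_of_isVectorBundle hE
  obtain ⟨E₀, hE₀⟩ := ch.exists_isSplit n
  exact ⟨E₀, hE₀.isVectorBundle, hE₀.nonempty_pullback_iso h hn⟩

end EssentialDimension

end CurveBundles

theorem mainTheorem12 (k : Type u) [Field k] (C : Scheme.{u}) (f : C ⟶ Spec (.of k))
    (hsmooth : SmoothOfRelativeDimension 1 f) (hproj : CurveBundles.IsProjective f)
    (hirr : IrreducibleSpace C) (hpoint : ∃ s : Spec (.of k) ⟶ C, s ≫ f = 𝟙 _)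
    (hgenus : CurveBundles.genus f = 0) :
    (∀ (K : Type u) [Field K] [Algebra k K] (r : ℕ)
      (E : (CurveBundles.baseChange f K).Modules), CurveBundles.IsVectorBundle E r →
      ∃ E₀ : C.Modules, CurveBundles.IsVectorBundle E₀ r ∧
        Nonempty ((Scheme.Modules.pullback (CurveBundles.baseChangeFst f K)).obj E₀ ≅ E)) ∧
    ∀ (r : ℕ) (d : ℤ), 1 ≤ r → CurveBundles.essDimBun f r d = 0 := by
  obtain ⟨ch⟩ := CurveBundles.exists_charts_of_genus_eq_zero hproj hpoint hgenus
  exact ⟨fun K _ _ r E hE => ch.exists_iso_pullback hE, fun r d hr => ch.essDimBun_eq_zero hr d⟩
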